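/- **Setting.** Let $\mathcal X\subset\mathbb R^{d_1}$ and $\mathcal Y\subset\mathbb R^{d_2}$ be Lebesgue measurable with $\|x\|_2\le c_1$ on $\mathcal X$ and $\|y\|_2\le c_2$ on $\mathcal Y$. Let $\mu$ be Lebesgue measure on $\mathcal Y$, or the counting measure if $\mathcal Y$ is finite. Let $(x,y)$ be a random pair in $\mathcal X\times\mathcal Y$ such that $y$ has a conditional density $p(y\mid x)$ given $x$ with respect to $\mu$, and let $\hat S=\{(x_i,y_i)\}_{i=1}^n$, $n\ge1$, be an i.i.d. sample of this pair. Let $L\ge1$, let $\sigma:\mathbb R\to\mathbb R$ be positively homogeneous and 1-Lipschitz, and let $E_1(w_1;x)=\sigma(W_{1,L}\sigma(\cdots\sigma(W_{1,1}x)))$ and $E_2(w_2;y)=\sigma(W_{2,L}\sigma(\cdots\sigma(W_{2,1}y)))$ be $L$-layer networks with values in $\mathbb R^{d_L}$, $d_L\ge1$ ($\sigma$ acts coordinatewise). Call $w=(w_1,w_2)$ admissible if $\|W_{1,l}\|_F\le B_l$ and $\|W_{2,l}\|_F\le B_l$ for all $l\le L$, $\|E_1(w_1;x)\|_2\le1$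 on $\mathcal X$, and $\|E_2(w_2;y)\|_2\le1$ on $\mathcal Y$. Put $E_w(x,y)=E_1(w_1;x)^\top E_2(w_2;y)$ and, for a temperature $\tau>0$, $$\mathcal L(w)=\mathbb E_{x,y}\Big[-\tau\log\frac{\exp(E_w(x,y)/\tau)}{\int_{\mathcal Y}\exp(E_w(x,y')/\tau)\,d\mu(y')}\Big].$$ Put $q^{(j)}=\sum_{j'=1}^n p(y_j\mid x_{j'})$ and, for $\tilde q\in(0,\infty)^n$, $$\hat{\mathcal L}(w;\tilde q,\hat S)=-\frac1n\sum_{i=1}^n\tau\log\frac{\exp(E_w(x_i,y_i)/\tau)}{\sum_{j=1}^n\exp(E_w(x_i,y_j)/\tau)/\tilde q^{(j)}},$$ $$\mathcal E_w(\tilde q,q;\hat S)=\frac1n\sum_{i=1}^n\sum_{j=1}^n\Big|\frac1{\tilde q^{(j)}}-\frac1{q^{(j)}}\Big|\exp\big((E_w(x_i,y_i)-1)/\tau\big).$$ **Theorem 1.** (a) For all $c,K,m>0$ there is a constant $C>0$, depending only on $\tau,L,c_1,c_2,(B_l)_l,c,K,m$, such that the following holds whenever $\mu(\mathcal Y)\ge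 m$. Assume that $q^{(j)}\ge c\,n$ almost surely for every $j$, and that almost surely $\sum_{j'=1}^n p(y\mid x_{j'})>0$ for $\mu$-almost every $y\in\mathcal Y$. Then for every $\delta\in(0,1)$, with probability at least $1-\delta$, simultaneously for all admissible $w$ and all $\tilde q$ (possibly depending on $\hat S$) with $0<\tilde q^{(j)}\le K n$ for all $j$, $$\big|\hat{\mathcal L}(w;\tilde q,\hat S)-\mathcal L(w)\big|\le C\Big(\frac1n+\sqrt{\frac{d_L}n}+\sqrt{\frac{\log(1/\delta)}n}+\mathcal E_w(\tilde q,q;\hat S)\Big).$$ The same bound holds with $E_w(x_i,y_j)$ in place of $E_w(x_i,y_i)$ in $\mathcal E_w$. (b) For the uniform (GCL) choice $\tilde q^{(j)}=n\kappa$, $\kappa>0$, the error term does not vanish: unless the marginal density $\mathbb E_x[p(\cdot\mid x)]$ of $y$, evaluated at $y$, is almost surely equal to $\kappa$, there is $\eta>0$ (depending on the law of $(x,y)$, $\kappa$ and $\tau$) such that the probability that $\mathcal E_w(\tilde q,q;\hat S)\ge\eta$ for all admissible $w$, for both forms of $\mathcal E_w$, tends to $1$ as $n\to\infty$. -/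

import Mathlib

open MeasureTheory Filter Topology

namespace DPM

/-- Euclidean space `ℝ^d` with the `ℓ²` norm. -/
abbrev Vec (d : ℕ) : Type := EuclideanSpace ℝ (Fin d)

/-- The reference measure `μ` on a data space `Y ⊆ ℝ^d`: the counting measure when `Y` is finite,
and Lebesgue measure on `Y` otherwise. -/
noncomputable def refMeasure {d : ℕ} (Y : Set (Vec d)) : Measure (Vec d) :=
  open Classical in
  if Y.Finite then Measure.count.restrict Y else volume.restrict Y

/-! ### Encoder networks -/

/-- Weight matrices of a network whose layer `l + 1` maps `ℝ^(d l)` to `ℝ^(d (l + 1))`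
(a network with `L` layers only uses the matrices with index `l < L`). -/
abbrev Weights (d : ℕ → ℕ) : Type :=
  (l : ℕ) → Matrix (Fin (d (l + 1))) (Fin (d l)) ℝ

/-- The network `x ↦ σ (W_L σ (W_{L-1} ⋯ σ (W_1 x)))` with `L` layers,
where `σ` acts on each coordinate. -/
def net (σ : ℝ → ℝ) (d : ℕ → ℕ) (W : Weights d) : (L : ℕ) → Vec (d 0) → Vec (d L)
  | 0, x => x
  | L + 1, x => WithLp.toLp 2 fun i => σ ((W L).mulVec (net σ d W L x).ofLp i)

section Frobenius

attribute [local instance] Matrix.frobeniusNormedAddCommGroup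

/-- The Frobenius norm of a matrix. -/
noncomputable def frobNorm {m k : ℕ} (A : Matrix (Fin m) (Fin k) ℝ) : ℝ := ‖A‖

end Frobenius

/-- The weights that are allowed for an `L`-layer encoder on the data space `X`:
the matrix of layer `l + 1` has Frobenius norm at most `B l`,
and the output has norm at most `1` at every point of `X`. -/
def encoders (σ : ℝ → ℝ) (L : ℕ) (B : ℕ → ℝ) (d : ℕ → ℕ) (X : Set (Vec (d 0))) :
    Set (Weights d) :=
  {W | (∀ l < L, frobNorm (W l) ≤ B l) ∧ ∀ x ∈ X, ‖net σ d W L x‖ ≤ 1}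

/-- The prediction function `E_w(x, y) = E₁(w₁; x)ᵀ E₂(w₂; y)` of two `L`-layer encoders with the
same output dimension. -/
def energy (σ : ℝ → ℝ) (L : ℕ) {d₁ d₂ : ℕ → ℕ} (hd : d₁ L = d₂ L)
    (W₁ : Weights d₁) (W₂ : Weights d₂) (x : Vec (d₁ 0)) (y : Vec (d₂ 0)) : ℝ :=
  ∑ i : Fin (d₁ L), net σ d₁ W₁ L x i * net σ d₂ W₂ L y (Fin.cast hd i)

/-! ### The data -/

/-- `P` is a joint law of pairs `(x, y)` with `x ∈ X` and `y ∈ Y`,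
and `p x y = p(y ∣ x)` is the conditional density of `y` given `x` with respect to
the reference measure of `Y`. -/
structure IsDataModel {a b : ℕ} (X : Set (Vec a)) (Y : Set (Vec b))
    (P : Measure (Vec a × Vec b)) (p : Vec a → Vec b → ℝ) : Prop where
  nullMeasurable_X : NullMeasurableSet X volume
  nullMeasurable_Y : NullMeasurableSet Y volume
  isProbabilityMeasure : IsProbabilityMeasure P
  ae_mem : ∀ᵐ z ∂P, z.1 ∈ X
  measurable_density : Measurable (Function.uncurry p)
  density_nonneg : ∀ x y, 0 ≤ p x y
  eq_withDensity :
    P = (P.fst.prod (refMeasure Y)).withDensity fun z => ENNReal.ofReal (p z.1 z.2)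

/-- `∑_{j'} p(y ∣ x_{j'})` for a sample `S = ((x_1, y_1), …, (x_n, y_n))`. -/
def densitySum {a b n : ℕ} (p : Vec a → Vec b → ℝ) (S : Fin n → Vec a × Vec b)
    (y : Vec b) : ℝ :=
  ∑ j' : Fin n, p (S j').1 y

/-- The popularity `q^{(j)} = ∑_{j'} p(y_j ∣ x_{j'})`. -/
def popularity {a b n : ℕ} (p : Vec a → Vec b → ℝ) (S : Fin n → Vec a × Vec b)
    (j : Fin n) : ℝ :=
  densitySum p S (S j).2

/-! ### Risks and error terms -/

/-- The partition function `g(w; x, Y) = ∫_Y exp(E_w(x, y') / τ) dμ(y')`. -/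
noncomputable def partitionFn {a b : ℕ} (τ : ℝ) (Y : Set (Vec b)) (E : Vec a → Vec b → ℝ)
    (x : Vec a) : ℝ :=
  ∫ y, Real.exp (E x y / τ) ∂(refMeasure Y)

/-- The true risk `𝓛(w) = 𝔼[-τ log (exp(E_w(x, y) / τ) / g(w; x, Y))]`. -/
noncomputable def trueRisk {a b : ℕ} (τ : ℝ) (Y : Set (Vec b)) (P : Measure (Vec a × Vec b))
    (E : Vec a → Vec b → ℝ) : ℝ :=
  ∫ z, -(τ * Real.log (Real.exp (E z.1 z.2 / τ) / partitionFn τ Y E z.1)) ∂P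

/-- The estimator `g̃(w; x) = ∑_j exp(E_w(x, y_j) / τ) / q̃^{(j)}` of the partition function. -/
noncomputable def misPartitionFn {a b n : ℕ} (τ : ℝ) (E : Vec a → Vec b → ℝ)
    (qt : Fin n → ℝ) (S : Fin n → Vec a × Vec b) (x : Vec a) : ℝ :=
  ∑ j : Fin n, Real.exp (E x (S j).2 / τ) / qt j

/-- The empirical risk
`𝓛̂(w; q̃, Ŝ) = -(1/n) ∑_i τ log (exp(E_w(x_i, y_i) / τ) / g̃(w; x_i))`. -/
noncomputable def empRisk {a b n : ℕ} (τ : ℝ) (E : Vec a → Vec b → ℝ)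
    (qt : Fin n → ℝ) (S : Fin n → Vec a × Vec b) : ℝ :=
  -(1 / (n : ℝ)) * ∑ i : Fin n,
    τ * Real.log (Real.exp (E (S i).1 (S i).2 / τ) / misPartitionFn τ E qt S (S i).1)

/-- The error term
`(1/n) ∑_i ∑_j |1 / q̃^{(j)} - 1 / q^{(j)}| exp((E_w(x_i, y_i) - 1) / τ)`. -/
noncomputable def errTerm {a b n : ℕ} (τ : ℝ) (E : Vec a → Vec b → ℝ)
    (qt q : Fin n → ℝ) (S : Fin n → Vec a × Vec b) : ℝ :=
  (1 / (n : ℝ)) * ∑ i : Fin n, ∑ j : Fin n,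
    |1 / qt j - 1 / q j| * Real.exp ((E (S i).1 (S i).2 - 1) / τ)

/-- The variant
`(1/n) ∑_i ∑_j |1 / q̃^{(j)} - 1 / q^{(j)}| exp((E_w(x_i, y_j) - 1) / τ)` of the error term,
where the exponential is taken at the pair `(x_i, y_j)`. -/
noncomputable def errTermCross {a b n : ℕ} (τ : ℝ) (E : Vec a → Vec b → ℝ)
    (qt q : Fin n → ℝ) (S : Fin n → Vec a × Vec b) : ℝ :=
  (1 / (n : ℝ)) * ∑ i : Fin n, ∑ j : Fin n,
    |1 / qt j - 1 / q j| * Real.exp ((E (S i).1 (S j).2 - 1) / τ)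

end DPM

/-! Part (a). Up to the factor `1/n` and signs, the gap between empirical and true risk is a sum of
three terms: the centred sum of `E(x_j, y_j)`, `τ` times the centred sum of the log-partition
function at the `x_j`, and `τ` times the sum over `i` of `log g̃(x_i) - log g(x_i)`
(`abs_empRisk_sub_trueRisk_le`). Both `g̃` and `g` are bounded below, so the logarithm is Lipschitz
there. The third term is then controlled by the weight error `|1/q̃ - 1/q|` and by the deviation of
the estimator with the true popularities `q`.

That estimator is importance sampling. Given all `x_j`, the `y_j` are independent with densities
`p(· ∣ x_j)`, and `∑_j p(y ∣ x_j) / q(y) = 1`, so its conditional mean is exactly `g`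
(`IsDataModel.sum_integral_condLaw`). The points `x_i` at which it is evaluated belong to the same
sample. This does no harm, since `E₁(x_i)` is a vector of the unit ball and the deviation is bounded
uniformly over that ball (`measure_partitionFn_deviation_le`).

The three uniform deviations come from one inequality, `measure_exists_lt_abs_sum_le`, for
independent but not identically distributed variables: bounded differences plus symmetrization. The
Rademacher sums are of order `√n`, independently of all widths. Positive homogeneity allows each
layer to be peeled off at the cost of its Frobenius norm (`normRademacherLE_net`). The last layers
of the two networks are peeled together, and the product of the remaining scalar functions is
handled by polarization (`rademacherLE_energy`). Hence `d_L` enters only through `1 ≤ d_L`.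

Part (b). For `q̃ = nκ` the error term dominates a multiple of the average of `|1/κ - n/q^{(j)}|`.
By the law of large numbers `q^{(j)}/n` approaches the marginal density at `y_j`, so the average,
truncated at `1`, approaches the mean of `recipGap κ` of the marginal density. That mean is positive
unless the density is almost surely `κ`. Markov's inequality controls the first approximation and a
lower tail bound the second (`exists_tendsto_measure_errTerm_lt`). -/

namespace DPM

/-! ### Averages over signs and Rademacher complexities -/

/-- The average of `F` over all vectors of `n` signs. -/
noncomputable def signAvg : (n : ℕ) → ((Fin n → ℝ) → ℝ) → ℝ
  | 0, F => F Fin.elim0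
  | n + 1, F => (signAvg n (fun ε => F (Fin.cons 1 ε)) + signAvg n (fun ε => F (Fin.cons (-1) ε))) / 2

theorem signAvg_mono {n : ℕ} {F G : (Fin n → ℝ) → ℝ} (h : ∀ ε, F ε ≤ G ε) :
    signAvg n F ≤ signAvg n G := by
  induction n with
  | zero => exact h _
  | succ n ih =>
    have h₁ := ih (fun ε => h (Fin.cons 1 ε))
    have h₂ := ih (fun ε => h (Fin.cons (-1) ε))
    simp only [signAvg]
    linarith

theorem signAvg_add {n : ℕ} (F G : (Fin n → ℝ) → ℝ) :
    signAvg n (fun ε => F ε + G ε) = signAvg n F + signAvg n G := by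
  induction n with
  | zero => rfl
  | succ n ih => simp only [signAvg, ih]; ring

theorem signAvg_const_mul {n : ℕ} (c : ℝ) (F : (Fin n → ℝ) → ℝ) :
    signAvg n (fun ε => c * F ε) = c * signAvg n F := by
  induction n with
  | zero => rfl
  | succ n ih => simp only [signAvg, ih]; ring

theorem sq_signAvg_le {n : ℕ} (F : (Fin n → ℝ) → ℝ) :
    signAvg n F ^ 2 ≤ signAvg n fun ε => F ε ^ 2 := by
  induction n with
  | zero => exact le_rfl
  | succ n ih =>
    have h₁ := ih (fun ε => F (Fin.cons 1 ε))
    have h₂ := ih (fun ε => F (Fin.cons (-1) ε))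
    simp only [signAvg]
    nlinarith [sq_nonneg (signAvg n (fun ε => F (Fin.cons 1 ε))
      - signAvg n (fun ε => F (Fin.cons (-1) ε)))]

/-- The cross terms of the two values of each sign cancel. The offset `a` collects the summands
whose signs are already fixed in the induction. -/
theorem signAvg_norm_sq {H : Type*} [NormedAddCommGroup H] [InnerProductSpace ℝ H]
    {n : ℕ} (a : H) (x : Fin n → H) :
    signAvg n (fun ε => ‖a + ∑ j, ε j • x j‖ ^ 2) = ‖a‖ ^ 2 + ∑ j, ‖x j‖ ^ 2 := by
  induction n generalizing a with
  | zero => simp [signAvg]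
  | succ n ih =>
    simp only [signAvg, Fin.sum_univ_succ, Fin.cons_zero, Fin.cons_succ, ← add_assoc, one_smul,
      neg_smul]
    rw [ih, ih, ← sub_eq_add_neg, norm_add_sq_real, norm_sub_sq_real]
    ring

/-- Jensen's inequality for the square, followed by orthogonality of the signs. This is the base
case of the peeling of layers. -/
theorem signAvg_norm_le {H : Type*} [NormedAddCommGroup H] [InnerProductSpace ℝ H]
    {n : ℕ} (x : Fin n → H) {c : ℝ} (hx : ∀ j, ‖x j‖ ≤ c) (hc : 0 ≤ c) :
    signAvg n (fun ε => ‖∑ j, ε j • x j‖) ≤ c * √n := by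
  have h := sq_signAvg_le fun ε : Fin n → ℝ => ‖∑ j, ε j • x j‖
  have h' := signAvg_norm_sq 0 x
  simp only [zero_add, norm_zero] at h'
  rw [h'] at h
  have hs : ∑ j, ‖x j‖ ^ 2 ≤ ∑ _j : Fin n, c ^ 2 :=
    Finset.sum_le_sum fun j _ => pow_le_pow_left₀ (norm_nonneg _) (hx j) 2
  simp only [Finset.sum_const, Finset.card_univ, Fintype.card_fin, nsmul_eq_mul] at hs
  refine abs_le_of_sq_le_sq' ?_ (by positivity) |>.2
  rw [mul_pow, Real.sq_sqrt (Nat.cast_nonneg n)]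
  nlinarith

/-- The Rademacher sums of the class `f` satisfy `𝔼_ε sup_t ∑_j ε_j f(t)_j ≤ r`; the supremum is
expressed by selections `s` of an index for each vector of signs. -/
def RademacherLE {T : Type*} {n : ℕ} (f : T → Fin n → ℝ) (r : ℝ) : Prop :=
  ∀ s : (Fin n → ℝ) → T, signAvg n (fun ε => ∑ j, ε j * f (s ε) j) ≤ r

/-- The variant `𝔼_ε sup_t |∑_j ε_j f(t)_j| ≤ r` of `RademacherLE`. -/
def AbsRademacherLE {T : Type*} {n : ℕ} (f : T → Fin n → ℝ) (r : ℝ) : Prop :=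
  ∀ s : (Fin n → ℝ) → T, signAvg n (fun ε => |∑ j, ε j * f (s ε) j|) ≤ r

/-- The variant `𝔼_ε sup_t ‖∑_j ε_j z(t)_j‖ ≤ r` of `RademacherLE` for vectors. -/
def NormRademacherLE {T H : Type*} [NormedAddCommGroup H] [InnerProductSpace ℝ H] {n : ℕ}
    (z : T → Fin n → H) (r : ℝ) : Prop :=
  ∀ s : (Fin n → ℝ) → T, signAvg n (fun ε => ‖∑ j, ε j • z (s ε) j‖) ≤ r

/-- The contraction principle, with the supremum replaced by selections. For one coordinate the two
signs contribute `g(t) - g(u)`, which is at most `|f(t) - f(u)|`, and the absolute value is removed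
by exchanging `t` and `u` if necessary. The term `a` carries the coordinate not yet contracted
through the induction. -/
theorem exists_signAvg_contraction {T : Type*} {n : ℕ} (a : T → ℝ) (f g : T → Fin n → ℝ)
    (h : ∀ t u j, |g t j - g u j| ≤ |f t j - f u j|) (s : (Fin n → ℝ) → T) :
    ∃ s' : (Fin n → ℝ) → T, signAvg n (fun ε => a (s ε) + ∑ j, ε j * g (s ε) j) ≤
      signAvg n (fun ε => a (s' ε) + ∑ j, ε j * f (s' ε) j) := by
  classical
  induction n generalizing a with
  | zero => exact ⟨s, by simp⟩
  | succ n ih =>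
    obtain ⟨p, hp⟩ := ih (fun t => a t + g t 0) (fun t j => f t j.succ) (fun t j => g t j.succ)
      (fun t u j => h t u j.succ) (fun ε => s (Fin.cons 1 ε))
    obtain ⟨q, hq⟩ := ih (fun t => a t - g t 0) (fun t j => f t j.succ) (fun t j => g t j.succ)
      (fun t u j => h t u j.succ) (fun ε => s (Fin.cons (-1) ε))
    -- The positive sign receives whichever of the two selected indices has the larger value of `f ·
    -- 0`.
    let p' : (Fin n → ℝ) → T := fun ε => if f (q ε) 0 ≤ f (p ε) 0 then p ε else q ε
    let q' : (Fin n → ℝ) → T := fun ε => if f (q ε) 0 ≤ f (p ε) 0 then q ε else p ε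
    refine ⟨fun η => if η 0 = 1 then p' (Fin.tail η) else q' (Fin.tail η), ?_⟩
    have hne : (-1 : ℝ) ≠ 1 := by norm_num
    simp only [signAvg, Fin.sum_univ_succ, Fin.cons_zero, Fin.cons_succ, Fin.tail_cons, if_true,
      if_neg hne, one_mul, neg_mul]
    have key : signAvg n (fun ε => a (p ε) + g (p ε) 0 + ∑ j, ε j * f (p ε) j.succ)
        + signAvg n (fun ε => a (q ε) - g (q ε) 0 + ∑ j, ε j * f (q ε) j.succ)
        ≤ signAvg n (fun ε => a (p' ε) + (f (p' ε) 0 + ∑ j, ε j * f (p' ε) j.succ))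
        + signAvg n (fun ε => a (q' ε) + (-f (q' ε) 0 + ∑ j, ε j * f (q' ε) j.succ)) := by
      rw [← signAvg_add, ← signAvg_add]
      refine signAvg_mono fun ε => ?_
      have hb := h (p ε) (q ε) 0
      simp only [p', q']
      split_ifs with hc
      · rw [abs_of_nonneg (sub_nonneg.2 hc)] at hb
        linarith [le_abs_self (g (p ε) 0 - g (q ε) 0)]
      · rw [abs_of_neg (sub_neg.2 (not_le.1 hc))] at hb
        linarith [le_abs_self (g (p ε) 0 - g (q ε) 0)]
    simp only [add_assoc, sub_eq_add_neg] at hp hq key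
    linarith

/-! ### Calculus of Rademacher bounds -/

namespace RademacherLE

variable {T U V : Type*} {n : ℕ} {r r' : ℝ}

theorem mono {f : T → Fin n → ℝ} (hf : RademacherLE f r) (h : r ≤ r') : RademacherLE f r' :=
  fun s => (hf s).trans h

theorem comp {f : T → Fin n → ℝ} (hf : RademacherLE f r) (g : U → T) :
    RademacherLE (fun u => f (g u)) r :=
  fun s => hf fun ε => g (s ε)

theorem add {f : T → Fin n → ℝ} {g : T → Fin n → ℝ} (hf : RademacherLE f r)
    (hg : RademacherLE g r') : RademacherLE (fun t j => f t j + g t j) (r + r') := by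
  intro s
  simp only [mul_add, Finset.sum_add_distrib, signAvg_add]
  exact add_le_add (hf s) (hg s)

theorem const_mul {f : T → Fin n → ℝ} (hf : RademacherLE f r) {K : ℝ} (hK : 0 ≤ K) :
    RademacherLE (fun t j => K * f t j) (K * r) := by
  intro s
  have : ∀ ε : Fin n → ℝ, ∑ j, ε j * (K * f (s ε) j) = K * ∑ j, ε j * f (s ε) j := fun ε => by
    rw [Finset.mul_sum]; exact Finset.sum_congr rfl fun _ _ => by ring
  simp only [this, signAvg_const_mul]
  exact mul_le_mul_of_nonneg_left (hf s) hK

theorem contraction {f : T → Fin n → ℝ} (hf : RademacherLE f r) {K : ℝ} (hK : 0 ≤ K)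
    {g : T → Fin n → ℝ} (h : ∀ t u j, |g t j - g u j| ≤ K * |f t j - f u j|) :
    RademacherLE g (K * r) := by
  intro s
  obtain ⟨s', hs'⟩ := exists_signAvg_contraction (fun _ => 0) (fun t j => K * f t j) g
    (fun t u j => by rw [← mul_sub, abs_mul, abs_of_nonneg hK]; exact h t u j) s
  simp only [zero_add] at hs'
  exact hs'.trans (hf.const_mul hK s')

theorem neg {f : T → Fin n → ℝ} (hf : RademacherLE f r) : RademacherLE (fun t j => -f t j) r := by
  have := hf.contraction (K := 1) zero_le_one (g := fun t j => -f t j) fun t u j => by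
    rw [one_mul, ← abs_neg]; ring_nf; exact le_rfl
  rwa [one_mul] at this

/-- The absolute value is the sum of the positive parts for `f` and for `-f`. A selection realizes a
positive part by switching to the zero member `t₀` when the sum has the wrong sign; hence the factor
`2`. -/
theorem abs {f : T → Fin n → ℝ} (hf : RademacherLE f r) {t₀ : T} (h₀ : ∀ j, f t₀ j = 0) :
    AbsRademacherLE f (2 * r) := by
  classical
  intro s
  have h₁ := hf fun ε => if 0 ≤ ∑ j, ε j * f (s ε) j then s ε else t₀
  have h₂ := hf.neg fun ε => if 0 ≤ ∑ j, ε j * f (s ε) j then t₀ else s ε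
  rw [two_mul]
  refine le_trans ?_ (add_le_add h₁ h₂)
  rw [← signAvg_add]
  refine signAvg_mono fun ε => ?_
  split_ifs with hc
  · simp [h₀, abs_of_nonneg hc]
  · simp [h₀, abs_of_neg (not_le.1 hc)]

end RademacherLE

/-- The Rademacher sums of the functions `⟨u, z(t)⟩`, where `u` ranges over the unit ball. -/
theorem NormRademacherLE.inner_closedBall {T H : Type*} [NormedAddCommGroup H]
    [InnerProductSpace ℝ H] {n : ℕ}
    {z : T → Fin n → H} {r : ℝ} (hz : NormRademacherLE z r) :
    RademacherLE (fun (t : T × Metric.closedBall (0 : H) 1) j => inner ℝ (t.2 : H) (z t.1 j)) r := by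
  intro s
  refine (signAvg_mono fun ε => ?_).trans (hz fun ε => (s ε).1)
  have : ∑ j, ε j * inner ℝ ((s ε).2 : H) (z (s ε).1 j)
      = inner ℝ ((s ε).2 : H) (∑ j, ε j • z (s ε).1 j) := by
    simp only [inner_sum, inner_smul_right]
  rw [this]
  refine (real_inner_le_norm _ _).trans ?_
  have hu : ‖((s ε).2 : H)‖ ≤ 1 := mem_closedBall_zero_iff.1 (s ε).2.2
  exact mul_le_of_le_one_left (norm_nonneg _) hu

/-! ### Rademacher complexities of encoder networks -/

theorem mulVec_eq_inner {m k : ℕ} (A : Matrix (Fin m) (Fin k) ℝ) (z : Vec k) (i : Fin m) :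
    A.mulVec z.ofLp i = inner ℝ (WithLp.toLp 2 (A i) : Vec k) z := by
  simp [PiLp.inner_apply, Matrix.mulVec, dotProduct, mul_comm]

theorem frobNorm_nonneg {m k : ℕ} (A : Matrix (Fin m) (Fin k) ℝ) : 0 ≤ frobNorm A := by
  unfold frobNorm
  let _ := Matrix.frobeniusNormedAddCommGroup (m := Fin m) (n := Fin k) (α := ℝ)
  exact norm_nonneg A

theorem frobNorm_sq {m k : ℕ} (A : Matrix (Fin m) (Fin k) ℝ) :
    frobNorm A ^ 2 = ∑ i, ‖(WithLp.toLp 2 (A i) : Vec k)‖ ^ 2 := by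
  unfold frobNorm
  rw [Matrix.frobenius_norm_def, ← Real.sqrt_eq_rpow, Real.sq_sqrt (by positivity)]
  refine Finset.sum_congr rfl fun i _ => ?_
  rw [EuclideanSpace.norm_sq_eq]
  simp

theorem exists_ball_smul_eq {H : Type*} [NormedAddCommGroup H] [InnerProductSpace ℝ H] (w : H) :
    ∃ u : Metric.closedBall (0 : H) 1, w = ‖w‖ • (u : H) := by
  by_cases hw : ‖w‖ = 0
  · exact ⟨⟨0, by simp⟩, by simpa using hw⟩
  · exact ⟨⟨‖w‖⁻¹ • w, by simp [norm_smul, hw]⟩, by simp [smul_smul, hw]⟩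

section PositivelyHomogeneous

variable {σ : ℝ → ℝ}

theorem activation_zero (hσ : ∀ a t : ℝ, 0 ≤ a → σ (a * t) = a * σ t) : σ 0 = 0 := by
  simpa using hσ 0 0 le_rfl

theorem exists_ball_activation_inner (hσ : ∀ a t : ℝ, 0 ≤ a → σ (a * t) = a * σ t) {H : Type*}
    [NormedAddCommGroup H] [InnerProductSpace ℝ H]
    (w : H) : ∃ u : Metric.closedBall (0 : H) 1, ∀ z : H,
      σ (inner ℝ w z) = ‖w‖ * σ (inner ℝ (u : H) z) := by
  obtain ⟨u, hu⟩ := exists_ball_smul_eq w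
  refine ⟨u, fun z => ?_⟩
  conv_lhs => rw [hu, real_inner_smul_left, hσ _ _ (norm_nonneg _)]

/-- Homogeneity pulls the norm of each row out of `σ`, so the squared norm of the signed sum is a
combination of squares of scalar signed sums with the squared row norms as weights. Replacing every
row direction by the best one leaves the Frobenius norm, whatever the width `m`. -/
theorem exists_ball_layer_le (hσ : ∀ a t : ℝ, 0 ≤ a → σ (a * t) = a * σ t) {n m k : ℕ}
    (A : Matrix (Fin m) (Fin k) ℝ) (z : Fin n → Vec k)
    (ε : Fin n → ℝ) :
    ∃ u : Metric.closedBall (0 : Vec k) 1,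
      ‖∑ j, ε j • (WithLp.toLp 2 fun i => σ (A.mulVec (z j).ofLp i) : Vec m)‖ ≤
        frobNorm A * |∑ j, ε j * σ (inner ℝ (u : Vec k) (z j))| := by
  choose u hu using fun i => exists_ball_activation_inner hσ (WithLp.toLp 2 (A i) : Vec k)
  rcases isEmpty_or_nonempty (Fin m) with hm | hm
  · refine ⟨⟨0, by simp⟩, ?_⟩
    rw [EuclideanSpace.norm_eq, Finset.univ_eq_empty, Finset.sum_empty, Real.sqrt_zero]
    exact mul_nonneg (frobNorm_nonneg A) (abs_nonneg _)
  obtain ⟨i₀, h₀⟩ := Finite.exists_max fun i => |∑ j, ε j * σ (inner ℝ (u i : Vec k) (z j))|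
  refine ⟨u i₀, abs_le_of_sq_le_sq' ?_ (mul_nonneg (frobNorm_nonneg A) (abs_nonneg _)) |>.2⟩
  rw [EuclideanSpace.norm_sq_eq, mul_pow, frobNorm_sq, Finset.sum_mul]
  refine Finset.sum_le_sum fun i _ => ?_
  have : (∑ j, ε j • (WithLp.toLp 2 fun i => σ (A.mulVec (z j).ofLp i) : Vec m)) i
      = ‖(WithLp.toLp 2 (A i) : Vec k)‖ * ∑ j, ε j * σ (inner ℝ (u i : Vec k) (z j)) := by
    simp only [WithLp.ofLp_sum, Finset.sum_apply, PiLp.smul_apply, smul_eq_mul, mulVec_eq_inner, hu,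
      Finset.mul_sum]
    exact Finset.sum_congr rfl fun _ _ => by ring
  rw [this, Real.norm_eq_abs, sq_abs, mul_pow]
  refine mul_le_mul_of_nonneg_left ?_ (by positivity)
  exact sq_le_sq.2 (by simpa using h₀ i)

/-- The same peeling, applied to the final layers of both networks at once. Row norms now occur as
products, and Cauchy–Schwarz turns their sum into the product of the Frobenius norms, so no power of
the output dimension is lost. -/
theorem exists_ball_product_layer_le (hσ : ∀ a t : ℝ, 0 ≤ a → σ (a * t) = a * σ t) {n m k k' : ℕ}
    (A : Matrix (Fin m) (Fin k) ℝ)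
    (A' : Matrix (Fin m) (Fin k') ℝ) (z : Fin n → Vec k) (z' : Fin n → Vec k') (ε : Fin n → ℝ) :
    ∃ (u : Metric.closedBall (0 : Vec k) 1) (u' : Metric.closedBall (0 : Vec k') 1),
      ∑ j, ε j * ∑ i, σ (A.mulVec (z j).ofLp i) * σ (A'.mulVec (z' j).ofLp i) ≤
        frobNorm A * frobNorm A' *
          |∑ j, ε j * (σ (inner ℝ (u : Vec k) (z j)) * σ (inner ℝ (u' : Vec k') (z' j)))| := by
  choose u hu using fun i => exists_ball_activation_inner hσ (WithLp.toLp 2 (A i) : Vec k)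
  choose u' hu' using fun i => exists_ball_activation_inner hσ (WithLp.toLp 2 (A' i) : Vec k')
  rcases isEmpty_or_nonempty (Fin m) with hm | hm
  · refine ⟨⟨0, by simp⟩, ⟨0, by simp⟩, ?_⟩
    simp only [Finset.univ_eq_empty, Finset.sum_empty, mul_zero, Finset.sum_const_zero]
    exact mul_nonneg (mul_nonneg (frobNorm_nonneg A) (frobNorm_nonneg A')) (abs_nonneg _)
  obtain ⟨i₀, h₀⟩ := Finite.exists_max fun i => |∑ j, ε j *
    (σ (inner ℝ (u i : Vec k) (z j)) * σ (inner ℝ (u' i : Vec k') (z' j)))|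
  refine ⟨u i₀, u' i₀, ?_⟩
  set S := |∑ j, ε j * (σ (inner ℝ (u i₀ : Vec k) (z j)) * σ (inner ℝ (u' i₀ : Vec k') (z' j)))|
  have e : ∑ j, ε j * ∑ i, σ (A.mulVec (z j).ofLp i) * σ (A'.mulVec (z' j).ofLp i)
      = ∑ i, ‖(WithLp.toLp 2 (A i) : Vec k)‖ * ‖(WithLp.toLp 2 (A' i) : Vec k')‖ *
        ∑ j, ε j * (σ (inner ℝ (u i : Vec k) (z j)) * σ (inner ℝ (u' i : Vec k') (z' j))) := by
    simp only [mulVec_eq_inner, hu, hu', Finset.mul_sum]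
    rw [Finset.sum_comm]
    exact Finset.sum_congr rfl fun _ _ => Finset.sum_congr rfl fun _ _ => by ring
  have cs : ∑ i, ‖(WithLp.toLp 2 (A i) : Vec k)‖ * ‖(WithLp.toLp 2 (A' i) : Vec k')‖
      ≤ frobNorm A * frobNorm A' := by
    refine abs_le_of_sq_le_sq' ?_ (mul_nonneg (frobNorm_nonneg A) (frobNorm_nonneg A')) |>.2
    rw [mul_pow, frobNorm_sq, frobNorm_sq]
    exact Finset.sum_mul_sq_le_sq_mul_sq _ _ _
  rw [e]
  calc _ ≤ ∑ i, ‖(WithLp.toLp 2 (A i) : Vec k)‖ * ‖(WithLp.toLp 2 (A' i) : Vec k')‖ * S :=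
        Finset.sum_le_sum fun i _ => mul_le_mul_of_nonneg_left ((le_abs_self _).trans (h₀ i))
          (by positivity)
    _ ≤ _ := by
        rw [← Finset.sum_mul]
        exact mul_le_mul_of_nonneg_right cs (abs_nonneg _)

theorem abs_activation_sub_le (hL : LipschitzWith 1 σ) (a b : ℝ) : |σ a - σ b| ≤ |a - b| := by
  simpa [Real.dist_eq] using hL.dist_le_mul a b

theorem abs_activation_le (hσ : ∀ a t : ℝ, 0 ≤ a → σ (a * t) = a * σ t)
    (hL : LipschitzWith 1 σ) (a : ℝ) : |σ a| ≤ |a| := by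
  simpa [activation_zero hσ] using abs_activation_sub_le hL a 0

theorem abs_activation_inner_le (hσ : ∀ a t : ℝ, 0 ≤ a → σ (a * t) = a * σ t)
    (hL : LipschitzWith 1 σ) {H : Type*} [NormedAddCommGroup H] [InnerProductSpace ℝ H]
    (u : Metric.closedBall (0 : H) 1) (z : H) : |σ (inner ℝ (u : H) z)| ≤ ‖z‖ := by
  refine (abs_activation_le hσ hL _).trans ((abs_real_inner_le_norm _ _).trans ?_)
  have hu : ‖(u : H)‖ ≤ 1 := mem_closedBall_zero_iff.1 u.2
  exact mul_le_of_le_one_left (norm_nonneg _) hu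

theorem norm_layer_le (hσ : ∀ a t : ℝ, 0 ≤ a → σ (a * t) = a * σ t)
    (hL : LipschitzWith 1 σ) {m k : ℕ} (A : Matrix (Fin m) (Fin k) ℝ) (z : Vec k) :
    ‖(WithLp.toLp 2 fun i => σ (A.mulVec z.ofLp i) : Vec m)‖ ≤ frobNorm A * ‖z‖ := by
  -- A sample with one point and sign `1` turns the peeling lemma into a norm bound.
  obtain ⟨u, hu⟩ := exists_ball_layer_le hσ A (fun _ : Fin 1 => z) (fun _ => 1)
  simp only [Finset.univ_unique, Finset.sum_singleton, one_smul, one_mul] at hu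
  exact hu.trans (mul_le_mul_of_nonneg_left (abs_activation_inner_le hσ hL u z)
    (frobNorm_nonneg A))

theorem norm_net_le (hσ : ∀ a t : ℝ, 0 ≤ a → σ (a * t) = a * σ t)
    (hL : LipschitzWith 1 σ) (d : ℕ → ℕ) (W : Weights d) (B : ℕ → ℝ) (L : ℕ)
    (hW : ∀ l < L, frobNorm (W l) ≤ B l) (x : Vec (d 0)) :
    ‖net σ d W L x‖ ≤ (∏ l ∈ Finset.range L, |B l|) * ‖x‖ := by
  induction L with
  | zero => simp [net]
  | succ L ih =>
    rw [Finset.prod_range_succ]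
    refine (norm_layer_le hσ hL (W L) (net σ d W L x)).trans ?_
    have h₁ := ih fun l hl => hW l (hl.trans L.lt_succ_self)
    have h₂ := (hW L L.lt_succ_self).trans (le_abs_self _)
    calc _ ≤ |B L| * ((∏ l ∈ Finset.range L, |B l|) * ‖x‖) :=
          mul_le_mul h₂ h₁ (norm_nonneg _) (abs_nonneg _)
      _ = _ := by ring

/-- The weights of an `L`-layer network whose matrices satisfy the bounds `B` on the Frobenius
norms. -/
abbrev BoundedWeights (L : ℕ) (B : ℕ → ℝ) (d : ℕ → ℕ) : Type :=
  {W : Weights d // ∀ l < L, frobNorm (W l) ≤ B l}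

theorem rademacherLE_activation_inner {T H : Type*} [NormedAddCommGroup H] [InnerProductSpace ℝ H]
    (hL : LipschitzWith 1 σ) {n : ℕ} {z : T → Fin n → H} {r : ℝ} (hz : NormRademacherLE z r) :
    RademacherLE (fun (t : T × Metric.closedBall (0 : H) 1) j =>
      σ (inner ℝ (t.2 : H) (z t.1 j))) r := by
  have := hz.inner_closedBall.contraction zero_le_one (g := fun t j =>
    σ (inner ℝ (t.2 : H) (z t.1 j))) fun t u j => by
      simpa [Real.dist_eq] using hL.dist_le_mul _ _
  rwa [one_mul] at this

/-- Each layer costs `|B l|` from peeling and a factor `2` from the absolute value that peeling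
introduces. The activation costs nothing, by contraction with constant `1`. -/
theorem normRademacherLE_net (hσ : ∀ a t : ℝ, 0 ≤ a → σ (a * t) = a * σ t)
    (hL : LipschitzWith 1 σ) (d : ℕ → ℕ) (B : ℕ → ℝ) (L : ℕ) {n : ℕ} (x : Fin n → Vec (d 0)) {c : ℝ}
    (hc : 0 ≤ c) (hx : ∀ j, ‖x j‖ ≤ c) :
    NormRademacherLE (fun (W : BoundedWeights L B d) j => net σ d W.1 L (x j))
      (2 ^ L * (∏ l ∈ Finset.range L, |B l|) * c * √n) := by
  induction L with
  | zero =>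
    intro s
    simpa [net] using signAvg_norm_le x hx hc
  | succ L ih =>
    intro s
    let t : (Fin n → ℝ) → BoundedWeights L B d :=
      fun ε => ⟨(s ε).1, fun l hl => (s ε).2 l (hl.trans L.lt_succ_self)⟩
    choose u hu using fun ε =>
      exists_ball_layer_le hσ ((s ε).1 L) (fun j => net σ d (s ε).1 L (x j)) ε
    -- The direction `0` gives the zero function, since `σ 0 = 0`; the weights paired with it are
    -- irrelevant.
    have key := (rademacherLE_activation_inner hL ih).abs
      (t₀ := (t 0, ⟨0, by simp⟩)) (fun j => by simp [activation_zero hσ]) (fun ε => (t ε, u ε))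
    calc _ ≤ signAvg n fun ε => |B L| * |∑ j, ε j *
            σ (inner ℝ (u ε : Vec (d L)) (net σ d (t ε).1 L (x j)))| := by
          refine signAvg_mono fun ε => (hu ε).trans ?_
          exact mul_le_mul_of_nonneg_right (((s ε).2 L L.lt_succ_self).trans (le_abs_self _))
            (abs_nonneg _)
      _ ≤ |B L| * (2 * (2 ^ L * (∏ l ∈ Finset.range L, |B l|) * c * √n)) := by
          rw [signAvg_const_mul]
          exact mul_le_mul_of_nonneg_left key (abs_nonneg _)
      _ = _ := by rw [Finset.prod_range_succ]; ring

/-- Polarization: `fg = ((f + g)² - (f - g)²) / 4`. Both `f + g` and `f - g` take values in `[-M,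
M]`, where `t² / 4` is `M / 2`-Lipschitz, so the contraction principle applies to each square. -/
theorem RademacherLE.mul {T : Type*} {n : ℕ} {f g : T → Fin n → ℝ} {r r' M : ℝ}
    (hf : RademacherLE f r) (hg : RademacherLE g r') (hM : 0 ≤ M)
    (hb : ∀ t j, |f t j| + |g t j| ≤ M) :
    RademacherLE (fun t j => f t j * g t j) (M * (r + r')) := by
  have h₁ := (hf.add hg).contraction (K := M / 2) (by positivity)
    (g := fun t j => (f t j + g t j) ^ 2 / 4) fun t u j => by
      have : (f t j + g t j) ^ 2 / 4 - (f u j + g u j) ^ 2 / 4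
        = ((f t j + g t j) + (f u j + g u j)) / 4 * (f t j + g t j - (f u j + g u j)) := by ring
      rw [this, abs_mul]
      refine mul_le_mul_of_nonneg_right ?_ (abs_nonneg _)
      rw [abs_le]
      have := abs_le.1 ((abs_add_le _ _).trans (hb t j))
      have := abs_le.1 ((abs_add_le _ _).trans (hb u j))
      constructor <;> linarith
  have h₂ := (hf.add hg.neg).contraction (K := M / 2) (by positivity)
    (g := fun t j => -((f t j - g t j) ^ 2 / 4)) fun t u j => by
      have : -((f t j - g t j) ^ 2 / 4) - -((f u j - g u j) ^ 2 / 4)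
        = -(((f t j - g t j) + (f u j - g u j)) / 4) * (f t j + -g t j - (f u j + -g u j)) := by
        ring
      rw [this, abs_mul]
      refine mul_le_mul_of_nonneg_right ?_ (abs_nonneg _)
      rw [abs_le]
      have := abs_le.1 ((abs_sub _ _).trans (hb t j))
      have := abs_le.1 ((abs_sub _ _).trans (hb u j))
      constructor <;> linarith
  have h := h₁.add h₂
  have e : (fun t j => f t j * g t j)
      = fun t j => (f t j + g t j) ^ 2 / 4 + -((f t j - g t j) ^ 2 / 4) := by
    ext t j; ring
  rw [e]
  exact h.mono (by linarith)

/-- The Rademacher complexity of the products of two `L`-layer networks is at most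
`energyRadius L B c₁ c₂ * √n`. -/
noncomputable def energyRadius (L : ℕ) (B : ℕ → ℝ) (c₁ c₂ : ℝ) : ℝ :=
  |B (L - 1)| * |B (L - 1)| * (2 * (((∏ l ∈ Finset.range (L - 1), |B l|) * c₁
    + (∏ l ∈ Finset.range (L - 1), |B l|) * c₂) *
    (2 ^ (L - 1) * (∏ l ∈ Finset.range (L - 1), |B l|) * c₁
      + 2 ^ (L - 1) * (∏ l ∈ Finset.range (L - 1), |B l|) * c₂)))

theorem energyRadius_nonneg (L : ℕ) (B : ℕ → ℝ) {c₁ c₂ : ℝ} (hc₁ : 0 ≤ c₁) (hc₂ : 0 ≤ c₂) :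
    0 ≤ energyRadius L B c₁ c₂ := by
  unfold energyRadius
  positivity

theorem rademacherLE_energy (hσ : ∀ a t : ℝ, 0 ≤ a → σ (a * t) = a * σ t)
    (hL : LipschitzWith 1 σ) {L : ℕ} (hL₁ : 1 ≤ L) (B : ℕ → ℝ) {c₁ c₂ : ℝ} (hc₁ : 0 ≤ c₁)
    (hc₂ : 0 ≤ c₂) {d₁ d₂ : ℕ → ℕ} (hd : d₁ L = d₂ L) {n : ℕ} (x : Fin n → Vec (d₁ 0))
    (y : Fin n → Vec (d₂ 0)) (hx : ∀ j, ‖x j‖ ≤ c₁) (hy : ∀ j, ‖y j‖ ≤ c₂) :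
    RademacherLE (fun (W : BoundedWeights L B d₁ × BoundedWeights L B d₂) j =>
      energy σ L hd W.1.1 W.2.1 (x j) (y j)) (energyRadius L B c₁ c₂ * √n) := by
  obtain ⟨L, rfl⟩ := Nat.exists_eq_succ_of_ne_zero (Nat.one_le_iff_ne_zero.1 hL₁)
  simp only [energyRadius, Nat.succ_sub_one]
  set Q := ∏ l ∈ Finset.range L, |B l| with hQ
  have hQ0 : 0 ≤ Q := Finset.prod_nonneg fun _ _ => abs_nonneg _
  intro s
  let t₁ : (Fin n → ℝ) → BoundedWeights L B d₁ :=
    fun ε => ⟨(s ε).1.1, fun l hl => (s ε).1.2 l (hl.trans L.lt_succ_self)⟩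
  let t₂ : (Fin n → ℝ) → BoundedWeights L B d₂ :=
    fun ε => ⟨(s ε).2.1, fun l hl => (s ε).2.2 l (hl.trans L.lt_succ_self)⟩
  -- The last matrix of the second network with its rows reindexed along `hd`, so that the two last
  -- layers share their index type; the Frobenius norm is unchanged.
  let A' : (Fin n → ℝ) → Matrix (Fin (d₁ (L + 1))) (Fin (d₂ L)) ℝ :=
    fun ε => ((s ε).2.1 L).submatrix (Fin.cast hd) id
  have hA' : ∀ ε, frobNorm (A' ε) = frobNorm ((s ε).2.1 L) := fun ε => by
    refine (pow_left_inj₀ (frobNorm_nonneg _) (frobNorm_nonneg _) two_ne_zero).1 ?_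
    rw [frobNorm_sq, frobNorm_sq, ← Equiv.sum_comp (finCongr hd)]
    rfl
  choose u u' hu using fun ε => exists_ball_product_layer_le hσ ((s ε).1.1 L) (A' ε)
    (fun j => net σ d₁ (s ε).1.1 L (x j)) (fun j => net σ d₂ (s ε).2.1 L (y j)) ε
  have r₁ := rademacherLE_activation_inner hL (normRademacherLE_net hσ hL d₁ B L x hc₁ hx)
  have r₂ := rademacherLE_activation_inner hL (normRademacherLE_net hσ hL d₂ B L y hc₂ hy)
  have hb : ∀ (t : (BoundedWeights L B d₁ × Metric.closedBall (0 : Vec (d₁ L)) 1) ×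
      (BoundedWeights L B d₂ × Metric.closedBall (0 : Vec (d₂ L)) 1)) (j : Fin n),
      |σ (inner ℝ (t.1.2 : Vec (d₁ L)) (net σ d₁ t.1.1.1 L (x j)))| +
      |σ (inner ℝ (t.2.2 : Vec (d₂ L)) (net σ d₂ t.2.1.1 L (y j)))| ≤ Q * c₁ + Q * c₂ := by
    intro t j
    refine add_le_add ?_ ?_
    · exact (abs_activation_inner_le hσ hL _ _).trans ((norm_net_le hσ hL d₁ _ B L t.1.1.2 _).trans
        (mul_le_mul_of_nonneg_left (hx j) hQ0))
    · exact (abs_activation_inner_le hσ hL _ _).trans ((norm_net_le hσ hL d₂ _ B L t.2.1.2 _).trans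
        (mul_le_mul_of_nonneg_left (hy j) hQ0))
  have key := ((r₁.comp Prod.fst).mul (r₂.comp Prod.snd) (by positivity) hb).abs
    (t₀ := ((t₁ 0, ⟨0, by simp⟩), (t₂ 0, ⟨0, by simp⟩))) (fun j => by simp [activation_zero hσ])
    (fun ε => ((t₁ ε, u ε), (t₂ ε, u' ε)))
  calc _ ≤ signAvg n fun ε => |B L| * |B L| * |∑ j, ε j *
            (σ (inner ℝ (u ε : Vec (d₁ L)) (net σ d₁ (t₁ ε).1 L (x j))) *
            σ (inner ℝ (u' ε : Vec (d₂ L)) (net σ d₂ (t₂ ε).1 L (y j))))| := by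
          refine signAvg_mono fun ε => (hu ε).trans ?_
          refine mul_le_mul_of_nonneg_right ?_ (abs_nonneg _)
          rw [hA']
          exact mul_le_mul (((s ε).1.2 L L.lt_succ_self).trans (le_abs_self _))
            (((s ε).2.2 L L.lt_succ_self).trans (le_abs_self _)) (frobNorm_nonneg _) (abs_nonneg _)
    _ ≤ |B L| * |B L| * (2 * ((Q * c₁ + Q * c₂) *
          (2 ^ L * Q * c₁ * √n + 2 ^ L * Q * c₂ * √n))) := by
          rw [signAvg_const_mul]
          exact mul_le_mul_of_nonneg_left key (by positivity)
    _ = _ := by ring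

end PositivelyHomogeneous

/-! ### Deviations of suprema of sums of independent bounded functions -/

section Deviation

variable {Z : Type*} [MeasurableSpace Z]

theorem integral_pi_cons {n : ℕ} (ν : Fin (n + 1) → Measure Z) [∀ j, IsProbabilityMeasure (ν j)]
    {Φ : (Fin (n + 1) → Z) → ℝ} (hΦ : Integrable Φ (Measure.pi ν)) :
    Integrable (fun a => ∫ z, Φ (Fin.cons a z) ∂(Measure.pi fun j => ν (Fin.succ j))) (ν 0) ∧
    ∫ z, Φ z ∂(Measure.pi ν) =
      ∫ a, ∫ z, Φ (Fin.cons a z) ∂(Measure.pi fun j => ν (Fin.succ j)) ∂(ν 0) := by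
  have hp := (measurePreserving_piFinSuccAbove ν 0).symm
  have hi : Integrable (fun q : Z × (Fin n → Z) => Φ (Fin.cons q.1 q.2))
      ((ν 0).prod (Measure.pi fun j => ν (Fin.succ j))) := by
    have := (hp.integrable_comp_emb (MeasurableEquiv.measurableEmbedding _)).2 hΦ
    simpa [Function.comp_def, MeasurableEquiv.piFinSuccAbove_symm_apply, Fin.insertNthEquiv,
      Fin.insertNth_zero] using this
  refine ⟨hi.integral_prod_left, ?_⟩
  rw [← hp.integral_comp', ← integral_prod _ hi]
  simp [MeasurableEquiv.piFinSuccAbove_symm_apply, Fin.insertNthEquiv]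

theorem measurable_cons_right {n : ℕ} (a : Z) :
    Measurable fun z : Fin n → Z => (Fin.cons a z : Fin (n + 1) → Z) := by
  refine measurable_pi_lambda _ fun j => ?_
  refine Fin.cases ?_ (fun j => ?_) j
  · simp
  · simpa using measurable_pi_apply j

theorem integrable_of_abs_le {Ω : Type*} [MeasurableSpace Ω] {μ : Measure Ω} [IsFiniteMeasure μ]
    {f : Ω → ℝ} (hf : Measurable f) {M : ℝ} (hM : ∀ ω, |f ω| ≤ M) : Integrable f μ :=
  Integrable.of_bound hf.aestronglyMeasurable M (ae_of_all _ hM)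

/-- Hoeffding's lemma on the interval of radius `c` around one value of `X`. The interval has length
`2c`, so the variance proxy is `c²` instead of the optimal `c² / 4`; in exchange no infimum of `X`
is needed. -/
theorem integral_exp_le_of_abs_sub_le (ν : Measure Z) [IsProbabilityMeasure ν] {X : Z → ℝ}
    (hX : Measurable X) {c : ℝ} (hc : ∀ z w, |X w - X z| ≤ c) (l : ℝ) :
    ∫ z, Real.exp (l * X z) ∂ν ≤ Real.exp (l * (∫ z, X z ∂ν) + l ^ 2 * c ^ 2 / 2) := by
  obtain ⟨z₀⟩ : Nonempty Z := nonempty_of_isProbabilityMeasure ν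
  have hc0 : 0 ≤ c := (abs_nonneg _).trans (hc z₀ z₀)
  have h := ProbabilityTheory.hasSubgaussianMGF_of_mem_Icc (μ := ν) (a := X z₀ - c) (b := X z₀ + c)
    hX.aemeasurable (ae_of_all _ fun z => by
      have := abs_le.1 (hc z₀ z)
      constructor <;> linarith)
  have h₁ := h.mgf_le l
  have e : (((‖X z₀ + c - (X z₀ - c)‖₊ / 2) ^ 2 : NNReal) : ℝ) = c ^ 2 := by
    have : X z₀ + c - (X z₀ - c) = 2 * c := by ring
    rw [this]
    push_cast
    rw [Real.norm_eq_abs, abs_of_nonneg (by positivity)]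
    ring
  rw [e] at h₁
  unfold ProbabilityTheory.mgf at h₁
  have e₂ : ∀ z, Real.exp (l * X z) = Real.exp (l * ∫ z, X z ∂ν)
      * Real.exp (l * (X z - ∫ z, X z ∂ν)) := fun z => by
    rw [← Real.exp_add]; congr 1; ring
  simp_rw [e₂]
  rw [integral_const_mul, Real.exp_add]
  refine mul_le_mul_of_nonneg_left (h₁.trans (le_of_eq ?_)) (Real.exp_nonneg _)
  congr 1; ring

/-- The exponential moment bound behind the bounded differences inequality. -/
theorem integral_exp_le_of_bounded_differences {n : ℕ} (ν : Fin n → Measure Z)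
    [∀ j, IsProbabilityMeasure (ν j)] {Φ : (Fin n → Z) → ℝ} (hΦ : Measurable Φ) {M c : ℝ}
    (hM : ∀ z, |Φ z| ≤ M) (hc : ∀ z j w, |Φ (Function.update z j w) - Φ z| ≤ c) (l : ℝ) :
    ∫ z, Real.exp (l * Φ z) ∂(Measure.pi ν) ≤
      Real.exp (l * (∫ z, Φ z ∂(Measure.pi ν)) + n * (l ^ 2 * c ^ 2 / 2)) := by
  induction n with
  | zero =>
    have h : ∀ z, Φ z = Φ Fin.elim0 := fun z => by congr 1; exact Subsingleton.elim _ _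
    have h1 : ∫ z, Φ z ∂(Measure.pi ν) = Φ Fin.elim0 := by
      rw [integral_congr_ae (ae_of_all _ h)]; simp
    have h2 : ∫ z, Real.exp (l * Φ z) ∂(Measure.pi ν) = Real.exp (l * Φ Fin.elim0) := by
      rw [integral_congr_ae (ae_of_all _ fun z => by simp only [h z]; rfl)]; simp
    rw [h1, h2]; simp
  | succ n ih =>
    have hIe : Integrable (fun z => Real.exp (l * Φ z)) (Measure.pi ν) := by
      refine integrable_of_abs_le (by fun_prop) (M := Real.exp (|l| * M)) fun z => ?_
      rw [abs_of_nonneg (Real.exp_nonneg _)]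
      refine Real.exp_le_exp.2 ((le_abs_self _).trans ?_)
      rw [abs_mul]
      exact mul_le_mul_of_nonneg_left (hM z) (abs_nonneg _)
    obtain ⟨hi₁, he₁⟩ := integral_pi_cons ν hIe
    obtain ⟨hi₂, he₂⟩ := integral_pi_cons ν (integrable_of_abs_le hΦ hM)
    set ν' : Fin n → Measure Z := fun j => ν (Fin.succ j)
    have hcons : Measurable fun q : Z × (Fin n → Z) => (Fin.cons q.1 q.2 : Fin (n + 1) → Z) := by
      refine measurable_pi_lambda _ fun j => ?_
      refine Fin.cases ?_ (fun j => ?_) j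
      · simpa using measurable_fst
      · simp only [Fin.cons_succ]
        exact (measurable_pi_apply j).comp measurable_snd
    have hmX : Measurable fun a => ∫ z, Φ (Fin.cons a z) ∂(Measure.pi ν') :=
      (StronglyMeasurable.integral_prod_right
        (f := fun a z => Φ (Fin.cons a z)) (hΦ.comp hcons).stronglyMeasurable).measurable
    have hint : ∀ a, Integrable (fun z => Φ (Fin.cons a z)) (Measure.pi ν') := fun a =>
      integrable_of_abs_le (hΦ.comp (measurable_cons_right a)) fun z => hM _
    have hcX : ∀ a b, |(∫ z, Φ (Fin.cons b z) ∂(Measure.pi ν'))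
        - ∫ z, Φ (Fin.cons a z) ∂(Measure.pi ν')| ≤ c := by
      intro a b
      rw [← integral_sub (hint b) (hint a)]
      have := norm_integral_le_of_norm_le_const (μ := Measure.pi ν') (C := c)
        (f := fun z => Φ (Fin.cons b z) - Φ (Fin.cons a z)) (ae_of_all _ fun z => by
          have := hc (Fin.cons a z) 0 b
          rwa [Fin.update_cons_zero] at this)
      simpa using this
    -- As a function of the first coordinate, the average over the others inherits the oscillation
    -- bound `c`, so Hoeffding's lemma applies to it. The induction hypothesis handles the other
    -- coordinates with the first one frozen.
    have hstep := integral_exp_le_of_abs_sub_le (ν 0) hmX hcX l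
    rw [he₁, he₂]
    calc _ ≤ ∫ a, Real.exp (l * ∫ z, Φ (Fin.cons a z) ∂(Measure.pi ν'))
            * Real.exp (n * (l ^ 2 * c ^ 2 / 2)) ∂(ν 0) := by
          refine integral_mono hi₁ ?_ fun a => ?_
          · refine (integrable_of_abs_le (by fun_prop) (M := Real.exp (|l| * M)) fun a => ?_).mul_const _
            rw [abs_of_nonneg (Real.exp_nonneg _)]
            refine Real.exp_le_exp.2 ((le_abs_self _).trans ?_)
            rw [abs_mul]
            refine mul_le_mul_of_nonneg_left ?_ (abs_nonneg _)
            have := norm_integral_le_of_norm_le_const (μ := Measure.pi ν')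
              (f := fun z => Φ (Fin.cons a z)) (ae_of_all _ fun z => hM (Fin.cons a z))
            simpa using this
          · dsimp only
            rw [← Real.exp_add]
            refine ih ν' (hΦ.comp (measurable_cons_right a)) (fun z => hM _) fun z j w => ?_
            have := hc (Fin.cons a z) j.succ w
            rwa [← Fin.cons_update] at this
      _ ≤ Real.exp (l * (∫ a, ∫ z, Φ (Fin.cons a z) ∂(Measure.pi ν') ∂(ν 0))
            + l ^ 2 * c ^ 2 / 2) * Real.exp (n * (l ^ 2 * c ^ 2 / 2)) := by
          rw [integral_mul_const]
          exact mul_le_mul_of_nonneg_right hstep (Real.exp_nonneg _)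
      _ = _ := by
          rw [← Real.exp_add]; congr 1; push_cast; ring

/-- A bounded differences (McDiarmid) inequality. -/
theorem measure_ge_le_of_bounded_differences {n : ℕ} (ν : Fin n → Measure Z)
    [∀ j, IsProbabilityMeasure (ν j)] {Φ : (Fin n → Z) → ℝ} (hΦ : Measurable Φ) {M c : ℝ}
    (hM : ∀ z, |Φ z| ≤ M) (hc : ∀ z j w, |Φ (Function.update z j w) - Φ z| ≤ c) {s : ℝ}
    (hs : 0 ≤ s) :
    (Measure.pi ν) {z | (∫ z, Φ z ∂(Measure.pi ν)) + s ≤ Φ z} ≤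
      ENNReal.ofReal (Real.exp (-s ^ 2 / (2 * (n * c ^ 2)))) := by
  have h : ProbabilityTheory.HasSubgaussianMGF (fun z => Φ z - ∫ z, Φ z ∂(Measure.pi ν))
      (Real.toNNReal (n * c ^ 2)) (Measure.pi ν) := by
    constructor
    · intro t
      refine integrable_of_abs_le (by fun_prop) (M := Real.exp (|t| * (M + M))) fun z => ?_
      rw [abs_of_nonneg (Real.exp_nonneg _)]
      refine Real.exp_le_exp.2 ((le_abs_self _).trans ?_)
      rw [abs_mul]
      refine mul_le_mul_of_nonneg_left ?_ (abs_nonneg _)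
      refine (abs_sub _ _).trans (add_le_add (hM z) ?_)
      simpa using norm_integral_le_of_norm_le_const (μ := Measure.pi ν) (f := Φ) (ae_of_all _ hM)
    · intro t
      have := integral_exp_le_of_bounded_differences ν hΦ hM hc t
      unfold ProbabilityTheory.mgf
      have e₂ : ∀ z, Real.exp (t * (Φ z - ∫ z, Φ z ∂(Measure.pi ν)))
          = Real.exp (t * Φ z) * Real.exp (-(t * ∫ z, Φ z ∂(Measure.pi ν))) := fun z => by
        rw [← Real.exp_add]; congr 1; ring
      simp_rw [e₂]
      rw [integral_mul_const]
      refine (mul_le_mul_of_nonneg_right this (Real.exp_nonneg _)).trans (le_of_eq ?_)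
      rw [← Real.exp_add, Real.coe_toNNReal _ (by positivity)]
      congr 1; ring
  have := h.measure_ge_le hs
  rw [Real.coe_toNNReal _ (by positivity)] at this
  rw [← ENNReal.ofReal_toReal (measure_ne_top (Measure.pi ν) _)]
  refine ENNReal.ofReal_le_ofReal (le_trans (le_of_eq ?_) this)
  rw [Measure.real]
  congr 2
  ext z
  simp only [Set.mem_ofPred_eq]
  constructor <;> intro h <;> linarith

theorem integrable_signAvg {Ω : Type*} [MeasurableSpace Ω] {μ : Measure Ω} {n : ℕ}
    {F : (Fin n → ℝ) → Ω → ℝ} (hF : ∀ ε, Integrable (F ε) μ) :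
    Integrable (fun ω => signAvg n fun ε => F ε ω) μ := by
  induction n with
  | zero => exact hF _
  | succ n ih =>
    exact ((ih fun ε => hF (Fin.cons 1 ε)).add (ih fun ε => hF (Fin.cons (-1) ε))).div_const 2

theorem integrable_lipschitz_comp {E : Type*} [NormedAddCommGroup E] [MeasurableSpace E]
    [BorelSpace E] {Ω : Type*} [MeasurableSpace Ω] {μ : Measure Ω}
    [IsFiniteMeasure μ] {G : E → ℝ} (hL : LipschitzWith 1 G) {f : Ω → E} (hf : Measurable f)
    {b : ℝ} (hb : ∀ ω, ‖f ω‖ ≤ b) : Integrable (fun ω => G (f ω)) μ := by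
  refine integrable_of_abs_le (hL.continuous.measurable.comp hf) (M := |G 0| + b) fun ω => ?_
  have := hL.dist_le_mul (f ω) 0
  rw [dist_zero_right, Real.dist_eq, NNReal.coe_one, one_mul] at this
  have h₁ := abs_sub_abs_le_abs_sub (G (f ω)) (G 0)
  linarith [hb ω]

/-! ### Symmetrization for convex functions -/

section Symmetrization

variable {E : Type*} [NormedAddCommGroup E] [NormedSpace ℝ E] [CompleteSpace E]
  [MeasurableSpace E] [BorelSpace E] [SecondCountableTopology E]

/-- Jensen's inequality replaces the mean by an independent copy, and `f z - f w` is the midpoint of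
`2 f z` and `-2 f w`. Convexity then produces the average over a sign directly, one variable at a
time. -/
theorem integral_convex_sub_integral_le (ν : Measure Z) [IsProbabilityMeasure ν] {f : Z → E}
    (hf : Measurable f) {b : ℝ} (hb : ∀ z, ‖f z‖ ≤ b) {G : E → ℝ} (hG : ConvexOn ℝ Set.univ G)
    (hL : LipschitzWith 1 G) :
    ∫ z, G (f z - ∫ w, f w ∂ν) ∂ν ≤
      ((∫ z, G ((2 : ℝ) • f z) ∂ν) + ∫ z, G (-((2 : ℝ) • f z)) ∂ν) / 2 := by
  have hfi : Integrable f ν := Integrable.of_bound hf.aestronglyMeasurable b (ae_of_all _ hb)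
  have hmb : ‖∫ w, f w ∂ν‖ ≤ b := by
    simpa using norm_integral_le_of_norm_le_const (μ := ν) (ae_of_all _ hb)
  have i₁ : Integrable (fun z => G ((2 : ℝ) • f z)) ν :=
    integrable_lipschitz_comp hL (hf.const_smul _) (b := 2 * b) fun z => by
      rw [norm_smul]; simpa using hb z
  have i₂ : Integrable (fun z => G (-((2 : ℝ) • f z))) ν :=
    integrable_lipschitz_comp hL (hf.const_smul _).neg (b := 2 * b) fun z => by
      rw [norm_neg, norm_smul]; simpa using hb z
  have hpt : ∀ z, G (f z - ∫ w, f w ∂ν) ≤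
      (G ((2 : ℝ) • f z) + ∫ w, G (-((2 : ℝ) • f w)) ∂ν) / 2 := by
    intro z
    have e : f z - ∫ w, f w ∂ν = ∫ w, (f z - f w) ∂ν := by
      rw [integral_sub (integrable_const _) hfi]; simp
    have hiw : Integrable (fun w => G (f z - f w)) ν :=
      integrable_lipschitz_comp hL (measurable_const.sub hf) (b := b + b) fun w =>
        (norm_sub_le _ _).trans (add_le_add (hb z) (hb w))
    rw [e]
    refine (hG.map_integral_le (hL.continuous.continuousOn) isClosed_univ
      (ae_of_all _ fun _ => Set.mem_univ _) ((integrable_const _).sub hfi) hiw).trans ?_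
    calc ∫ w, G (f z - f w) ∂ν
        ≤ ∫ w, (G ((2 : ℝ) • f z) / 2 + G (-((2 : ℝ) • f w)) / 2) ∂ν := by
          refine integral_mono hiw ((integrable_const _).add (i₂.div_const 2)) fun w => ?_
          have := hG.2 (Set.mem_univ ((2 : ℝ) • f z)) (Set.mem_univ (-((2 : ℝ) • f w)))
            (by norm_num : (0 : ℝ) ≤ 1 / 2) (by norm_num : (0 : ℝ) ≤ 1 / 2) (by norm_num)
          have e' : (1 / 2 : ℝ) • (2 : ℝ) • f z + (1 / 2 : ℝ) • -((2 : ℝ) • f w) = f z - f w := by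
            rw [smul_neg, smul_smul, smul_smul]; norm_num [sub_eq_add_neg]
          rw [e'] at this
          simp only [smul_eq_mul] at this
          linarith
      _ = _ := by
          rw [integral_add (integrable_const _) (i₂.div_const 2), integral_const, integral_div]
          simp; ring
  calc _ ≤ ∫ z, (G ((2 : ℝ) • f z) + ∫ w, G (-((2 : ℝ) • f w)) ∂ν) / 2 ∂ν := by
        refine integral_mono ?_ ((i₁.add (integrable_const _)).div_const 2) hpt
        exact integrable_lipschitz_comp hL (hf.sub measurable_const) (b := b + b) fun w =>
          (norm_sub_le _ _).trans (add_le_add (hb w) hmb)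
    _ = _ := by
        rw [integral_div, integral_add i₁ (integrable_const _)]
        simp

/-- Symmetrization for convex functions of a sum of independent bounded random vectors. -/
theorem integral_convex_sum_le_signAvg {n : ℕ} (ν : Fin n → Measure Z)
    [∀ j, IsProbabilityMeasure (ν j)] {f : Fin n → Z → E} (hf : ∀ j, Measurable (f j)) {b : ℝ}
    (hb : ∀ j z, ‖f j z‖ ≤ b) {G : E → ℝ} (hG : ConvexOn ℝ Set.univ G) (hL : LipschitzWith 1 G) :
    ∫ z, G (∑ j, (f j (z j) - ∫ w, f j w ∂(ν j))) ∂(Measure.pi ν) ≤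
      ∫ z, signAvg n (fun ε => G ((2 : ℝ) • ∑ j, ε j • f j (z j))) ∂(Measure.pi ν) := by
  induction n generalizing G with
  | zero => simp [signAvg]
  | succ n ih =>
    have hmb : ∀ j, ‖∫ w, f j w ∂(ν j)‖ ≤ b := fun j => by
      simpa using norm_integral_le_of_norm_le_const (μ := ν j) (ae_of_all _ (hb j))
    set ν' : Fin n → Measure Z := fun j => ν (Fin.succ j) with hν'
    have hsm : Measurable fun z : Fin (n + 1) → Z => ∑ j, (f j (z j) - ∫ w, f j w ∂(ν j)) :=
      Finset.measurable_fun_sum _ fun j _ =>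
        ((hf j).comp (measurable_pi_apply j)).sub measurable_const
    have hsb : ∀ z : Fin (n + 1) → Z, ‖∑ j, (f j (z j) - ∫ w, f j w ∂(ν j))‖ ≤
        ∑ _j : Fin (n + 1), (b + b) := fun z =>
      (norm_sum_le _ _).trans (Finset.sum_le_sum fun j _ =>
        (norm_sub_le _ _).trans (add_le_add (hb j _) (hmb j)))
    set D : (Fin n → Z) → E := fun z => ∑ j : Fin n, (f j.succ (z j) - ∫ w, f j.succ w ∂(ν' j))
      with hD
    have hDm : Measurable D := Finset.measurable_fun_sum _ fun j _ =>
      ((hf j.succ).comp (measurable_pi_apply j)).sub measurable_const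
    have hDb : ∀ z, ‖D z‖ ≤ ∑ _j : Fin n, (b + b) := fun z =>
      (norm_sum_le _ _).trans (Finset.sum_le_sum fun j _ =>
        (norm_sub_le _ _).trans (add_le_add (hb j.succ _) (hmb j.succ)))
    have hDi : ∀ e : E, Integrable (fun z => G (e + D z)) (Measure.pi ν') := fun e =>
      integrable_lipschitz_comp hL (measurable_const.add hDm) fun z =>
        (norm_add_le _ _).trans (add_le_add le_rfl (hDb z))
    -- Integrating out the remaining variables leaves a convex `1`-Lipschitz function, so the
    -- one-variable inequality applies to the first summand. The induction hypothesis is then used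
    -- for the translates of `G`.
    set H : E → ℝ := fun e => ∫ z, G (e + D z) ∂(Measure.pi ν') with hH
    have hHc : ConvexOn ℝ Set.univ H := by
      refine ⟨convex_univ, fun x _ y _ p q hp hq hpq => ?_⟩
      simp only [hH, smul_eq_mul]
      rw [← integral_const_mul, ← integral_const_mul,
        ← integral_add ((hDi x).const_mul p) ((hDi y).const_mul q)]
      refine integral_mono (hDi _) (((hDi x).const_mul p).add ((hDi y).const_mul q)) fun z => ?_
      have := hG.2 (Set.mem_univ (x + D z)) (Set.mem_univ (y + D z)) hp hq hpq
      have e : p • (x + D z) + q • (y + D z) = p • x + q • y + D z := by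
        rw [smul_add, smul_add, add_add_add_comm, ← add_smul, hpq, one_smul]
      rw [e] at this
      exact this
    have hHL : LipschitzWith 1 H := by
      refine LipschitzWith.of_dist_le_mul fun x y => ?_
      rw [Real.dist_eq, hH, ← integral_sub (hDi x) (hDi y)]
      have := norm_integral_le_of_norm_le_const (μ := Measure.pi ν') (C := dist x y)
        (f := fun z => G (x + D z) - G (y + D z)) (ae_of_all _ fun z => by
          simpa [Real.dist_eq] using hL.dist_le_mul (x + D z) (y + D z))
      simpa using this
    have hfun : ∀ ε : Fin (n + 1) → ℝ, Integrable
        (fun z : Fin (n + 1) → Z => G ((2 : ℝ) • ∑ j, ε j • f j (z j))) (Measure.pi ν) := fun ε =>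
      integrable_lipschitz_comp hL
        ((Finset.measurable_fun_sum _ fun j _ =>
          ((hf j).comp (measurable_pi_apply j)).const_smul (ε j)).const_smul (2 : ℝ))
        (b := 2 * ∑ j, |ε j| * b) fun z => by
          rw [norm_smul, Real.norm_ofNat]
          refine mul_le_mul_of_nonneg_left ((norm_sum_le _ _).trans
            (Finset.sum_le_sum fun j _ => ?_)) zero_le_two
          rw [norm_smul]
          exact mul_le_mul_of_nonneg_left (hb j _) (abs_nonneg _)
    have hfun' : ∀ (e : E) (ε : Fin n → ℝ), Integrable
        (fun z : Fin n → Z => G (e + (2 : ℝ) • ∑ j, ε j • f j.succ (z j))) (Measure.pi ν') :=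
      fun e ε => integrable_lipschitz_comp hL
        (measurable_const.add ((Finset.measurable_fun_sum _ fun j _ =>
          ((hf j.succ).comp (measurable_pi_apply j)).const_smul (ε j)).const_smul (2 : ℝ)))
        (b := ‖e‖ + 2 * ∑ j, |ε j| * b) fun z => by
          refine (norm_add_le _ _).trans (add_le_add le_rfl ?_)
          rw [norm_smul, Real.norm_ofNat]
          refine mul_le_mul_of_nonneg_left ((norm_sum_le _ _).trans
            (Finset.sum_le_sum fun j _ => ?_)) zero_le_two
          rw [norm_smul]
          exact mul_le_mul_of_nonneg_left (hb j.succ _) (abs_nonneg _)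
    have hIH : ∀ e : E, H e ≤ ∫ z, signAvg n
        (fun ε => G (e + (2 : ℝ) • ∑ j : Fin n, ε j • f j.succ (z j))) ∂(Measure.pi ν') := by
      intro e
      refine ih ν' (fun j => hf j.succ) (fun j => hb j.succ) (G := fun x => G (e + x)) ?_ ?_
      · have := hG.translate_right e
        simpa [Function.comp_def] using this
      · have := hL.comp (LipschitzWith.of_dist_le_mul (K := 1) (f := fun x : E => e + x)
          fun x y => by simp)
        simpa [Function.comp_def] using this
    obtain ⟨-, e₁⟩ := integral_pi_cons ν (integrable_lipschitz_comp (μ := Measure.pi ν) hL hsm hsb)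
    obtain ⟨j₂, e₂⟩ := integral_pi_cons ν (integrable_signAvg hfun)
    rw [e₁, e₂]
    have e₃ : ∀ a (z : Fin n → Z), G (∑ j, (f j ((Fin.cons a z : Fin (n + 1) → Z) j)
        - ∫ w, f j w ∂(ν j))) = G ((f 0 a - ∫ w, f 0 w ∂(ν 0)) + D z) := fun a z => by
      rw [Fin.sum_univ_succ]; rfl
    simp only [e₃]
    refine (integral_convex_sub_integral_le (ν 0) (hf 0) (hb 0) hHc hHL).trans ?_
    have i₁ : Integrable (fun z => H ((2 : ℝ) • f 0 z)) (ν 0) :=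
      integrable_lipschitz_comp hHL ((hf 0).const_smul _) (b := 2 * b) fun z => by
        rw [norm_smul]; simpa using hb 0 z
    have i₂ : Integrable (fun z => H (-((2 : ℝ) • f 0 z))) (ν 0) :=
      integrable_lipschitz_comp hHL ((hf 0).const_smul _).neg (b := 2 * b) fun z => by
        rw [norm_neg, norm_smul]; simpa using hb 0 z
    rw [← integral_add i₁ i₂, ← integral_div]
    refine integral_mono ((i₁.add i₂).div_const 2) j₂ fun a => ?_
    have h₁ := hIH ((2 : ℝ) • f 0 a)
    have h₂ := hIH (-((2 : ℝ) • f 0 a))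
    have e₄ : ∀ z : Fin n → Z, signAvg (n + 1) (fun ε => G ((2 : ℝ) •
        ∑ j, ε j • f j ((Fin.cons a z : Fin (n + 1) → Z) j))) =
        (signAvg n (fun ε => G ((2 : ℝ) • f 0 a + (2 : ℝ) • ∑ j : Fin n, ε j • f j.succ (z j)))
        + signAvg n (fun ε => G (-((2 : ℝ) • f 0 a)
          + (2 : ℝ) • ∑ j : Fin n, ε j • f j.succ (z j)))) / 2 := fun z => by
      simp only [signAvg, Fin.sum_univ_succ, Fin.cons_zero, Fin.cons_succ, smul_add, one_smul,
        neg_smul, smul_neg]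
    simp only [e₄]
    rw [integral_div, integral_add (integrable_signAvg (hfun' _)) (integrable_signAvg (hfun' _))]
    linarith

end Symmetrization

end Deviation

/-! ### Uniform deviations of finite and separable classes -/

section Deviation

variable {Z : Type*} [MeasurableSpace Z]

theorem convexOn_sup' (T : Type*) [Fintype T] [Nonempty T] :
    ConvexOn ℝ Set.univ fun e : T → ℝ => Finset.univ.sup' Finset.univ_nonempty e := by
  refine ⟨convex_univ, fun x _ y _ p q hp hq _ => Finset.sup'_le _ _ fun t _ => ?_⟩
  simp only [Pi.add_apply, Pi.smul_apply, smul_eq_mul]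
  exact add_le_add (mul_le_mul_of_nonneg_left (Finset.le_sup' x (Finset.mem_univ t)) hp)
    (mul_le_mul_of_nonneg_left (Finset.le_sup' y (Finset.mem_univ t)) hq)

theorem lipschitzWith_sup' (T : Type*) [Fintype T] [Nonempty T] :
    LipschitzWith 1 fun e : T → ℝ => Finset.univ.sup' Finset.univ_nonempty e := by
  have key : ∀ x y : T → ℝ, Finset.univ.sup' Finset.univ_nonempty x ≤
      Finset.univ.sup' Finset.univ_nonempty y + dist x y := fun x y =>
    Finset.sup'_le _ _ fun t _ => by
      have h₁ := Finset.le_sup' y (Finset.mem_univ t)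
      have h₂ := dist_le_pi_dist x y t
      rw [Real.dist_eq] at h₂
      linarith [le_abs_self (x t - y t)]
  refine LipschitzWith.of_dist_le_mul fun x y => ?_
  rw [Real.dist_eq, NNReal.coe_one, one_mul, abs_le]
  have h₁ := key x y
  have h₂ := key y x
  rw [dist_comm] at h₂
  constructor <;> linarith

/-- The uniform deviation bound for a finite class. -/
theorem measure_exists_lt_sum_le_of_fintype {T : Type*} [Fintype T] {n : ℕ} (ν : Fin n → Measure Z)
    [∀ j, IsProbabilityMeasure (ν j)] {f : T → Fin n → Z → ℝ} (hf : ∀ t j, Measurable (f t j))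
    {b : ℝ} (hb : ∀ t j z, |f t j z| ≤ b) {r : ℝ}
    (hr : ∀ᵐ z ∂(Measure.pi ν), RademacherLE (fun t j => f t j (z j)) r) {s : ℝ} (hs : 0 ≤ s) :
    (Measure.pi ν) {z | ∃ t, 2 * r + s < ∑ j, (f t j (z j) - ∫ w, f t j w ∂(ν j))} ≤
      ENNReal.ofReal (Real.exp (-s ^ 2 / (2 * (n * (2 * b) ^ 2)))) := by
  classical
  rcases isEmpty_or_nonempty T with hT | hT
  · simp
  set m : T → Fin n → ℝ := fun t j => ∫ w, f t j w ∂(ν j) with hm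
  have hmb : ∀ t j, |m t j| ≤ b := fun t j => by
    simpa using norm_integral_le_of_norm_le_const (μ := ν j) (f := f t j) (ae_of_all _ (hb t j))
  -- The supremum over the class is this convex function, `1`-Lipschitz for the sup norm, of a sum
  -- of independent vectors in `T → ℝ`. Symmetrization bounds its mean and bounded differences bound
  -- its fluctuation.
  set G : (T → ℝ) → ℝ := fun e => Finset.univ.sup' Finset.univ_nonempty e with hGdef
  set f' : Fin n → Z → T → ℝ := fun j z t => f t j z with hf'
  have hf'm : ∀ j, Measurable (f' j) := fun j => measurable_pi_lambda _ fun t => hf t j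
  have hf'b : ∀ j z, ‖f' j z‖ ≤ |b| := fun j z =>
    (pi_norm_le_iff_of_nonneg (abs_nonneg b)).2 fun t => (hb t j z).trans (le_abs_self b)
  have hmean : ∀ j, ∫ w, f' j w ∂(ν j) = fun t => m t j := fun j => by
    ext t
    have := (ContinuousLinearMap.proj (R := ℝ) (φ := fun _ : T => ℝ) t).integral_comp_comm
      (μ := ν j) (Integrable.of_bound (hf'm j).aestronglyMeasurable |b| (ae_of_all _ (hf'b j)))
    exact this.symm
  set Φ : (Fin n → Z) → ℝ := fun z => G (∑ j, (f' j (z j) - ∫ w, f' j w ∂(ν j))) with hΦ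
  have hval : ∀ (z : Fin n → Z) (t : T), (∑ j, (f' j (z j) - ∫ w, f' j w ∂(ν j))) t = ∑ j, (f t j (z j) - m t j) :=
    fun z t => by
      rw [Finset.sum_apply]
      exact Finset.sum_congr rfl fun j _ => by rw [Pi.sub_apply, hmean]
  have hsum : ∀ (z : Fin n → Z) (t : T), |∑ j, (f t j (z j) - m t j)| ≤ n * (2 * b) := fun z t => by
    refine (Finset.abs_sum_le_sum_abs _ _).trans ((Finset.sum_le_sum fun j _ =>
      (abs_sub _ _).trans (add_le_add (hb t j (z j)) (hmb t j))).trans (le_of_eq ?_))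
    simp; ring
  have hΦm : Measurable Φ := (lipschitzWith_sup' T).continuous.measurable.comp
    (Finset.measurable_fun_sum _ fun j _ => ((hf'm j).comp (measurable_pi_apply j)).sub
      measurable_const)
  have hΦb : ∀ z, |Φ z| ≤ n * (2 * b) := fun z => by
    obtain ⟨t, -, ht⟩ := Finset.exists_mem_eq_sup' Finset.univ_nonempty
      (∑ j, (f' j (z j) - ∫ w, f' j w ∂(ν j)))
    simp only [hΦ, hGdef]
    rw [ht, hval]
    exact hsum z t
  have hΦc : ∀ z j w, |Φ (Function.update z j w) - Φ z| ≤ 2 * b := fun z j w => by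
    have h := (lipschitzWith_sup' T).dist_le_mul
      (∑ i, (f' i (Function.update z j w i) - ∫ w, f' i w ∂(ν i)))
      (∑ i, (f' i (z i) - ∫ w, f' i w ∂(ν i)))
    rw [Real.dist_eq, NNReal.coe_one, one_mul] at h
    refine h.trans ?_
    obtain ⟨t₀⟩ := hT
    have hb0 : 0 ≤ b := (abs_nonneg _).trans (hb t₀ j w)
    refine (dist_pi_le_iff (by positivity)).2 fun t => ?_
    rw [hval, hval, Real.dist_eq, ← Finset.sum_sub_distrib]
    rw [Finset.sum_eq_single j]
    · rw [Function.update_self, sub_sub_sub_cancel_right, two_mul]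
      exact (abs_sub _ _).trans (add_le_add (hb t j _) (hb t j _))
    · intro i _ hi
      rw [Function.update_of_ne hi, sub_self]
    · simp
  have hE : ∫ z, Φ z ∂(Measure.pi ν) ≤ 2 * r := by
    refine (integral_convex_sum_le_signAvg ν hf'm hf'b (convexOn_sup' T)
      (lipschitzWith_sup' T)).trans ?_
    have hint : Integrable (fun z : Fin n → Z => signAvg n (fun ε => G ((2 : ℝ) •
        ∑ j, ε j • f' j (z j)))) (Measure.pi ν) := integrable_signAvg fun ε =>
      integrable_lipschitz_comp (lipschitzWith_sup' T)
        ((Finset.measurable_fun_sum _ fun j _ =>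
          ((hf'm j).comp (measurable_pi_apply j)).const_smul (ε j)).const_smul (2 : ℝ))
        (b := 2 * ∑ j, |ε j| * |b|) fun z => by
          rw [norm_smul, Real.norm_ofNat]
          refine mul_le_mul_of_nonneg_left ((norm_sum_le _ _).trans
            (Finset.sum_le_sum fun j _ => ?_)) zero_le_two
          rw [norm_smul]
          exact mul_le_mul_of_nonneg_left (hf'b j _) (abs_nonneg _)
    calc _ ≤ ∫ _z : Fin n → Z, 2 * r ∂(Measure.pi ν) := by
          refine integral_mono_ae hint (integrable_const _) ?_
          filter_upwards [hr] with z hz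
          -- A maximizer for each sign vector is a selection, to which the Rademacher hypothesis
          -- applies.
          choose t _ ht using fun ε : Fin n → ℝ => Finset.exists_mem_eq_sup'
            (Finset.univ_nonempty (α := T)) ((2 : ℝ) • ∑ j, ε j • f' j (z j))
          have h := hz t
          have e : ∀ ε, G ((2 : ℝ) • ∑ j, ε j • f' j (z j))
              = 2 * ∑ j, ε j * f (t ε) j (z j) := fun ε => by
            simp only [hGdef]
            rw [ht]
            simp [Finset.sum_apply, hf']
          refine (signAvg_mono fun ε => (e ε).le).trans ?_
          rw [signAvg_const_mul]
          exact mul_le_mul_of_nonneg_left h zero_le_two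
      _ = 2 * r := by simp
  refine (measure_mono ?_).trans (measure_ge_le_of_bounded_differences ν hΦm hΦb hΦc hs)
  rintro z ⟨t, ht⟩
  show _ ≤ Φ z
  have h₁ := Finset.le_sup' (∑ j, (f' j (z j) - ∫ w, f' j w ∂(ν j))) (Finset.mem_univ t)
  rw [hval] at h₁
  exact ((add_le_add hE le_rfl).trans ht.le).trans h₁

theorem exists_lt_iff_exists_denseSeq {T : Type*} [TopologicalSpace T]
    [TopologicalSpace.SeparableSpace T] [Nonempty T] {g : T → ℝ} (hg : Continuous g) (a : ℝ) :
    (∃ t, a < g t) ↔ ∃ k, a < g (TopologicalSpace.denseSeq T k) := by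
  refine ⟨fun ⟨t, ht⟩ => ?_, fun ⟨k, hk⟩ => ⟨_, hk⟩⟩
  exact (TopologicalSpace.denseRange_denseSeq T).exists_mem_open
    (isOpen_lt continuous_const hg) ⟨t, ht⟩

/-- The uniform deviation bound for a separable class of uniformly bounded functions
that depend continuously on the parameter. -/
theorem measure_exists_lt_sum_le {T : Type*} [TopologicalSpace T]
    [TopologicalSpace.SeparableSpace T] [FirstCountableTopology T] {n : ℕ} (ν : Fin n → Measure Z)
    [∀ j, IsProbabilityMeasure (ν j)] {f : T → Fin n → Z → ℝ} (hf : ∀ t j, Measurable (f t j))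
    (hcont : ∀ j z, Continuous fun t => f t j z)
    {b : ℝ} (hb : ∀ t j z, |f t j z| ≤ b) {r : ℝ}
    (hr : ∀ᵐ z ∂(Measure.pi ν), RademacherLE (fun t j => f t j (z j)) r) {s : ℝ} (hs : 0 ≤ s) :
    (Measure.pi ν) {z | ∃ t, 2 * r + s < ∑ j, (f t j (z j) - ∫ w, f t j w ∂(ν j))} ≤
      ENNReal.ofReal (Real.exp (-s ^ 2 / (2 * (n * (2 * b) ^ 2)))) := by
  rcases isEmpty_or_nonempty T with hT | hT
  · simp
  have hc : ∀ z : Fin n → Z, Continuous fun t => ∑ j, (f t j (z j) - ∫ w, f t j w ∂(ν j)) := by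
    intro z
    refine continuous_finsetSum _ fun j _ => (hcont j (z j)).sub ?_
    exact continuous_of_dominated (fun t => (hf t j).aestronglyMeasurable)
      (fun t => ae_of_all _ (hb t j)) (integrable_const b) (ae_of_all _ fun w => hcont j w)
  -- By continuity the strict inequality is already attained on a dense sequence. The events for its
  -- finite initial segments increase to the full event, and the finite bound does not depend on
  -- their size.
  set A : ℕ → Set (Fin n → Z) := fun N => {z | ∃ k : Fin N, 2 * r + s <
    ∑ j, (f (TopologicalSpace.denseSeq T k) j (z j)
      - ∫ w, f (TopologicalSpace.denseSeq T k) j w ∂(ν j))} with hA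
  have hU : {z : Fin n → Z | ∃ t, 2 * r + s < ∑ j, (f t j (z j) - ∫ w, f t j w ∂(ν j))}
      = ⋃ N, A N := by
    ext z
    simp only [hA, Set.mem_iUnion]
    refine (exists_lt_iff_exists_denseSeq (hc z) _).trans ⟨?_, ?_⟩
    · rintro ⟨k, hk⟩
      exact ⟨k + 1, ⟨k, k.lt_succ_self⟩, hk⟩
    · rintro ⟨N, k, hk⟩
      exact ⟨k, hk⟩
  have hmono : Monotone A := by
    rintro N N' h z ⟨k, hk⟩
    exact ⟨Fin.castLE h k, hk⟩
  rw [hU, hmono.measure_iUnion]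
  refine iSup_le fun N => ?_
  refine measure_exists_lt_sum_le_of_fintype ν
    (f := fun (k : Fin N) j z => f (TopologicalSpace.denseSeq T k) j z) (fun k j => hf _ j)
    (fun k j z => hb _ j z) ?_ hs
  filter_upwards [hr] with z hz
  exact hz.comp fun k : Fin N => TopologicalSpace.denseSeq T k

/-- The two-sided form of `measure_exists_lt_sum_le`. -/
theorem measure_exists_lt_abs_sum_le {T : Type*} [TopologicalSpace T]
    [TopologicalSpace.SeparableSpace T] [FirstCountableTopology T] {n : ℕ} (ν : Fin n → Measure Z)
    [∀ j, IsProbabilityMeasure (ν j)] {f : T → Fin n → Z → ℝ} (hf : ∀ t j, Measurable (f t j))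
    (hcont : ∀ j z, Continuous fun t => f t j z)
    {b : ℝ} (hb : ∀ t j z, |f t j z| ≤ b) {r : ℝ}
    (hr : ∀ᵐ z ∂(Measure.pi ν), RademacherLE (fun t j => f t j (z j)) r) {s : ℝ} (hs : 0 ≤ s) :
    (Measure.pi ν) {z | ∃ t, 2 * r + s < |∑ j, (f t j (z j) - ∫ w, f t j w ∂(ν j))|} ≤
      2 * ENNReal.ofReal (Real.exp (-s ^ 2 / (2 * (n * (2 * b) ^ 2)))) := by
  have h₁ := measure_exists_lt_sum_le ν hf hcont hb hr hs
  have h₂ := measure_exists_lt_sum_le ν (f := fun t j z => -f t j z) (fun t j => (hf t j).neg)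
    (fun j z => (hcont j z).neg) (fun t j z => by rw [abs_neg]; exact hb t j z)
    (hr.mono fun z hz => hz.neg) hs
  refine (measure_mono ?_).trans ((measure_union_le _ _).trans
    ((add_le_add h₁ h₂).trans (two_mul _).ge))
  rintro z ⟨t, ht⟩
  rcases lt_abs.1 ht with h | h
  · exact Or.inl ⟨t, h⟩
  · refine Or.inr ⟨t, h.trans_eq ?_⟩
    rw [← Finset.sum_neg_distrib]
    refine Finset.sum_congr rfl fun j _ => ?_
    rw [integral_neg]; ring

end Deviation

/-! ### Disintegration of samples -/

theorem lintegral_pi_prod {n : ℕ} {Z : Type*} [MeasurableSpace Z] (μ : Fin n → Measure Z)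
    [∀ j, SigmaFinite (μ j)] {f : Fin n → Z → ENNReal} (hf : ∀ j, Measurable (f j)) :
    ∫⁻ z, ∏ j, f j (z j) ∂(Measure.pi μ) = ∏ j, ∫⁻ w, f j w ∂(μ j) := by
  induction n with
  | zero => simp
  | succ n ih =>
    have hp := (measurePreserving_piFinSuccAbove μ 0).symm
    rw [← hp.lintegral_comp_emb (MeasurableEquiv.measurableEmbedding _)]
    simp only [MeasurableEquiv.piFinSuccAbove_symm_apply, Fin.insertNthEquiv, Equiv.coe_fn_mk,
      Fin.insertNth_zero, Fin.prod_univ_succ, Fin.cons_zero, Fin.cons_succ, Fin.zero_succAbove,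
      cast_eq]
    rw [lintegral_prod_mul (hf 0).aemeasurable (g := fun z : Fin n → Z => ∏ j : Fin n, f j.succ (z j))
      (Finset.measurable_fun_prod _ fun j _ =>
        (hf j.succ).comp (measurable_pi_apply j)).aemeasurable,
      ih (fun j => μ j.succ) fun j => hf j.succ]

theorem pi_withDensity {n : ℕ} {Z : Type*} [MeasurableSpace Z] (μ : Fin n → Measure Z)
    [∀ j, SigmaFinite (μ j)] {f : Fin n → Z → ENNReal} (hf : ∀ j, Measurable (f j))
    [∀ j, SigmaFinite ((μ j).withDensity (f j))] :
    (Measure.pi fun j => (μ j).withDensity (f j)) =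
      (Measure.pi μ).withDensity fun z => ∏ j, f j (z j) := by
  refine Measure.pi_eq fun s hs => ?_
  rw [withDensity_apply _ (MeasurableSet.univ_pi hs), Measure.restrict_pi_pi, lintegral_pi_prod _ hf]
  exact Finset.prod_congr rfl fun j _ => (withDensity_apply _ (hs j)).symm

/-! ### Finiteness and support of the reference measure -/

section RefMeasure

variable {b : ℕ} {Y : Set (Vec b)}

theorem isFiniteMeasure_refMeasure {c : ℝ} (hY : ∀ y ∈ Y, ‖y‖ ≤ c) :
    IsFiniteMeasure (refMeasure Y) := by
  unfold refMeasure
  split_ifs with h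
  · refine ⟨?_⟩
    rw [Measure.restrict_apply_univ]
    exact Measure.count_apply_lt_top.2 h
  · refine ⟨?_⟩
    rw [Measure.restrict_apply_univ]
    exact (isBounded_iff_forall_norm_le.2 ⟨c, hY⟩).measure_lt_top

theorem ae_mem_refMeasure (hY : NullMeasurableSet Y volume) : ∀ᵐ y ∂(refMeasure Y), y ∈ Y := by
  unfold refMeasure
  split_ifs with h
  · exact ae_restrict_mem h.measurableSet
  · exact ae_restrict_mem₀ hY

end RefMeasure

/-- The conditional law of `y` given `x`. -/
noncomputable def condLaw {a b : ℕ} (Y : Set (Vec b)) (p : Vec a → Vec b → ℝ) (x : Vec a) :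
    Measure (Vec b) :=
  (refMeasure Y).withDensity fun y => ENNReal.ofReal (p x y)

/-! ### Conditioning the sample on its first components -/

namespace IsDataModel

variable {a b : ℕ} {X : Set (Vec a)} {Y : Set (Vec b)} {P : Measure (Vec a × Vec b)}
  {p : Vec a → Vec b → ℝ}

theorem isProbabilityMeasure_fst (h : IsDataModel X Y P p) : IsProbabilityMeasure P.fst :=
  have := h.isProbabilityMeasure
  inferInstance

theorem measurable_ofReal (h : IsDataModel X Y P p) (x : Vec a) :
    Measurable fun y => ENNReal.ofReal (p x y) :=
  (h.measurable_density.comp measurable_prodMk_left).ennreal_ofReal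

theorem measurable_ofReal_uncurry (h : IsDataModel X Y P p) :
    Measurable fun z : Vec a × Vec b => ENNReal.ofReal (p z.1 z.2) :=
  h.measurable_density.ennreal_ofReal

theorem ae_of_ae_prod (h : IsDataModel X Y P p) {Q : Vec a × Vec b → Prop}
    (hQ : ∀ᵐ z ∂(P.fst.prod (refMeasure Y)), Q z) : ∀ᵐ z ∂P, Q z := by
  have hac : P ≪ P.fst.prod (refMeasure Y) := by
    conv_lhs => rw [h.eq_withDensity]
    exact withDensity_absolutelyContinuous _ _
  exact hac.ae_le hQ

theorem sigmaFinite_condLaw [IsFiniteMeasure (refMeasure Y)] (p : Vec a → Vec b → ℝ) (x : Vec a) :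
    SigmaFinite (condLaw Y p x) :=
  SigmaFinite.withDensity fun y => (p x y).toNNReal

theorem ae_snd_mem (h : IsDataModel X Y P p) : ∀ᵐ z ∂P, z.2 ∈ Y := by
  have := h.isProbabilityMeasure_fst
  refine h.ae_of_ae_prod ?_
  exact Measure.quasiMeasurePreserving_snd.ae (ae_mem_refMeasure h.nullMeasurable_Y)

theorem measurable_prod_density (h : IsDataModel X Y P p) (n : ℕ) :
    Measurable fun S : Fin n → Vec a × Vec b => ∏ j, ENNReal.ofReal (p (S j).1 (S j).2) :=
  Finset.measurable_fun_prod _ fun j _ =>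
    h.measurable_ofReal_uncurry.comp (measurable_pi_apply j)

theorem measurable_zip_indicator (h : IsDataModel X Y P p) {n : ℕ}
    {A : Set (Fin n → Vec a × Vec b)} (hA : MeasurableSet A) :
    Measurable fun q : (Fin n → Vec a) × (Fin n → Vec b) =>
      A.indicator (fun S => ∏ j, ENNReal.ofReal (p (S j).1 (S j).2))
        (fun j => (q.1 j, q.2 j)) :=
  ((h.measurable_prod_density n).indicator hA).comp (measurable_pi_lambda _ fun j =>
    ((measurable_pi_apply j).comp measurable_fst).prodMk
      ((measurable_pi_apply j).comp measurable_snd))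

variable [IsFiniteMeasure (refMeasure Y)]

/-- By Fubini, the mass of the fibres integrates over every measurable set `s` to `P.fst s`, so it
equals `1` almost everywhere. -/
theorem ae_isProbabilityMeasure_condLaw (h : IsDataModel X Y P p) :
    ∀ᵐ x ∂P.fst, IsProbabilityMeasure (condLaw Y p x) := by
  have := h.isProbabilityMeasure
  have hm : Measurable fun x => ∫⁻ y, ENNReal.ofReal (p x y) ∂(refMeasure Y) :=
    h.measurable_ofReal_uncurry.lintegral_prod_right'
  have key : (fun x => ∫⁻ y, ENNReal.ofReal (p x y) ∂(refMeasure Y)) =ᵐ[P.fst] fun _ => 1 := by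
    refine ae_eq_of_forall_setLIntegral_eq_of_sigmaFinite hm measurable_const fun s hs _ => ?_
    rw [setLIntegral_one, Measure.fst_apply hs]
    conv_rhs => rw [h.eq_withDensity]
    rw [withDensity_apply _ (measurable_fst hs), ← Set.prod_univ, ← Measure.prod_restrict,
      Measure.restrict_univ, lintegral_prod _ h.measurable_ofReal_uncurry.aemeasurable]
  filter_upwards [key] with x hx
  refine ⟨?_⟩
  rw [condLaw, withDensity_apply _ MeasurableSet.univ, Measure.restrict_univ]
  exact hx

theorem pi_condLaw_apply (h : IsDataModel X Y P p) {n : ℕ} {A : Set (Fin n → Vec a × Vec b)}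
    (hA : MeasurableSet A) (x : Fin n → Vec a) :
    (Measure.pi fun j => condLaw Y p (x j)) {y | (fun j => (x j, y j)) ∈ A} =
      ∫⁻ y, A.indicator (fun S => ∏ j, ENNReal.ofReal (p (S j).1 (S j).2))
        (fun j => (x j, y j)) ∂(Measure.pi fun _ : Fin n => refMeasure Y) := by
  have hsf : ∀ j : Fin n, SigmaFinite ((refMeasure Y).withDensity
    ((fun j y => ENNReal.ofReal (p (x j) y)) j)) := fun j => sigmaFinite_condLaw p (x j)
  have hsl : MeasurableSet {y : Fin n → Vec b | (fun j => (x j, y j)) ∈ A} :=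
    hA.preimage (measurable_pi_lambda _ fun j => measurable_const.prodMk (measurable_pi_apply j))
  have e₂ := pi_withDensity (fun _ : Fin n => refMeasure Y)
    (f := fun j y => ENNReal.ofReal (p (x j) y)) (fun j => h.measurable_ofReal (x j))
  simp only [condLaw]
  rw [e₂, withDensity_apply _ hsl, ← lintegral_indicator hsl]
  rfl

theorem measurable_pi_condLaw (h : IsDataModel X Y P p) {n : ℕ}
    {A : Set (Fin n → Vec a × Vec b)} (hA : MeasurableSet A) :
    Measurable fun x : Fin n → Vec a => (Measure.pi fun j => condLaw Y p (x j))
      {y | (fun j => (x j, y j)) ∈ A} := by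
  simp only [h.pi_condLaw_apply hA]
  exact (h.measurable_zip_indicator hA).lintegral_prod_right'

/-- The law of a sample is the law of the `x_j` followed by independent draws from the conditional
laws. -/
theorem pi_apply (h : IsDataModel X Y P p) {n : ℕ} {A : Set (Fin n → Vec a × Vec b)}
    (hA : MeasurableSet A) :
    (Measure.pi fun _ : Fin n => P) A =
      ∫⁻ x : Fin n → Vec a, (Measure.pi fun j => condLaw Y p (x j))
        {y | (fun j => (x j, y j)) ∈ A} ∂(Measure.pi fun _ => P.fst) := by
  have := h.isProbabilityMeasure
  have e₁ : (Measure.pi fun _ : Fin n => P) =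
      (Measure.pi fun _ : Fin n => P.fst.prod (refMeasure Y)).withDensity
        fun S => ∏ j, ENNReal.ofReal (p (S j).1 (S j).2) := by
    have hs : SigmaFinite ((P.fst.prod (refMeasure Y)).withDensity
        fun z => ENNReal.ofReal (p z.1 z.2)) := by
      rw [← h.eq_withDensity]; infer_instance
    rw [← pi_withDensity (fun _ : Fin n => P.fst.prod (refMeasure Y))
      fun _ => h.measurable_ofReal_uncurry]
    rw [← h.eq_withDensity]
  have hp := (measurePreserving_arrowProdEquivProdArrow (Vec a) (Vec b) (Fin n)
    (fun _ => P.fst) (fun _ => refMeasure Y)).symm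
  rw [e₁, withDensity_apply _ hA, ← lintegral_indicator hA,
    ← hp.lintegral_comp_emb (MeasurableEquiv.measurableEmbedding _), lintegral_prod]
  · exact lintegral_congr fun x => (h.pi_condLaw_apply hA x).symm
  · exact (h.measurable_zip_indicator hA).aemeasurable

/-- The route from bounds conditional on the `x_j` to bounds for the sample. The event must be
measurable because its probability is computed by an iterated integral. -/
theorem pi_le_of_ae_le (h : IsDataModel X Y P p) {n : ℕ} {A : Set (Fin n → Vec a × Vec b)}
    (hA : MeasurableSet A) {δ : ENNReal}
    (hδ : ∀ᵐ x ∂(Measure.pi fun _ : Fin n => P.fst), (Measure.pi fun j => condLaw Y p (x j))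
        {y | (fun j => (x j, y j)) ∈ A} ≤ δ) :
    (Measure.pi fun _ : Fin n => P) A ≤ δ := by
  have := h.isProbabilityMeasure
  rw [h.pi_apply hA]
  refine (lintegral_mono_ae hδ).trans ?_
  simp

theorem ae_ae_of_ae_pi (h : IsDataModel X Y P p) {n : ℕ} {Q : (Fin n → Vec a × Vec b) → Prop}
    (hQ : ∀ᵐ S ∂(Measure.pi fun _ : Fin n => P), Q S) :
    ∀ᵐ x ∂(Measure.pi fun _ : Fin n => P.fst), ∀ᵐ y ∂(Measure.pi fun j => condLaw Y p (x j)),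
      Q fun j => (x j, y j) := by
  have := h.isProbabilityMeasure
  -- The failure set of `Q` need not be measurable, so it is enlarged to a measurable null set
  -- before disintegrating.
  set A := toMeasurable (Measure.pi fun _ : Fin n => P) {S | ¬ Q S} with hA
  have h₀ : (Measure.pi fun _ : Fin n => P) A = 0 := by
    rw [hA, measure_toMeasurable]; exact hQ
  rw [h.pi_apply (measurableSet_toMeasurable _ _)] at h₀
  rw [lintegral_eq_zero_iff (h.measurable_pi_condLaw (measurableSet_toMeasurable _ _))] at h₀
  filter_upwards [h₀] with x hx
  refine measure_mono_null (fun y hy => ?_) hx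
  exact subset_toMeasurable _ _ hy

end IsDataModel

/-! ### Decomposition of the generalization gap -/

theorem abs_log_sub_log_le {u v l : ℝ} (hl : 0 < l) (hu : l ≤ u) (hv : l ≤ v) :
    |Real.log u - Real.log v| ≤ |u - v| / l := by
  have key : ∀ {u v : ℝ}, l ≤ u → l ≤ v → Real.log u - Real.log v ≤ |u - v| / l := by
    intro u v hu hv
    have hu0 := hl.trans_le hu
    have hv0 := hl.trans_le hv
    rw [← Real.log_div hu0.ne' hv0.ne']
    have h₁ := Real.log_le_sub_one_of_pos (div_pos hu0 hv0)
    have h₂ : u / v - 1 = (u - v) / v := by field_simp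
    rw [h₂] at h₁
    refine h₁.trans ((div_le_div_of_nonneg_right (le_abs_self _) hv0.le).trans ?_)
    exact div_le_div_of_nonneg_left (abs_nonneg _) hl hv
  rw [abs_le]
  have h₁ := key hu hv
  have h₂ := key hv hu
  rw [abs_sub_comm] at h₂
  constructor <;> linarith

section BoundedEnergy

variable {a b n : ℕ} {τ : ℝ} {Y : Set (Vec b)} {E : Vec a → Vec b → ℝ}

theorem exp_neg_le_exp_div (hτ : 0 < τ) {e : ℝ} (he : |e| ≤ 1) :
    Real.exp (-1 / τ) ≤ Real.exp (e / τ) :=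
  Real.exp_le_exp.2 (div_le_div_of_nonneg_right (abs_le.1 he).1 hτ.le)

theorem exp_div_le_exp (hτ : 0 < τ) {e : ℝ} (he : |e| ≤ 1) :
    Real.exp (e / τ) ≤ Real.exp (1 / τ) :=
  Real.exp_le_exp.2 (div_le_div_of_nonneg_right (abs_le.1 he).2 hτ.le)

/-- Energies lie in `[-1, 1]`, so two exponents differ by at most `2 / τ`. A bound with the cross
form therefore yields one with the diagonal form. -/
theorem errTermCross_le (hτ : 0 < τ) (hE : ∀ x y, |E x y| ≤ 1) (qt q : Fin n → ℝ)
    (S : Fin n → Vec a × Vec b) :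
    errTermCross τ E qt q S ≤ Real.exp (2 / τ) * errTerm τ E qt q S := by
  unfold errTermCross errTerm
  rw [mul_left_comm]
  refine mul_le_mul_of_nonneg_left ?_ (by positivity)
  rw [Finset.mul_sum]
  refine Finset.sum_le_sum fun i _ => ?_
  rw [Finset.mul_sum]
  refine Finset.sum_le_sum fun j _ => ?_
  rw [mul_left_comm, ← Real.exp_add]
  refine mul_le_mul_of_nonneg_left (Real.exp_le_exp.2 ?_) (abs_nonneg _)
  rw [← add_div]
  refine div_le_div_of_nonneg_right ?_ hτ.le
  have := abs_le.1 (hE (S i).1 (S j).2)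
  have := abs_le.1 (hE (S i).1 (S i).2)
  linarith

theorem integrable_exp_energy [IsFiniteMeasure (refMeasure Y)] (hτ : 0 < τ)
    (hE : ∀ x y, |E x y| ≤ 1) (hEm : Measurable (Function.uncurry E)) (x : Vec a) :
    Integrable (fun y => Real.exp (E x y / τ)) (refMeasure Y) := by
  refine integrable_of_abs_le ?_ (M := Real.exp (1 / τ)) fun y => ?_
  · exact ((hEm.comp measurable_prodMk_left).div_const τ).exp
  · rw [abs_of_nonneg (Real.exp_nonneg _)]
    exact exp_div_le_exp hτ (hE x y)

theorem measurable_partitionFn [IsFiniteMeasure (refMeasure Y)]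
    (hEm : Measurable (Function.uncurry E)) : Measurable (partitionFn τ Y E) :=
  (StronglyMeasurable.integral_prod_right (f := fun x y => Real.exp (E x y / τ))
    ((hEm.div_const τ).exp).stronglyMeasurable).measurable

theorem le_partitionFn [IsFiniteMeasure (refMeasure Y)] (hτ : 0 < τ) (hE : ∀ x y, |E x y| ≤ 1)
    (hEm : Measurable (Function.uncurry E)) (x : Vec a) :
    (refMeasure Y).real Set.univ * Real.exp (-1 / τ) ≤ partitionFn τ Y E x := by
  have := integral_mono (integrable_const (Real.exp (-1 / τ)))
    (integrable_exp_energy hτ hE hEm x) (μ := refMeasure Y)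
    fun y => exp_neg_le_exp_div hτ (hE x y)
  simpa [partitionFn] using this

theorem partitionFn_le [IsFiniteMeasure (refMeasure Y)] (hτ : 0 < τ) (hE : ∀ x y, |E x y| ≤ 1)
    (hEm : Measurable (Function.uncurry E)) (x : Vec a) :
    partitionFn τ Y E x ≤ (refMeasure Y).real Set.univ * Real.exp (1 / τ) := by
  have := integral_mono (integrable_exp_energy hτ hE hEm x) (integrable_const (Real.exp (1 / τ)))
    (μ := refMeasure Y) fun y => exp_div_le_exp hτ (hE x y)
  simpa [partitionFn] using this

/-- The logarithm of the average of `exp (E(x, y) / τ)` over `y ∈ Y`. -/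
noncomputable def logMeanExp (τ : ℝ) (Y : Set (Vec b)) (E : Vec a → Vec b → ℝ) (x : Vec a) : ℝ :=
  Real.log (partitionFn τ Y E x / (refMeasure Y).real Set.univ)

theorem empRisk_eq (hτ : 0 < τ) (hn : 1 ≤ n) {qt : Fin n → ℝ} (hqt : ∀ j, 0 < qt j)
    (S : Fin n → Vec a × Vec b) :
    empRisk τ E qt S = (1 / (n : ℝ)) * ∑ i, (-(E (S i).1 (S i).2)
      + τ * Real.log (misPartitionFn τ E qt S (S i).1)) := by
  unfold empRisk
  rw [neg_mul, ← mul_neg, ← Finset.sum_neg_distrib]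
  congr 1
  refine Finset.sum_congr rfl fun i _ => ?_
  have : 0 < misPartitionFn τ E qt S (S i).1 :=
    Finset.sum_pos (fun j _ => div_pos (Real.exp_pos _) (hqt j)) ⟨⟨0, hn⟩, Finset.mem_univ _⟩
  rw [Real.log_div (Real.exp_pos _).ne' this.ne', Real.log_exp]
  field_simp
  ring

variable [IsFiniteMeasure (refMeasure Y)]

theorem exp_neg_le_partitionFn_div (hV : 0 < (refMeasure Y).real Set.univ)
    (hτ : 0 < τ) (hE : ∀ x y, |E x y| ≤ 1) (hEm : Measurable (Function.uncurry E)) (x : Vec a) :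
    Real.exp (-1 / τ) ≤ partitionFn τ Y E x / (refMeasure Y).real Set.univ := by
  rw [le_div_iff₀ hV, mul_comm]
  exact le_partitionFn hτ hE hEm x

theorem partitionFn_pos (hV : 0 < (refMeasure Y).real Set.univ)
    (hτ : 0 < τ) (hE : ∀ x y, |E x y| ≤ 1) (hEm : Measurable (Function.uncurry E)) (x : Vec a) :
    0 < partitionFn τ Y E x :=
  (mul_pos hV (Real.exp_pos _)).trans_le (le_partitionFn hτ hE hEm x)

/-- Dividing by the total mass makes the bound independent of the size of `Y`. The removed constant,
the logarithm of the mass, cancels in the generalization gap, which is why the final constant needs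
only a lower bound for the mass. -/
theorem abs_logMeanExp_le (hV : 0 < (refMeasure Y).real Set.univ)
    (hτ : 0 < τ) (hE : ∀ x y, |E x y| ≤ 1) (hEm : Measurable (Function.uncurry E)) (x : Vec a) :
    |logMeanExp τ Y E x| ≤ 1 / τ := by
  have h₁ := exp_neg_le_partitionFn_div hV hτ hE hEm x
  have h₂ : partitionFn τ Y E x / (refMeasure Y).real Set.univ ≤ Real.exp (1 / τ) := by
    rw [div_le_iff₀ hV, mul_comm]
    exact partitionFn_le hτ hE hEm x
  have h₀ := (Real.exp_pos _).trans_le h₁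
  rw [logMeanExp, abs_le, ← neg_div]
  exact ⟨(Real.le_log_iff_exp_le h₀).2 h₁, (Real.log_le_iff_le_exp h₀).2 h₂⟩

theorem measurable_logMeanExp (hEm : Measurable (Function.uncurry E)) :
    Measurable (logMeanExp τ Y E) :=
  ((measurable_partitionFn hEm).div_const _).log

theorem log_partitionFn (hV : 0 < (refMeasure Y).real Set.univ)
    (hτ : 0 < τ) (hE : ∀ x y, |E x y| ≤ 1) (hEm : Measurable (Function.uncurry E)) (x : Vec a) :
    Real.log (partitionFn τ Y E x)
      = logMeanExp τ Y E x + Real.log ((refMeasure Y).real Set.univ) := by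
  rw [logMeanExp, Real.log_div (partitionFn_pos hV hτ hE hEm x).ne' hV.ne']
  ring

theorem trueRisk_eq (hV : 0 < (refMeasure Y).real Set.univ)
    (hτ : 0 < τ) (hE : ∀ x y, |E x y| ≤ 1) (hEm : Measurable (Function.uncurry E))
    (P : Measure (Vec a × Vec b)) [IsProbabilityMeasure P] :
    trueRisk τ Y P E = -(∫ z, E z.1 z.2 ∂P) + τ * ((∫ z, logMeanExp τ Y E z.1 ∂P)
      + Real.log ((refMeasure Y).real Set.univ)) := by
  have hpt : ∀ z : Vec a × Vec b,
      -(τ * Real.log (Real.exp (E z.1 z.2 / τ) / partitionFn τ Y E z.1)) =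
      -(E z.1 z.2) + τ * (logMeanExp τ Y E z.1 + Real.log ((refMeasure Y).real Set.univ)) := by
    intro z
    rw [Real.log_div (Real.exp_pos _).ne' (partitionFn_pos hV hτ hE hEm _).ne', Real.log_exp,
      log_partitionFn hV hτ hE hEm]
    field_simp
    ring
  unfold trueRisk
  simp_rw [hpt]
  have i₁ : Integrable (fun z : Vec a × Vec b => E z.1 z.2) P :=
    integrable_of_abs_le hEm fun z => hE z.1 z.2
  have i₂ : Integrable (fun z : Vec a × Vec b => logMeanExp τ Y E z.1) P :=
    integrable_of_abs_le ((measurable_logMeanExp hEm).comp measurable_fst)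
      fun z => abs_logMeanExp_le hV hτ hE hEm z.1
  have i₃ : Integrable (fun z : Vec a × Vec b => logMeanExp τ Y E z.1
      + Real.log ((refMeasure Y).real Set.univ)) P := i₂.add (integrable_const _)
  have i₄ : Integrable (fun z : Vec a × Vec b => -(E z.1 z.2)) P := i₁.neg
  rw [integral_add i₄ (i₃.const_mul τ), integral_const_mul,
    integral_add i₂ (integrable_const _), integral_neg]
  simp

/-- The deterministic part of the argument. The number `l` lies below both partition functions, so
the logarithm is `1 / l`-Lipschitz on their values. The hypothesis `h₃` is uniform in `i`, so it
survives averaging over the sample. -/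
theorem abs_empRisk_sub_trueRisk_le (hV : 0 < (refMeasure Y).real Set.univ)
    (hτ : 0 < τ) (hE : ∀ x y, |E x y| ≤ 1) (hEm : Measurable (Function.uncurry E))
    (P : Measure (Vec a × Vec b)) [IsProbabilityMeasure P] (hn : 1 ≤ n) {qt q : Fin n → ℝ}
    {K l D₁ D₂ D₃ : ℝ} (hqt : ∀ j, 0 < qt j ∧ qt j ≤ K * n) (S : Fin n → Vec a × Vec b)
    (hl : 0 < l) (hl₁ : l ≤ Real.exp (-1 / τ) / K)
    (hl₂ : l ≤ (refMeasure Y).real Set.univ * Real.exp (-1 / τ))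
    (h₁ : |∑ j, (E (S j).1 (S j).2 - ∫ z, E z.1 z.2 ∂P)| ≤ D₁)
    (h₂ : |∑ j, (logMeanExp τ Y E (S j).1 - ∫ z, logMeanExp τ Y E z.1 ∂P)| ≤ D₂)
    (h₃ : ∀ i, |∑ j, Real.exp (E (S i).1 (S j).2 / τ) / q j - partitionFn τ Y E (S i).1| ≤ D₃) :
    |empRisk τ E qt S - trueRisk τ Y P E| ≤ D₁ / n + τ * D₂ / n
      + τ / l * (Real.exp (1 / τ) * errTermCross τ E qt q S + D₃) := by
  have hn0 : (0 : ℝ) < n := by exact_mod_cast hn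
  set mE := ∫ z, E z.1 z.2 ∂P
  set mF := ∫ z, logMeanExp τ Y E z.1 ∂P
  set V := (refMeasure Y).real Set.univ
  have hsplit : empRisk τ E qt S - trueRisk τ Y P E =
      -((1 / (n : ℝ)) * ∑ j, (E (S j).1 (S j).2 - mE))
      + τ * ((1 / (n : ℝ)) * ∑ j, (logMeanExp τ Y E (S j).1 - mF))
      + τ * ((1 / (n : ℝ)) * ∑ i, (Real.log (misPartitionFn τ E qt S (S i).1)
        - Real.log (partitionFn τ Y E (S i).1))) := by
    rw [empRisk_eq hτ hn (fun j => (hqt j).1), trueRisk_eq hV hτ hE hEm P]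
    simp only [log_partitionFn hV hτ hE hEm, Finset.sum_add_distrib, Finset.sum_sub_distrib,
      Finset.sum_neg_distrib, ← Finset.mul_sum, Finset.sum_const, Finset.card_univ,
      Fintype.card_fin, nsmul_eq_mul]
    field_simp
    ring
  have hK : 0 < K := by
    have := (hqt ⟨0, hn⟩).1.trans_le (hqt ⟨0, hn⟩).2
    exact pos_of_mul_pos_left this hn0.le
  -- This is where `q̃ ≤ K n` enters: each of the `n` summands is at least `exp (-1 / τ) / (K n)`.
  have hmis : ∀ i, l ≤ misPartitionFn τ E qt S (S i).1 := fun i => by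
    refine hl₁.trans ?_
    calc Real.exp (-1 / τ) / K = ∑ _j : Fin n, Real.exp (-1 / τ) / (K * n) := by
          rw [Finset.sum_const, Finset.card_univ, Fintype.card_fin, nsmul_eq_mul]
          field_simp
      _ ≤ _ := Finset.sum_le_sum fun j _ =>
          div_le_div₀ (Real.exp_nonneg _) (exp_neg_le_exp_div hτ (hE _ _)) (hqt j).1 (hqt j).2
  have hlog : ∀ i, |Real.log (misPartitionFn τ E qt S (S i).1)
      - Real.log (partitionFn τ Y E (S i).1)| ≤
      ((∑ j, |1 / qt j - 1 / q j| * Real.exp (E (S i).1 (S j).2 / τ)) + D₃) / l := fun i => by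
    refine (abs_log_sub_log_le hl (hmis i) (hl₂.trans (le_partitionFn hτ hE hEm _))).trans ?_
    refine div_le_div_of_nonneg_right ?_ hl.le
    have e : misPartitionFn τ E qt S (S i).1 - partitionFn τ Y E (S i).1 =
        (∑ j, (1 / qt j - 1 / q j) * Real.exp (E (S i).1 (S j).2 / τ))
        + (∑ j, Real.exp (E (S i).1 (S j).2 / τ) / q j - partitionFn τ Y E (S i).1) := by
      rw [misPartitionFn, ← add_sub_assoc, ← Finset.sum_add_distrib]
      congr 1
      exact Finset.sum_congr rfl fun j _ => by ring
    rw [e]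
    refine (abs_add_le _ _).trans (add_le_add ?_ (h₃ i))
    refine (Finset.abs_sum_le_sum_abs _ _).trans (Finset.sum_le_sum fun j _ => ?_)
    rw [abs_mul, abs_of_nonneg (Real.exp_nonneg _)]
  -- The factor `exp (1 / τ)` compensates for the `-1` in the exponent of the error term.
  have hcross : (1 / (n : ℝ)) * ∑ i, |Real.log (misPartitionFn τ E qt S (S i).1)
      - Real.log (partitionFn τ Y E (S i).1)| ≤
      (Real.exp (1 / τ) * errTermCross τ E qt q S + D₃) / l := by
    refine (mul_le_mul_of_nonneg_left (Finset.sum_le_sum fun i _ => hlog i)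
      (by positivity)).trans (le_of_eq ?_)
    have e : ∀ i j, |1 / qt j - 1 / q j| * Real.exp (E (S i).1 (S j).2 / τ) =
        Real.exp (1 / τ) * (|1 / qt j - 1 / q j| * Real.exp ((E (S i).1 (S j).2 - 1) / τ)) := by
      intro i j
      rw [mul_left_comm, ← Real.exp_add]
      congr 2; ring
    simp only [e, errTermCross, ← Finset.mul_sum, ← Finset.sum_div, Finset.sum_add_distrib,
      Finset.sum_const, Finset.card_univ, Fintype.card_fin, nsmul_eq_mul]
    field_simp
  rw [hsplit]
  have t₁ : |-((1 / (n : ℝ)) * ∑ j, (E (S j).1 (S j).2 - mE))| ≤ D₁ / n := by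
    rw [abs_neg, abs_mul, abs_of_nonneg (by positivity), one_div, inv_mul_eq_div]
    exact div_le_div_of_nonneg_right h₁ hn0.le
  have t₂ : |τ * ((1 / (n : ℝ)) * ∑ j, (logMeanExp τ Y E (S j).1 - mF))| ≤ τ * D₂ / n := by
    rw [abs_mul, abs_mul, abs_of_pos hτ, abs_of_nonneg (a := 1 / (n : ℝ)) (by positivity),
      one_div, inv_mul_eq_div, mul_div_assoc]
    exact mul_le_mul_of_nonneg_left (div_le_div_of_nonneg_right h₂ hn0.le) hτ.le
  have t₃ : |τ * ((1 / (n : ℝ)) * ∑ i, (Real.log (misPartitionFn τ E qt S (S i).1)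
        - Real.log (partitionFn τ Y E (S i).1)))| ≤
      τ / l * (Real.exp (1 / τ) * errTermCross τ E qt q S + D₃) := by
    rw [abs_mul, abs_mul, abs_of_pos hτ, abs_of_nonneg (a := 1 / (n : ℝ)) (by positivity)]
    rw [div_mul_eq_mul_div τ l, mul_div_assoc τ]
    refine mul_le_mul_of_nonneg_left (le_trans ?_ hcross) hτ.le
    exact mul_le_mul_of_nonneg_left (Finset.abs_sum_le_sum_abs _ _) (by positivity)
  exact (abs_add_le _ _).trans (add_le_add ((abs_add_le _ _).trans (add_le_add t₁ t₂)) t₃)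

end BoundedEnergy

/-! ### Truncated energies -/

/-- Truncation of a real number to the interval `[-1, 1]`. -/
noncomputable def clip (t : ℝ) : ℝ := max (-1) (min 1 t)

theorem abs_clip_le (t : ℝ) : |clip t| ≤ 1 := by
  rw [abs_le]
  exact ⟨le_max_left _ _, max_le (by norm_num) (min_le_left _ _)⟩

theorem clip_of_abs_le {t : ℝ} (ht : |t| ≤ 1) : clip t = t := by
  rw [abs_le] at ht
  rw [clip, min_eq_right ht.2, max_eq_right ht.1]

theorem lipschitzWith_clip : LipschitzWith 1 clip :=
  (LipschitzWith.id.const_min 1).const_max (-1)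

theorem abs_clip_sub_le (s t : ℝ) : |clip s - clip t| ≤ |s - t| := by
  simpa [Real.dist_eq] using lipschitzWith_clip.dist_le_mul s t

theorem abs_exp_sub_exp_le {u v M : ℝ} (hu : u ≤ M) (hv : v ≤ M) :
    |Real.exp u - Real.exp v| ≤ Real.exp M * |u - v| := by
  have key : ∀ {u v : ℝ}, u ≤ M → Real.exp u - Real.exp v ≤ Real.exp M * |u - v| := by
    intro u v hu
    have h := Real.add_one_le_exp (v - u)
    have e : Real.exp v = Real.exp u * Real.exp (v - u) := by rw [← Real.exp_add]; ring_nf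
    have h₁ : Real.exp u - Real.exp v ≤ Real.exp u * (u - v) := by
      rw [e]; nlinarith [Real.exp_pos u]
    refine h₁.trans ((mul_le_mul_of_nonneg_left (le_abs_self _) (Real.exp_nonneg _)).trans ?_)
    exact mul_le_mul_of_nonneg_right (Real.exp_le_exp.2 hu) (abs_nonneg _)
  rw [abs_le]
  have h₁ := key (v := v) hu
  have h₂ := key (v := u) hv
  rw [abs_sub_comm] at h₂
  constructor <;> linarith

theorem abs_exp_clip_sub_le {τ : ℝ} (hτ : 0 < τ) (s t : ℝ) :
    |Real.exp (clip s / τ) - Real.exp (clip t / τ)| ≤ Real.exp (1 / τ) / τ * |s - t| := by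
  refine (abs_exp_sub_exp_le (M := 1 / τ)
    (div_le_div_of_nonneg_right (abs_le.1 (abs_clip_le s)).2 hτ.le)
    (div_le_div_of_nonneg_right (abs_le.1 (abs_clip_le t)).2 hτ.le)).trans ?_
  rw [← sub_div, abs_div, abs_of_pos hτ, div_mul_eq_mul_div, mul_div_assoc]
  exact mul_le_mul_of_nonneg_left (div_le_div_of_nonneg_right (abs_clip_sub_le s t) hτ.le)
    (Real.exp_nonneg _)

/-! ### Continuity and measurability of networks and energies -/

section Networks

variable {σ : ℝ → ℝ} {L : ℕ} {d d₁ d₂ : ℕ → ℕ}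

theorem continuous_net (hL : LipschitzWith 1 σ) (W : Weights d) (L : ℕ) :
    Continuous (net σ d W L) := by
  have hc := hL.continuous
  induction L with
  | zero => exact continuous_id
  | succ L ih =>
    change Continuous fun x => (WithLp.toLp 2 fun i =>
      σ ((W L).mulVec (net σ d W L x).ofLp i) : Vec (d (L + 1)))
    refine (PiLp.continuous_toLp 2 _).comp (continuous_pi fun i => hc.comp ?_)
    simp only [mulVec_eq_inner]
    exact continuous_const.inner ih

theorem continuous_net_weights (hL : LipschitzWith 1 σ) (L : ℕ) (x : Vec (d 0)) :
    Continuous fun W : Weights d => net σ d W L x := by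
  have hc := hL.continuous
  induction L with
  | zero => exact continuous_const
  | succ L ih =>
    change Continuous fun W : Weights d => (WithLp.toLp 2 fun i =>
      σ ((W L).mulVec (net σ d W L x).ofLp i) : Vec (d (L + 1)))
    refine (PiLp.continuous_toLp 2 _).comp (continuous_pi fun i => hc.comp ?_)
    change Continuous fun W : Weights d => ∑ k, W L i k * (net σ d W L x).ofLp k
    refine continuous_finsetSum _ fun k _ => Continuous.mul ?_ ?_
    · exact (continuous_apply k).comp ((continuous_apply i).comp (continuous_apply L))
    · exact (continuous_apply k).comp ((PiLp.continuous_ofLp 2 _).comp ih)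

/-- Transport of a vector along an equality of dimensions. -/
def castVec {m k : ℕ} (h : m = k) (v : Vec k) : Vec m := WithLp.toLp 2 fun i => v (Fin.cast h i)

theorem norm_castVec {m k : ℕ} (h : m = k) (v : Vec k) : ‖castVec h v‖ = ‖v‖ := by
  subst h; rfl

/-- Freezing one argument makes the energy a linear functional, with coefficient vector in the unit
ball, of the other network. The first network is kept for the log-partition term and the second for
the estimator of the partition function. -/
theorem energy_eq_inner_left (hd : d₁ L = d₂ L) (W₁ : Weights d₁) (W₂ : Weights d₂)
    (x : Vec (d₁ 0)) (y : Vec (d₂ 0)) : energy σ L hd W₁ W₂ x y =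
      inner ℝ (castVec hd (net σ d₂ W₂ L y)) (net σ d₁ W₁ L x) := by
  simp [energy, PiLp.inner_apply, castVec]

theorem energy_eq_inner_right (hd : d₁ L = d₂ L) (W₁ : Weights d₁) (W₂ : Weights d₂)
    (x : Vec (d₁ 0)) (y : Vec (d₂ 0)) : energy σ L hd W₁ W₂ x y =
      inner ℝ (castVec hd.symm (net σ d₁ W₁ L x)) (net σ d₂ W₂ L y) := by
  rw [energy, ← Equiv.sum_comp (finCongr hd.symm)]
  simp [PiLp.inner_apply, castVec, mul_comm]

theorem abs_energy_le (hd : d₁ L = d₂ L) {W₁ : Weights d₁} {W₂ : Weights d₂}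
    {x : Vec (d₁ 0)} {y : Vec (d₂ 0)} (h₁ : ‖net σ d₁ W₁ L x‖ ≤ 1) (h₂ : ‖net σ d₂ W₂ L y‖ ≤ 1) :
    |energy σ L hd W₁ W₂ x y| ≤ 1 := by
  rw [energy_eq_inner_left]
  refine (abs_real_inner_le_norm _ _).trans ?_
  rw [norm_castVec]
  exact mul_le_one₀ h₂ (norm_nonneg _) h₁

/-- The energy truncated to `[-1, 1]`. -/
noncomputable def clipEnergy (σ : ℝ → ℝ) (L : ℕ) {d₁ d₂ : ℕ → ℕ} (hd : d₁ L = d₂ L)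
    (W₁ : Weights d₁) (W₂ : Weights d₂) (x : Vec (d₁ 0)) (y : Vec (d₂ 0)) : ℝ :=
  clip (energy σ L hd W₁ W₂ x y)

theorem abs_clipEnergy_le (hd : d₁ L = d₂ L) (W₁ : Weights d₁) (W₂ : Weights d₂)
    (x : Vec (d₁ 0)) (y : Vec (d₂ 0)) : |clipEnergy σ L hd W₁ W₂ x y| ≤ 1 :=
  abs_clip_le _

theorem continuous_energy (hL : LipschitzWith 1 σ) (hd : d₁ L = d₂ L) (W₁ : Weights d₁)
    (W₂ : Weights d₂) :
    Continuous fun z : Vec (d₁ 0) × Vec (d₂ 0) => energy σ L hd W₁ W₂ z.1 z.2 := by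
  have h₁ := (continuous_net hL W₁ L).comp
    (continuous_fst : Continuous (Prod.fst : Vec (d₁ 0) × Vec (d₂ 0) → _))
  have h₂ := (continuous_net hL W₂ L).comp
    (continuous_snd : Continuous (Prod.snd : Vec (d₁ 0) × Vec (d₂ 0) → _))
  refine continuous_finsetSum _ fun i _ => Continuous.mul ?_ ?_
  · exact (continuous_apply i).comp ((PiLp.continuous_ofLp 2 _).comp h₁)
  · exact (continuous_apply (Fin.cast hd i)).comp ((PiLp.continuous_ofLp 2 _).comp h₂)

theorem measurable_clipEnergy (hL : LipschitzWith 1 σ) (hd : d₁ L = d₂ L) (W₁ : Weights d₁)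
    (W₂ : Weights d₂) : Measurable (Function.uncurry (clipEnergy σ L hd W₁ W₂)) :=
  (lipschitzWith_clip.continuous.comp (continuous_energy hL hd W₁ W₂)).measurable

theorem continuous_clipEnergy_weights (hL : LipschitzWith 1 σ) (hd : d₁ L = d₂ L)
    (x : Vec (d₁ 0)) (y : Vec (d₂ 0)) :
    Continuous fun W : Weights d₁ × Weights d₂ => clipEnergy σ L hd W.1 W.2 x y := by
  refine lipschitzWith_clip.continuous.comp ?_
  have h₁ := (continuous_net_weights hL L x).comp
    (continuous_fst : Continuous (Prod.fst : Weights d₁ × Weights d₂ → _))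
  have h₂ := (continuous_net_weights hL L y).comp
    (continuous_snd : Continuous (Prod.snd : Weights d₁ × Weights d₂ → _))
  refine continuous_finsetSum _ fun i _ => Continuous.mul ?_ ?_
  · exact (continuous_apply i).comp ((PiLp.continuous_ofLp 2 _).comp h₁)
  · exact (continuous_apply (Fin.cast hd i)).comp ((PiLp.continuous_ofLp 2 _).comp h₂)

variable {B : ℕ → ℝ} {X : Set (Vec (d₁ 0))} {Y : Set (Vec (d₂ 0))}

/-- Admissible encoders are bounded only on the data spaces, while the deviation inequalities
require bounds at every point. Truncation provides them without changing any value on `X` and `Y`.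
-/
theorem clipEnergy_eq (hd : d₁ L = d₂ L) {W₁ : Weights d₁} {W₂ : Weights d₂}
    (h₁ : W₁ ∈ encoders σ L B d₁ X) (h₂ : W₂ ∈ encoders σ L B d₂ Y)
    {x : Vec (d₁ 0)} {y : Vec (d₂ 0)} (hx : x ∈ X) (hy : y ∈ Y) :
    clipEnergy σ L hd W₁ W₂ x y = energy σ L hd W₁ W₂ x y :=
  clip_of_abs_le (abs_energy_le hd (h₁.2 x hx) (h₂.2 y hy))

instance secondCountableTopology_weights (d : ℕ → ℕ) : SecondCountableTopology (Weights d) :=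
  inferInstanceAs (SecondCountableTopology ((l : ℕ) → Fin (d (l + 1)) → Fin (d l) → ℝ))

end Networks

/-! ### Uniform deviations over the encoders -/

/-- The Rademacher complexity of the networks with `L` layers is at most
`netRadius L B c * √n`. -/
noncomputable def netRadius (L : ℕ) (B : ℕ → ℝ) (c : ℝ) : ℝ :=
  2 ^ L * (∏ l ∈ Finset.range L, |B l|) * c

section Deviations

variable {σ : ℝ → ℝ} {L : ℕ} {d₁ d₂ : ℕ → ℕ} {B : ℕ → ℝ} {X : Set (Vec (d₁ 0))}
  {Y : Set (Vec (d₂ 0))} {P : Measure (Vec (d₁ 0) × Vec (d₂ 0))}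
  {p : Vec (d₁ 0) → Vec (d₂ 0) → ℝ} {n : ℕ} {τ c₁ c₂ : ℝ}

theorem IsDataModel.ae_pi_mem (h : IsDataModel X Y P p) (n : ℕ) :
    ∀ᵐ S ∂(Measure.pi fun _ : Fin n => P), ∀ j, (S j).1 ∈ X ∧ (S j).2 ∈ Y := by
  have := h.isProbabilityMeasure
  rw [ae_all_iff]
  intro j
  exact (measurePreserving_eval (fun _ : Fin n => P) j).quasiMeasurePreserving.ae
    (h.ae_mem.and h.ae_snd_mem)

theorem measure_energy_deviation_le (hσ : ∀ a t : ℝ, 0 ≤ a → σ (a * t) = a * σ t)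
    (hL : LipschitzWith 1 σ) (hL₁ : 1 ≤ L) (hd : d₁ L = d₂ L) (h : IsDataModel X Y P p)
    (hc₁ : 0 ≤ c₁) (hc₂ : 0 ≤ c₂) (hX : ∀ x ∈ X, ‖x‖ ≤ c₁) (hY : ∀ y ∈ Y, ‖y‖ ≤ c₂)
    {s : ℝ} (hs : 0 ≤ s) :
    (Measure.pi fun _ : Fin n => P) {S | ∃ W : encoders σ L B d₁ X × encoders σ L B d₂ Y,
      2 * (energyRadius L B c₁ c₂ * √n) + s <
        |∑ j, (clipEnergy σ L hd W.1 W.2 (S j).1 (S j).2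
          - ∫ z, clipEnergy σ L hd W.1 W.2 z.1 z.2 ∂P)|} ≤
      2 * ENNReal.ofReal (Real.exp (-s ^ 2 / (2 * (n * (2 * 1) ^ 2)))) := by
  have := h.isProbabilityMeasure
  refine measure_exists_lt_abs_sum_le (fun _ : Fin n => P)
    (f := fun (W : encoders σ L B d₁ X × encoders σ L B d₂ Y) _ z =>
      clipEnergy σ L hd W.1 W.2 z.1 z.2)
    (fun W _ => measurable_clipEnergy hL hd W.1 W.2) (fun _ z => ?_)
    (fun W _ z => abs_clipEnergy_le hd _ _ _ _) ?_ hs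
  · exact (continuous_clipEnergy_weights hL hd z.1 z.2).comp
      ((continuous_subtype_val.comp continuous_fst).prodMk
        (continuous_subtype_val.comp continuous_snd))
  · filter_upwards [h.ae_pi_mem n] with S hS
    have hr := (rademacherLE_energy hσ hL hL₁ B hc₁ hc₂ hd (fun j => (S j).1) (fun j => (S j).2)
      (fun j => hX _ (hS j).1) (fun j => hY _ (hS j).2)).comp
      fun W : encoders σ L B d₁ X × encoders σ L B d₂ Y =>
        ((⟨W.1, W.1.2.1⟩ : BoundedWeights L B d₁), (⟨W.2, W.2.2.1⟩ : BoundedWeights L B d₂))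
    convert hr using 3 with W j
    -- On almost every sample truncation has no effect, so the Rademacher bound of the untruncated
    -- energy applies as it is.
    exact clipEnergy_eq hd W.1.2 W.2.2 (hS j).1 (hS j).2

theorem rademacherLE_exp_clip_inner {T H : Type*} [NormedAddCommGroup H] [InnerProductSpace ℝ H]
    (hτ : 0 < τ) {z : T → Fin n → H} {r : ℝ} (hz : NormRademacherLE z r) :
    RademacherLE (fun (t : T × Metric.closedBall (0 : H) 1) j =>
      Real.exp (clip (inner ℝ (t.2 : H) (z t.1 j)) / τ)) (Real.exp (1 / τ) / τ * r) :=
  hz.inner_closedBall.contraction (by positivity) fun _ _ _ => abs_exp_clip_sub_le hτ _ _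

/-- A signed sum of averages over `y` is at most its value at some `y ∈ Y`, and that point may be
chosen for each sign vector. The second network then enters only through one vector of the unit
ball, so the complexity is that of the first network. The outer logarithm is Lipschitz because the
average is at least `exp (-1 / τ)`. -/
theorem rademacherLE_logMeanExp (hσ : ∀ a t : ℝ, 0 ≤ a → σ (a * t) = a * σ t)
    (hL : LipschitzWith 1 σ) (hd : d₁ L = d₂ L) [IsFiniteMeasure (refMeasure Y)]
    (hYm : NullMeasurableSet Y volume) (hV : 0 < (refMeasure Y).real Set.univ) (hτ : 0 < τ)
    (hc₁ : 0 ≤ c₁) (hX : ∀ x ∈ X, ‖x‖ ≤ c₁) {x : Fin n → Vec (d₁ 0)} (hx : ∀ j, x j ∈ X) :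
    RademacherLE (fun (W : encoders σ L B d₁ X × encoders σ L B d₂ Y) j =>
      logMeanExp τ Y (clipEnergy σ L hd W.1 W.2) (x j))
      (Real.exp (1 / τ) * (Real.exp (1 / τ) / τ * (netRadius L B c₁ * √n))) := by
  have hE : ∀ W : encoders σ L B d₁ X × encoders σ L B d₂ Y, ∀ x y,
      |clipEnergy σ L hd W.1 W.2 x y| ≤ 1 := fun W => abs_clipEnergy_le hd _ _
  have hEm : ∀ W : encoders σ L B d₁ X × encoders σ L B d₂ Y,
      Measurable (Function.uncurry (clipEnergy σ L hd W.1 W.2)) :=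
    fun W => measurable_clipEnergy hL hd W.1 W.2
  have hmean : RademacherLE (fun (W : encoders σ L B d₁ X × encoders σ L B d₂ Y) j =>
      partitionFn τ Y (clipEnergy σ L hd W.1 W.2) (x j) / (refMeasure Y).real Set.univ)
      (Real.exp (1 / τ) / τ * (netRadius L B c₁ * √n)) := by
    intro s
    have hex : ∀ ε : Fin n → ℝ, ∃ y ∈ Y,
        ∑ j, ε j * (partitionFn τ Y (clipEnergy σ L hd (s ε).1 (s ε).2) (x j)
          / (refMeasure Y).real Set.univ) ≤
        ∑ j, ε j * Real.exp (clipEnergy σ L hd (s ε).1 (s ε).2 (x j) y / τ) := by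
      intro ε
      have hi : ∀ j, Integrable (fun y => ε j *
          Real.exp (clipEnergy σ L hd (s ε).1 (s ε).2 (x j) y / τ)) (refMeasure Y) := fun j =>
        (integrable_exp_energy hτ (hE (s ε)) (hEm (s ε)) (x j)).const_mul _
      have hne : refMeasure Y ≠ 0 := by
        rintro h0
        rw [h0] at hV
        simp at hV
      obtain ⟨y, hy, hle⟩ := exists_notMem_null_average_le hne
        (integrable_finsetSum Finset.univ fun j _ => hi j) (ae_mem_refMeasure hYm)
      refine ⟨y, not_not.1 hy, le_trans (le_of_eq ?_) hle⟩
      rw [average_eq, integral_finsetSum _ fun j _ => hi j, smul_eq_mul, Finset.mul_sum]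
      refine Finset.sum_congr rfl fun j _ => ?_
      rw [integral_const_mul, partitionFn]
      ring
    choose y hyY hy using hex
    have hr := rademacherLE_exp_clip_inner hτ (normRademacherLE_net hσ hL d₁ B L x hc₁
      fun j => hX _ (hx j))
    refine (signAvg_mono hy).trans (le_trans (le_of_eq ?_) (hr fun ε =>
      ((⟨(s ε).1, (s ε).1.2.1⟩ : BoundedWeights L B d₁),
        ⟨castVec hd (net σ d₂ (s ε).2 L (y ε)), mem_closedBall_zero_iff.2
          ((norm_castVec hd _).trans_le ((s ε).2.2.2 _ (hyY ε)))⟩)))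
    simp only [clipEnergy, energy_eq_inner_left]
  refine hmean.contraction (Real.exp_nonneg _) fun W W' j => ?_
  refine (abs_log_sub_log_le (Real.exp_pos (-1 / τ))
    (exp_neg_le_partitionFn_div hV hτ (hE W) (hEm W) (x j))
    (exp_neg_le_partitionFn_div hV hτ (hE W') (hEm W') (x j))).trans (le_of_eq ?_)
  rw [neg_div, Real.exp_neg, div_inv_eq_mul, mul_comm]

theorem continuous_partitionFn_weights (hL : LipschitzWith 1 σ) (hd : d₁ L = d₂ L)
    [IsFiniteMeasure (refMeasure Y)] (hτ : 0 < τ) (x : Vec (d₁ 0)) :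
    Continuous fun W : Weights d₁ × Weights d₂ =>
      partitionFn τ Y (clipEnergy σ L hd W.1 W.2) x := by
  refine continuous_of_dominated (bound := fun _ => Real.exp (1 / τ)) (fun W => ?_) (fun W => ?_)
    (integrable_const _) ?_
  · exact (((measurable_clipEnergy hL hd W.1 W.2).comp
      measurable_prodMk_left).div_const τ).exp.aestronglyMeasurable
  · refine ae_of_all _ fun y => ?_
    rw [Real.norm_eq_abs, abs_of_nonneg (Real.exp_nonneg _)]
    exact exp_div_le_exp hτ (abs_clipEnergy_le hd _ _ _ _)
  · exact ae_of_all _ fun y =>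
      Real.continuous_exp.comp ((continuous_clipEnergy_weights hL hd x y).div_const τ)

theorem measure_logMeanExp_deviation_le (hσ : ∀ a t : ℝ, 0 ≤ a → σ (a * t) = a * σ t)
    (hL : LipschitzWith 1 σ) (hd : d₁ L = d₂ L) (h : IsDataModel X Y P p)
    [IsFiniteMeasure (refMeasure Y)] (hV : 0 < (refMeasure Y).real Set.univ) (hτ : 0 < τ)
    (hc₁ : 0 ≤ c₁) (hX : ∀ x ∈ X, ‖x‖ ≤ c₁) {s : ℝ} (hs : 0 ≤ s) :
    (Measure.pi fun _ : Fin n => P) {S | ∃ W : encoders σ L B d₁ X × encoders σ L B d₂ Y,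
      2 * (Real.exp (1 / τ) * (Real.exp (1 / τ) / τ * (netRadius L B c₁ * √n))) + s <
        |∑ j, (logMeanExp τ Y (clipEnergy σ L hd W.1 W.2) (S j).1
          - ∫ z, logMeanExp τ Y (clipEnergy σ L hd W.1 W.2) z.1 ∂P)|} ≤
      2 * ENNReal.ofReal (Real.exp (-s ^ 2 / (2 * (n * (2 * (1 / τ)) ^ 2)))) := by
  have := h.isProbabilityMeasure
  have hE : ∀ (W₁ : Weights d₁) (W₂ : Weights d₂), ∀ x y,
      |clipEnergy σ L hd W₁ W₂ x y| ≤ 1 := fun W₁ W₂ => abs_clipEnergy_le hd _ _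
  refine measure_exists_lt_abs_sum_le (fun _ : Fin n => P)
    (f := fun (W : encoders σ L B d₁ X × encoders σ L B d₂ Y) _ z =>
      logMeanExp τ Y (clipEnergy σ L hd W.1 W.2) z.1)
    (fun W _ => (measurable_logMeanExp (measurable_clipEnergy hL hd W.1 W.2)).comp measurable_fst)
    (fun _ z => ?_)
    (fun W _ z => abs_logMeanExp_le hV hτ (hE _ _) (measurable_clipEnergy hL hd W.1 W.2) _) ?_ hs
  · have hc := (continuous_partitionFn_weights (Y := Y) hL hd hτ z.1).comp
      ((continuous_subtype_val.comp continuous_fst).prodMk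
        (continuous_subtype_val.comp continuous_snd) :
        Continuous fun W : encoders σ L B d₁ X × encoders σ L B d₂ Y => (W.1.1, W.2.1))
    refine (hc.div_const _).log fun W => ?_
    exact (div_pos (partitionFn_pos hV hτ (hE _ _) (measurable_clipEnergy hL hd _ _) _) hV).ne'
  · filter_upwards [h.ae_pi_mem n] with S hS
    exact rademacherLE_logMeanExp hσ hL hd h.nullMeasurable_Y hV hτ hc₁ hX fun j => (hS j).1

end Deviations

/-! ### The estimator of the partition function -/

namespace IsDataModel

variable {a b : ℕ} {X : Set (Vec a)} {Y : Set (Vec b)} {P : Measure (Vec a × Vec b)}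
  {p : Vec a → Vec b → ℝ}

theorem measurable_density_right (h : IsDataModel X Y P p) (x : Vec a) : Measurable (p x) :=
  h.measurable_density.comp measurable_prodMk_left

theorem integral_condLaw (h : IsDataModel X Y P p) (x : Vec a) (f : Vec b → ℝ) :
    ∫ y, f y ∂(condLaw Y p x) = ∫ y, p x y * f y ∂(refMeasure Y) := by
  rw [condLaw, integral_withDensity_eq_integral_toReal_smul (h.measurable_ofReal x)
    (ae_of_all _ fun _ => ENNReal.ofReal_lt_top)]
  refine integral_congr_ae (ae_of_all _ fun y => ?_)
  simp only [smul_eq_mul, ENNReal.toReal_ofReal (h.density_nonneg x y)]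

theorem integrable_density_right (h : IsDataModel X Y P p) {x : Vec a}
    (hx : IsProbabilityMeasure (condLaw Y p x)) : Integrable (p x) (refMeasure Y) := by
  refine ⟨(h.measurable_density_right x).aestronglyMeasurable, ?_⟩
  rw [hasFiniteIntegral_iff_ofReal (ae_of_all _ (h.density_nonneg x))]
  have := hx.measure_univ
  rw [condLaw, withDensity_apply _ MeasurableSet.univ, Measure.restrict_univ] at this
  rw [this]
  exact ENNReal.one_lt_top

/-- Conditionally on the `x_j`, the estimator of the partition function with the popularities
as weights is unbiased. -/
theorem sum_integral_condLaw (h : IsDataModel X Y P p) {n : ℕ} {x : Fin n → Vec a}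
    (hx : ∀ j, IsProbabilityMeasure (condLaw Y p (x j))) {C : ℝ} (hC : 0 < C)
    (hq : ∀ᵐ y ∂(Measure.pi fun j => condLaw Y p (x j)), ∀ j, C ≤ ∑ j', p (x j') (y j))
    (hpos : ∀ᵐ y ∂(refMeasure Y), 0 < ∑ j', p (x j') y) {w : Vec b → ℝ} (hw : Measurable w)
    {M : ℝ} (hM : ∀ y, |w y| ≤ M) :
    ∑ j, ∫ y, w y / max (∑ j', p (x j') y) C ∂(condLaw Y p (x j)) = ∫ y, w y ∂(refMeasure Y) := by
  have hm : Measurable fun y => ∑ j', p (x j') y :=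
    Finset.measurable_fun_sum _ fun j _ => h.measurable_density_right (x j)
  have hfm : Measurable fun y => w y / max (∑ j', p (x j') y) C :=
    hw.div (hm.max measurable_const)
  have hfb : ∀ y, ‖w y / max (∑ j', p (x j') y) C‖ ≤ M / C := fun y => by
    have : 0 < max (∑ j', p (x j') y) C := hC.trans_le (le_max_right _ _)
    rw [Real.norm_eq_abs, abs_div, abs_of_pos this]
    exact div_le_div₀ ((abs_nonneg _).trans (hM y)) (hM y) hC (le_max_right _ _)
  simp_rw [h.integral_condLaw]
  rw [← integral_finsetSum]
  swap
  · intro j _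
    exact (h.integrable_density_right (hx j)).mul_bdd hfm.aestronglyMeasurable
      (ae_of_all _ hfb)
  -- The lower bound on the popularity is known only at sampled points. In terms of the reference
  -- measure, it holds for almost every `y` at which some `p(y ∣ x_j)` is nonzero, and `hpos` says
  -- that these are almost all `y`. Thus the maximum with `C` is inactive, and it serves only to
  -- make the integrands bounded everywhere.
  have hge : ∀ j, ∀ᵐ y ∂(refMeasure Y), p (x j) y ≠ 0 → C ≤ ∑ j', p (x j') y := by
    intro j
    have h₁ : ∀ᵐ y ∂(condLaw Y p (x j)), C ≤ ∑ j', p (x j') y := by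
      have hs : MeasurableSet {y | C ≤ ∑ j', p (x j') y} := measurableSet_le measurable_const hm
      have he := measurePreserving_eval (fun j => condLaw Y p (x j)) j
      rw [← he.map_eq]
      exact (ae_map_iff he.measurable.aemeasurable hs).2 (hq.mono fun y hy => hy j)
    rw [condLaw, ae_withDensity_iff (h.measurable_ofReal (x j))] at h₁
    filter_upwards [h₁] with y hy hne
    refine hy ?_
    rw [Ne, ENNReal.ofReal_eq_zero, not_le]
    exact lt_of_le_of_ne (h.density_nonneg _ _) hne.symm
  refine integral_congr_ae ?_
  filter_upwards [ae_all_iff.2 hge, hpos] with y hy hy'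
  obtain ⟨j, -, hj⟩ := Finset.exists_ne_zero_of_sum_ne_zero hy'.ne'
  rw [← Finset.sum_mul, max_eq_left (hy j hj)]
  field_simp

theorem measurable_popularity (h : IsDataModel X Y P p) {n : ℕ} (j : Fin n) :
    Measurable fun S : Fin n → Vec a × Vec b => popularity p S j :=
  Finset.measurable_fun_sum Finset.univ fun j' _ => h.measurable_density.comp
    ((measurable_fst.comp (measurable_pi_apply j')).prodMk
      (measurable_snd.comp (measurable_pi_apply j)))

end IsDataModel

section Deviations

variable {σ : ℝ → ℝ} {L : ℕ} {d₁ d₂ : ℕ → ℕ} {B : ℕ → ℝ} {X : Set (Vec (d₁ 0))}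
  {Y : Set (Vec (d₂ 0))} {P : Measure (Vec (d₁ 0) × Vec (d₂ 0))}
  {p : Vec (d₁ 0) → Vec (d₂ 0) → ℝ} {n : ℕ} {τ c c₂ : ℝ}

/-- The function `y ↦ exp (⟨v, E₂(w₂; y)⟩ / τ)`, truncated. -/
noncomputable def expInner (σ : ℝ → ℝ) (L : ℕ) (d : ℕ → ℕ) (τ : ℝ) (W : Weights d) (v : Vec (d L))
    (y : Vec (d 0)) : ℝ :=
  Real.exp (clip (inner ℝ v (net σ d W L y)) / τ)

theorem abs_expInner_le (hτ : 0 < τ) {d : ℕ → ℕ} (W : Weights d) (v : Vec (d L)) (y : Vec (d 0)) :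
    |expInner σ L d τ W v y| ≤ Real.exp (1 / τ) := by
  rw [expInner, abs_of_nonneg (Real.exp_nonneg _)]
  exact exp_div_le_exp hτ (abs_clip_le _)

theorem measurable_expInner (hL : LipschitzWith 1 σ) {d : ℕ → ℕ} (W : Weights d) (v : Vec (d L)) :
    Measurable (expInner σ L d τ W v) :=
  (Real.continuous_exp.comp ((lipschitzWith_clip.continuous.comp
    (continuous_const.inner (continuous_net hL W L))).div_const τ)).measurable

theorem continuous_expInner (hL : LipschitzWith 1 σ) {d : ℕ → ℕ} (S : Set (Weights d))
    (y : Vec (d 0)) :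
    Continuous fun t : S × Metric.closedBall (0 : Vec (d L)) 1 =>
      expInner σ L d τ t.1 (t.2 : Vec (d L)) y :=
  Real.continuous_exp.comp ((lipschitzWith_clip.continuous.comp
    ((continuous_subtype_val.comp continuous_snd).inner ((continuous_net_weights hL L y).comp
      (continuous_subtype_val.comp continuous_fst)))).div_const τ)

/-- Once the `x_j` are fixed, the denominator is a fixed function of `y` and the summands are
independent with total mean the partition function. The unit vector `t.2` stands for the output of
the first encoder at any point. Denominators are at least `c n`, which supplies the factor `1 / n`
in both the range and the Lipschitz constant. -/
theorem measure_partitionFn_deviation_le (hσ : ∀ a t : ℝ, 0 ≤ a → σ (a * t) = a * σ t)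
    (hL : LipschitzWith 1 σ) (h : IsDataModel X Y P p) (hτ : 0 < τ) (hc : 0 < c)
    (hc₂ : 0 ≤ c₂) (hY : ∀ y ∈ Y, ‖y‖ ≤ c₂) (hn : 1 ≤ n)
    (hpop : ∀ᵐ S ∂(Measure.pi fun _ : Fin n => P), ∀ j, c * n ≤ popularity p S j)
    (hpos : ∀ᵐ S ∂(Measure.pi fun _ : Fin n => P), ∀ᵐ y ∂(refMeasure Y), 0 < densitySum p S y)
    {s : ℝ} (hs : 0 ≤ s) :
    (Measure.pi fun _ : Fin n => P)
      {S | ∃ t : encoders σ L B d₂ Y × Metric.closedBall (0 : Vec (d₂ L)) 1,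
        2 * (Real.exp (1 / τ) / (τ * (c * n)) * (netRadius L B c₂ * √n)) + s <
        |∑ j, expInner σ L d₂ τ t.1 t.2 (S j).2 / max (popularity p S j) (c * n)
          - ∫ y, expInner σ L d₂ τ t.1 t.2 y ∂(refMeasure Y)|} ≤
      2 * ENNReal.ofReal (Real.exp (-s ^ 2 / (2 * (n * (2 * (Real.exp (1 / τ) / (c * n))) ^ 2)))) := by
  have := h.isProbabilityMeasure
  have := isFiniteMeasure_refMeasure hY
  have hn0 : (0 : ℝ) < n := by exact_mod_cast hn
  have hcn : 0 < c * n := mul_pos hc hn0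
  rcases isEmpty_or_nonempty (encoders σ L B d₂ Y) with hT | hT
  · simp
  have hT' : Nonempty (Metric.closedBall (0 : Vec (d₂ L)) 1) := ⟨⟨0, by simp⟩⟩
  have hcont : ∀ S : Fin n → Vec (d₁ 0) × Vec (d₂ 0), Continuous
      fun t : encoders σ L B d₂ Y × Metric.closedBall (0 : Vec (d₂ L)) 1 =>
        |∑ j, expInner σ L d₂ τ t.1 t.2 (S j).2 / max (popularity p S j) (c * n)
          - ∫ y, expInner σ L d₂ τ t.1 t.2 y ∂(refMeasure Y)| := by
    intro S
    refine ((continuous_finsetSum _ fun j _ => (continuous_expInner hL _ _).div_const _).sub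
      ?_).abs
    exact continuous_of_dominated (bound := fun _ => Real.exp (1 / τ))
      (fun t => (measurable_expInner hL _ _).aestronglyMeasurable)
      (fun t => ae_of_all _ (abs_expInner_le hτ _ _)) (integrable_const _)
      (ae_of_all _ fun y => continuous_expInner hL _ y)
  refine h.pi_le_of_ae_le ?_ ?_
  -- Disintegration needs a measurable event; a dense sequence of parameters turns the existential
  -- into a countable union.
  · simp only [exists_lt_iff_exists_denseSeq (hcont _)]
    rw [Set.ofPred_exists]
    refine MeasurableSet.iUnion fun k => measurableSet_lt measurable_const ?_
    refine ((Finset.measurable_fun_sum _ fun j _ => ?_).sub measurable_const).abs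
    exact ((measurable_expInner hL _ _).comp (measurable_snd.comp (measurable_pi_apply j))).div
      ((h.measurable_popularity j).max measurable_const)
  have hprob : ∀ᵐ x ∂(Measure.pi fun _ : Fin n => P.fst),
      ∀ j, IsProbabilityMeasure (condLaw Y p (x j)) := by
    have := h.isProbabilityMeasure_fst
    rw [ae_all_iff]
    intro j
    exact (measurePreserving_eval (fun _ : Fin n => P.fst) j).quasiMeasurePreserving.ae
      h.ae_isProbabilityMeasure_condLaw
  filter_upwards [hprob, h.ae_ae_of_ae_pi hpop, h.ae_ae_of_ae_pi hpos,
    h.ae_ae_of_ae_pi (h.ae_pi_mem n)] with x hx hxpop hxpos hxmem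
  -- The positivity of the density sum involves only the `x_j`, so any one choice of the `y_j`
  -- delivers it.
  obtain ⟨y₀, hy₀⟩ := hxpos.exists
  have hq : Measurable fun y : Vec (d₂ 0) => max (∑ j', p (x j') y) (c * n) :=
    (Finset.measurable_fun_sum _ fun j _ => h.measurable_density_right (x j)).max measurable_const
  have hmain := measure_exists_lt_abs_sum_le (fun j => condLaw Y p (x j))
    (f := fun (t : encoders σ L B d₂ Y × Metric.closedBall (0 : Vec (d₂ L)) 1) _ y =>
      expInner σ L d₂ τ t.1 t.2 y / max (∑ j', p (x j') y) (c * n))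
    (b := Real.exp (1 / τ) / (c * n))
    (r := Real.exp (1 / τ) / (τ * (c * n)) * (netRadius L B c₂ * √n))
    (fun t j => (measurable_expInner hL _ _).div hq)
    (fun j y => (continuous_expInner hL _ _).div_const _) (fun t j y => ?_) ?_ hs
  · refine (measure_mono ?_).trans hmain
    rintro y ⟨t, ht⟩
    refine ⟨t, ht.trans_eq ?_⟩
    rw [Finset.sum_sub_distrib, h.sum_integral_condLaw hx hcn hxpop hy₀ (measurable_expInner hL _ _)
      (abs_expInner_le hτ _ _)]
    rfl
  · have : 0 < max (∑ j', p (x j') y) (c * n) := hcn.trans_le (le_max_right _ _)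
    rw [abs_div, abs_of_pos this]
    exact div_le_div₀ (Real.exp_nonneg _) (abs_expInner_le hτ _ _ _) hcn (le_max_right _ _)
  · filter_upwards [hxmem] with y hy
    have hr := (normRademacherLE_net hσ hL d₂ B L y hc₂
      fun j => hY _ (hy j).2).inner_closedBall.comp
        fun t : encoders σ L B d₂ Y × Metric.closedBall (0 : Vec (d₂ L)) 1 =>
          ((⟨t.1, t.1.2.1⟩ : BoundedWeights L B d₂), t.2)
    refine hr.contraction (by positivity) fun t u j => ?_
    have hmax : 0 < max (∑ j', p (x j') (y j)) (c * n) := hcn.trans_le (le_max_right _ _)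
    rw [← sub_div, abs_div, abs_of_pos hmax]
    refine (div_le_div₀ (by positivity) (abs_exp_clip_sub_le hτ _ _) hcn
      (le_max_right _ _)).trans (le_of_eq ?_)
    field_simp

end Deviations

/-! ### The generalization bound -/

/-! ### Dependence of risks and error terms on the data spaces only -/

section Congr

variable {a b n : ℕ} {τ : ℝ} {Y : Set (Vec b)} {E E' : Vec a → Vec b → ℝ}
  {S : Fin n → Vec a × Vec b}

theorem empRisk_congr (h : ∀ i j, E (S i).1 (S j).2 = E' (S i).1 (S j).2) (qt : Fin n → ℝ) :
    empRisk τ E qt S = empRisk τ E' qt S := by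
  simp only [empRisk, misPartitionFn, h]

theorem errTerm_congr (h : ∀ i j, E (S i).1 (S j).2 = E' (S i).1 (S j).2) (qt q : Fin n → ℝ) :
    errTerm τ E qt q S = errTerm τ E' qt q S := by
  simp only [errTerm, h]

theorem errTermCross_congr (h : ∀ i j, E (S i).1 (S j).2 = E' (S i).1 (S j).2)
    (qt q : Fin n → ℝ) : errTermCross τ E qt q S = errTermCross τ E' qt q S := by
  simp only [errTermCross, h]

theorem errTermCross_nonneg (E : Vec a → Vec b → ℝ) (qt q : Fin n → ℝ)
    (S : Fin n → Vec a × Vec b) : 0 ≤ errTermCross τ E qt q S := by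
  unfold errTermCross
  positivity

theorem IsDataModel.trueRisk_congr {X : Set (Vec a)} {P : Measure (Vec a × Vec b)}
    {p : Vec a → Vec b → ℝ} (hP : IsDataModel X Y P p)
    (h : ∀ x ∈ X, ∀ y ∈ Y, E x y = E' x y) : trueRisk τ Y P E = trueRisk τ Y P E' := by
  refine integral_congr_ae ?_
  filter_upwards [hP.ae_mem, hP.ae_snd_mem] with z hx hy
  have : partitionFn τ Y E z.1 = partitionFn τ Y E' z.1 := by
    refine integral_congr_ae ?_
    filter_upwards [ae_mem_refMeasure hP.nullMeasurable_Y] with y hy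
    rw [h _ hx _ hy]
  rw [this, h _ hx _ hy]

end Congr

/-- The deviation level that makes each one-sided failure probability exactly `δ / 6` for summands
bounded by `β`. Three two-sided events then add up to `δ`. -/
theorem exp_deviation_eq {β δ : ℝ} {n : ℕ} (hβ : 0 < β) (hn : 1 ≤ n) (hδ : 0 < δ) (hδ' : δ < 1) :
    Real.exp (-(β * √(8 * n * Real.log (6 / δ))) ^ 2 / (2 * (n * (2 * β) ^ 2))) = δ / 6 := by
  have hn0 : (0 : ℝ) < n := by exact_mod_cast hn
  have hlog : 0 ≤ Real.log (6 / δ) := Real.log_nonneg (by rw [le_div_iff₀ hδ]; linarith)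
  rw [mul_pow, Real.sq_sqrt (by positivity)]
  have : -(β ^ 2 * (8 * n * Real.log (6 / δ))) / (2 * (n * (2 * β) ^ 2)) = -Real.log (6 / δ) := by
    field_simp; ring
  rw [this, Real.exp_neg, Real.exp_log (by positivity), inv_div]

/-- The only place where the output dimension matters, through `1 ≤ k`. Since `log 6 ≤ 5`, the
square of the second left-hand side is at most `8 n (5 + log (1 / δ))`, and both `40` and `8` are
below `7² = 49`. -/
theorem deviation_rate_le {δ : ℝ} {n k : ℕ} (hn : 1 ≤ n) (hk : 1 ≤ k) (hδ : 0 < δ) (hδ' : δ < 1) :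
    √n ≤ √(k / n) * n ∧
    √(8 * n * Real.log (6 / δ)) ≤ 7 * (√(k / n) + √(Real.log (1 / δ) / n)) * n := by
  have hn0 : (0 : ℝ) < n := by exact_mod_cast hn
  have hk1 : (1 : ℝ) ≤ k := by exact_mod_cast hk
  have hlog : 0 ≤ Real.log (1 / δ) := Real.log_nonneg (by rw [le_div_iff₀ hδ]; linarith)
  have h₁ : √(k / n : ℝ) ^ 2 * n = k := by rw [Real.sq_sqrt (by positivity)]; field_simp
  have h₂ : √(Real.log (1 / δ) / n) ^ 2 * n = Real.log (1 / δ) := by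
    rw [Real.sq_sqrt (by positivity)]; field_simp
  constructor
  · refine abs_le_of_sq_le_sq' ?_ (by positivity) |>.2
    rw [mul_pow, Real.sq_sqrt hn0.le]
    have : √(k / n : ℝ) ^ 2 * (n : ℝ) ^ 2 = k * n := by rw [pow_two (n : ℝ), ← mul_assoc, h₁]
    rw [this]
    nlinarith
  · have h6 : Real.log (6 / δ) ≤ 5 + Real.log (1 / δ) := by
      rw [show (6 : ℝ) / δ = 6 * (1 / δ) by ring, Real.log_mul (by norm_num) (by positivity)]
      linarith [Real.log_le_sub_one_of_pos (by norm_num : (0 : ℝ) < 6)]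
    refine abs_le_of_sq_le_sq' ?_ (by positivity) |>.2
    have hlog6 : 0 ≤ Real.log (6 / δ) := Real.log_nonneg (by rw [le_div_iff₀ hδ]; linarith)
    rw [Real.sq_sqrt (by positivity)]
    set u := √(k / n : ℝ)
    set v := √(Real.log (1 / δ) / n)
    have hu : 0 ≤ u := Real.sqrt_nonneg _
    have hv : 0 ≤ v := Real.sqrt_nonneg _
    have e : (7 * (u + v) * n) ^ 2 = 49 * (u ^ 2 * n + v ^ 2 * n + 2 * (u * v) * n) * n := by ring
    rw [e, h₁, h₂]
    rw [mul_right_comm]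
    refine mul_le_mul_of_nonneg_right ?_ hn0.le
    have : 0 ≤ u * v * n := by positivity
    nlinarith

/-- The constant of the generalization bound. -/
noncomputable def boundConst (τ : ℝ) (L : ℕ) (B : ℕ → ℝ) (c₁ c₂ c K m : ℝ) : ℝ :=
  ((2 * energyRadius L B |c₁| |c₂| + 7)
    + (τ * (2 * (Real.exp (1 / τ) * (Real.exp (1 / τ) / τ * netRadius L B |c₁|))) + 7)
    + τ / min (Real.exp (-1 / τ) / K) (m * Real.exp (-1 / τ))
      * (2 * (Real.exp (1 / τ) / (τ * c) * netRadius L B |c₂|) + 7 * (Real.exp (1 / τ) / c)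
        + Real.exp (1 / τ))) * Real.exp (2 / τ)

theorem netRadius_nonneg (L : ℕ) (B : ℕ → ℝ) {c : ℝ} (hc : 0 ≤ c) : 0 ≤ netRadius L B c := by
  unfold netRadius
  positivity

theorem boundConst_pos {τ c K m : ℝ} (hτ : 0 < τ) (hc : 0 < c) (hK : 0 < K) (hm : 0 < m) (L : ℕ)
    (B : ℕ → ℝ) (c₁ c₂ : ℝ) : 0 < boundConst τ L B c₁ c₂ c K m := by
  have h₁ := energyRadius_nonneg L B (abs_nonneg c₁) (abs_nonneg c₂)
  have h₂ := netRadius_nonneg L B (abs_nonneg c₁)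
  have h₃ := netRadius_nonneg L B (abs_nonneg c₂)
  have h₄ : 0 < min (Real.exp (-1 / τ) / K) (m * Real.exp (-1 / τ)) :=
    lt_min (by positivity) (by positivity)
  unfold boundConst
  positivity

section Bound

variable {σ : ℝ → ℝ} {L : ℕ} {d₁ d₂ : ℕ → ℕ} {B : ℕ → ℝ} {X : Set (Vec (d₁ 0))}
  {Y : Set (Vec (d₂ 0))} {P : Measure (Vec (d₁ 0) × Vec (d₂ 0))}
  {p : Vec (d₁ 0) → Vec (d₂ 0) → ℝ} {n : ℕ} {τ c K m c₁ c₂ δ : ℝ}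

/-- Outside three deviation events of probability at most `δ / 3` each and two null sets, the
deterministic decomposition applies to all weights and all `q̃` at once, because the randomness was
controlled without reference to `q̃`. -/
theorem measure_generalization_gap_le (hτ : 0 < τ) (hL₁ : 1 ≤ L) (hc : 0 < c)
    (hm : 0 < m) (hd : d₁ L = d₂ L) (hdL : 1 ≤ d₁ L)
    (hσ : ∀ a t : ℝ, 0 ≤ a → σ (a * t) = a * σ t) (hL : LipschitzWith 1 σ)
    (hX : ∀ x ∈ X, ‖x‖ ≤ c₁) (hY : ∀ y ∈ Y, ‖y‖ ≤ c₂)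
    (hmY : ENNReal.ofReal m ≤ refMeasure Y Set.univ) (h : IsDataModel X Y P p) (hn : 1 ≤ n)
    (hpop : ∀ᵐ S ∂(Measure.pi fun _ : Fin n => P), ∀ j, c * n ≤ popularity p S j)
    (hpos : ∀ᵐ S ∂(Measure.pi fun _ : Fin n => P), ∀ᵐ y ∂(refMeasure Y), 0 < densitySum p S y)
    (hδ : 0 < δ) (hδ' : δ < 1) :
    (Measure.pi fun _ : Fin n => P)
      {S | ¬ ∀ W₁ ∈ encoders σ L B d₁ X, ∀ W₂ ∈ encoders σ L B d₂ Y,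
        ∀ qt : Fin n → ℝ, (∀ j, 0 < qt j ∧ qt j ≤ K * n) →
          |empRisk τ (energy σ L hd W₁ W₂) qt S - trueRisk τ Y P (energy σ L hd W₁ W₂)|
            ≤ boundConst τ L B c₁ c₂ c K m *
              (1 / n + √(d₁ L / n) + √(Real.log (1 / δ) / n)
              + errTerm τ (energy σ L hd W₁ W₂) qt (popularity p S) S) ∧
          |empRisk τ (energy σ L hd W₁ W₂) qt S - trueRisk τ Y P (energy σ L hd W₁ W₂)|
            ≤ boundConst τ L B c₁ c₂ c K m *
              (1 / n + √(d₁ L / n) + √(Real.log (1 / δ) / n)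
              + errTermCross τ (energy σ L hd W₁ W₂) qt (popularity p S) S)}
      ≤ ENNReal.ofReal δ := by
  have := h.isProbabilityMeasure
  have := isFiniteMeasure_refMeasure hY
  have hn0 : (0 : ℝ) < n := by exact_mod_cast hn
  have hcn : 0 < c * n := mul_pos hc hn0
  have hVm : m ≤ (refMeasure Y).real Set.univ :=
    (ENNReal.ofReal_le_iff_le_toReal (measure_ne_top _ _)).1 hmY
  have hV := hm.trans_le hVm
  -- The constant is chosen before the data spaces, when the signs of `c₁` and `c₂` are unknown;
  -- absolute values keep it positive.
  have hX' : ∀ x ∈ X, ‖x‖ ≤ |c₁| := fun x hx => (hX x hx).trans (le_abs_self _)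
  have hY' : ∀ y ∈ Y, ‖y‖ ≤ |c₂| := fun y hy => (hY y hy).trans (le_abs_self _)
  set s := √(8 * n * Real.log (6 / δ)) with hs_def
  have hs : 0 ≤ s := Real.sqrt_nonneg _
  have A₁ := measure_energy_deviation_le (n := n) (B := B) hσ hL hL₁ hd h (abs_nonneg c₁)
    (abs_nonneg c₂) hX' hY' (s := 1 * s) (by positivity)
  have A₂ := measure_logMeanExp_deviation_le (n := n) (B := B) hσ hL hd h hV hτ (abs_nonneg c₁) hX'
    (s := 1 / τ * s) (by positivity)
  have A₃ := measure_partitionFn_deviation_le (L := L) (B := B) hσ hL h hτ hc (abs_nonneg c₂) hY' hn hpop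
    hpos (s := Real.exp (1 / τ) / (c * n) * s) (by positivity)
  rw [exp_deviation_eq one_pos hn hδ hδ'] at A₁
  rw [exp_deviation_eq (by positivity) hn hδ hδ'] at A₂ A₃
  have hsum : (2 * ENNReal.ofReal (δ / 6) + 2 * ENNReal.ofReal (δ / 6)
      + 2 * ENNReal.ofReal (δ / 6)) + (0 + 0) = ENNReal.ofReal δ := by
    have : (2 : ENNReal) * ENNReal.ofReal (δ / 6) = ENNReal.ofReal (δ / 3) := by
      rw [← ENNReal.ofReal_ofNat, ← ENNReal.ofReal_mul (by norm_num)]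
      congr 1; ring
    rw [this, ← ENNReal.ofReal_add (by positivity) (by positivity),
      ← ENNReal.ofReal_add (by positivity) (by positivity), add_zero, add_zero]
    congr 1; ring
  rw [← hsum]
  refine (measure_mono ?_).trans ((measure_union_le _ _).trans (add_le_add
    ((measure_union_le _ _).trans (add_le_add ((measure_union_le _ _).trans
      (add_le_add A₁ A₂)) A₃)) ((measure_union_le _ _).trans (add_le_add
        (h.ae_pi_mem n).le (hpop).le))))
  intro S hS
  by_contra hgood
  simp only [Set.mem_union, not_or] at hgood
  obtain ⟨⟨⟨g₁, g₂⟩, g₃⟩, g₄, g₅⟩ := hgood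
  have g₄ := not_not.1 g₄
  have g₅ := not_not.1 g₅
  refine hS fun W₁ hW₁ W₂ hW₂ qt hqt => ?_
  set E' := clipEnergy σ L hd W₁ W₂ with hE'
  have hE : ∀ x y, |E' x y| ≤ 1 := abs_clipEnergy_le hd W₁ W₂
  have hEm : Measurable (Function.uncurry E') := measurable_clipEnergy hL hd W₁ W₂
  have hcongr : ∀ x ∈ X, ∀ y ∈ Y, energy σ L hd W₁ W₂ x y = E' x y := fun x hx y hy =>
    (clipEnergy_eq hd hW₁ hW₂ hx hy).symm
  have hcS : ∀ i j, energy σ L hd W₁ W₂ (S i).1 (S j).2 = E' (S i).1 (S j).2 := fun i j =>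
    hcongr _ (g₄ i).1 _ (g₄ j).2
  rw [empRisk_congr hcS, h.trueRisk_congr hcongr, errTerm_congr hcS, errTermCross_congr hcS]
  have h₁ := not_lt.1 fun hlt => g₁ ⟨(⟨W₁, hW₁⟩, ⟨W₂, hW₂⟩), hlt⟩
  have h₂ := not_lt.1 fun hlt => g₂ ⟨(⟨W₁, hW₁⟩, ⟨W₂, hW₂⟩), hlt⟩
  have h₃ : ∀ i, |∑ j, Real.exp (E' (S i).1 (S j).2 / τ) / popularity p S j
      - partitionFn τ Y E' (S i).1| ≤
      2 * (Real.exp (1 / τ) / (τ * (c * n)) * (netRadius L B |c₂| * √n))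
        + Real.exp (1 / τ) / (c * n) * s := by
    intro i
    have hv : ‖castVec hd.symm (net σ d₁ W₁ L (S i).1)‖ ≤ 1 :=
      (norm_castVec hd.symm _).trans_le (hW₁.2 _ (g₄ i).1)
    -- The unit vector is the first encoder's output at `x_i`. One event uniform over the ball thus
    -- serves every `i`, although `x_i` belongs to the sample.
    have := not_lt.1 fun hlt => g₃ ⟨(⟨W₂, hW₂⟩, ⟨_, mem_closedBall_zero_iff.2 hv⟩), hlt⟩
    refine le_trans (le_of_eq ?_) this
    have e : ∀ y, Real.exp (E' (S i).1 y / τ) =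
        expInner σ L d₂ τ W₂ (castVec hd.symm (net σ d₁ W₁ L (S i).1)) y := fun y => by
      rw [expInner, hE', clipEnergy, energy_eq_inner_right]
    simp only [partitionFn, e, max_eq_left (g₅ _)]
  set l := min (Real.exp (-1 / τ) / K) (m * Real.exp (-1 / τ)) with hl
  have hK : 0 < K := pos_of_mul_pos_left ((hqt ⟨0, hn⟩).1.trans_le (hqt ⟨0, hn⟩).2) hn0.le
  have hl0 : 0 < l := lt_min (by positivity) (by positivity)
  have hgap := abs_empRisk_sub_trueRisk_le hV hτ hE hEm P hn hqt S hl0 (min_le_left _ _)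
    ((min_le_right _ _).trans (mul_le_mul_of_nonneg_right hVm (Real.exp_nonneg _))) h₁ h₂ h₃
  obtain ⟨r₁, r₂⟩ := deviation_rate_le hn hdL hδ hδ'
  rw [← hs_def] at r₂
  set u := √(d₁ L / n : ℝ)
  set v := √(Real.log (1 / δ) / n)
  have hu : 0 ≤ u := Real.sqrt_nonneg _
  have hv : 0 ≤ v := Real.sqrt_nonneg _
  set ρ₁ := energyRadius L B |c₁| |c₂|
  set ρ₂ := netRadius L B |c₁|
  set ρ₃ := netRadius L B |c₂|
  have hρ₁ : 0 ≤ ρ₁ := energyRadius_nonneg L B (abs_nonneg c₁) (abs_nonneg c₂)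
  have hρ₂ : 0 ≤ ρ₂ := netRadius_nonneg L B (abs_nonneg c₁)
  have hρ₃ : 0 ≤ ρ₃ := netRadius_nonneg L B (abs_nonneg c₂)
  set e₁ := Real.exp (1 / τ)
  have he₁ : 0 < e₁ := Real.exp_pos _
  set R := √(n : ℝ)
  have q₁ : R / n ≤ u + v := by rw [div_le_iff₀ hn0]; nlinarith
  have q₂ : s / n ≤ 7 * (u + v) := by rw [div_le_iff₀ hn0]; exact r₂
  have d₁' : (2 * (ρ₁ * R) + 1 * s) / n ≤ (2 * ρ₁ + 7) * (u + v) := by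
    have : (2 * (ρ₁ * R) + 1 * s) / n = 2 * ρ₁ * (R / n) + s / n := by ring
    rw [this, add_mul]
    exact add_le_add (mul_le_mul_of_nonneg_left q₁ (by positivity)) q₂
  have d₂' : τ * (2 * (e₁ * (e₁ / τ * (ρ₂ * R))) + 1 / τ * s) / n ≤
      (τ * (2 * (e₁ * (e₁ / τ * ρ₂))) + 7) * (u + v) := by
    have : τ * (2 * (e₁ * (e₁ / τ * (ρ₂ * R))) + 1 / τ * s) / n
        = τ * (2 * (e₁ * (e₁ / τ * ρ₂))) * (R / n) + s / n := by field_simp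
    rw [this, add_mul]
    exact add_le_add (mul_le_mul_of_nonneg_left q₁ (by positivity)) q₂
  have d₃' : 2 * (e₁ / (τ * (c * n)) * (ρ₃ * R)) + e₁ / (c * n) * s ≤
      (2 * (e₁ / (τ * c) * ρ₃) + 7 * (e₁ / c)) * (u + v) := by
    have : 2 * (e₁ / (τ * (c * n)) * (ρ₃ * R)) + e₁ / (c * n) * s
        = 2 * (e₁ / (τ * c) * ρ₃) * (R / n) + e₁ / c * (s / n) := by field_simp
    rw [this, add_mul]
    refine add_le_add (mul_le_mul_of_nonneg_left q₁ (by positivity)) ?_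
    calc _ ≤ e₁ / c * (7 * (u + v)) := mul_le_mul_of_nonneg_left q₂ (by positivity)
      _ = _ := by ring
  set C₀ := (2 * ρ₁ + 7) + (τ * (2 * (e₁ * (e₁ / τ * ρ₂))) + 7)
    + τ / l * (2 * (e₁ / (τ * c) * ρ₃) + 7 * (e₁ / c) + e₁) with hC₀
  have hC : boundConst τ L B c₁ c₂ c K m = C₀ * Real.exp (2 / τ) := rfl
  have hC₀0 : 0 ≤ C₀ := by positivity
  set cr := errTermCross τ E' qt (popularity p S) S
  have hcr : 0 ≤ cr := errTermCross_nonneg _ _ _ _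
  have hgap₂ : |empRisk τ E' qt S - trueRisk τ Y P E'| ≤ C₀ * (u + v + cr) := by
    refine (hgap.trans (add_le_add (add_le_add d₁' d₂') (mul_le_mul_of_nonneg_left
      (add_le_add le_rfl d₃') (by positivity)))).trans ?_
    have hw : 0 ≤ u + v := by positivity
    have t₁ : 0 ≤ τ / l * e₁ * (u + v) := by positivity
    have t₂ : 0 ≤ ((2 * ρ₁ + 7) + (τ * (2 * (e₁ * (e₁ / τ * ρ₂))) + 7)
      + τ / l * (2 * (e₁ / (τ * c) * ρ₃) + 7 * (e₁ / c))) * cr := by positivity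
    rw [hC₀]
    linarith
  have he₂ : 1 ≤ Real.exp (2 / τ) := Real.one_le_exp (by positivity)
  have hn1 : 0 ≤ 1 / (n : ℝ) := by positivity
  have hw : 0 ≤ 1 / (n : ℝ) + u + v := by positivity
  -- The decomposition yields the cross form; the factor `exp (2 / τ)` reserved in the constant pays
  -- for the diagonal form.
  have hce := errTermCross_le hτ hE qt (popularity p S) S
  have hwe : u + v ≤ Real.exp (2 / τ) * (1 / n + u + v) := by
    have := le_mul_of_one_le_left hw he₂
    linarith
  have hcre := le_mul_of_one_le_left hcr he₂
  rw [hC, mul_assoc, mul_assoc]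
  constructor
  · refine hgap₂.trans (mul_le_mul_of_nonneg_left ?_ hC₀0)
    rw [mul_add]
    exact add_le_add hwe hce
  · refine hgap₂.trans (mul_le_mul_of_nonneg_left ?_ hC₀0)
    rw [mul_add]
    exact add_le_add hwe hcre

end Bound

/-! ### The error term of the uniform choice -/

section Averages

variable {Z : Type*} [MeasurableSpace Z] (P : Measure Z) [IsProbabilityMeasure P]

theorem measurePreserving_infinitePi_fin (n : ℕ) :
    MeasurePreserving (fun (ω : ℕ → Z) (j : Fin n) => ω j) (Measure.infinitePi fun _ : ℕ => P)
      (Measure.pi fun _ : Fin n => P) := by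
  refine ⟨by fun_prop, ?_⟩
  have := Measure.map_infinitePi_infinitePi_of_inj (P := fun _ : ℕ => P)
    (f := fun j : Fin n => (j : ℕ)) Fin.val_injective
  exact this.trans (Measure.infinitePi_eq_pi _)

/-- The strong law with one extra summand `u₀` and denominator `n + 1`. In the application `u₀` is
the term `p(y_j ∣ x_j)` that a popularity contains besides those of the other sample points. -/
theorem ae_tendsto_average_infinitePi {u : Z → ℝ} (hu : Measurable u) (hi : Integrable u P)
    (u₀ : ℝ) :
    ∀ᵐ ω ∂(Measure.infinitePi fun _ : ℕ => P), Tendsto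
      (fun n : ℕ => (u₀ + ∑ j : Fin n, u (ω j)) / ((n : ℝ) + 1)) atTop (𝓝 (∫ z, u z ∂P)) := by
  have hev := fun i : ℕ => measurePreserving_eval_infinitePi (fun _ : ℕ => P) i
  have hlaw := ProbabilityTheory.strong_law_ae_real (μ := Measure.infinitePi fun _ : ℕ => P)
    (fun i ω => u (ω i)) ((hev 0).integrable_comp_of_integrable hi)
    (fun i j hij => (ProbabilityTheory.iIndepFun_infinitePi (P := fun _ : ℕ => P)
      (X := fun _ => u) fun _ => hu).indepFun hij)
    (fun i => ⟨(hu.comp (hev i).measurable).aemeasurable, (hu.comp (hev 0).measurable).aemeasurable,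
      by
        change Measure.map (u ∘ (Function.eval i : (ℕ → Z) → Z)) _ =
          Measure.map (u ∘ (Function.eval 0 : (ℕ → Z) → Z)) _
        rw [← Measure.map_map hu (hev i).measurable, ← Measure.map_map hu (hev 0).measurable,
          (hev i).map_eq, (hev 0).map_eq]⟩)
  have hmean : ∫ ω : ℕ → Z, u (ω 0) ∂(Measure.infinitePi fun _ : ℕ => P) = ∫ z, u z ∂P := by
    have := integral_map (μ := Measure.infinitePi fun _ : ℕ => P) (hev 0).measurable.aemeasurable
      (f := u) (by rw [(hev 0).map_eq]; exact hu.aestronglyMeasurable)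
    rw [(hev 0).map_eq] at this
    exact this.symm
  filter_upwards [hlaw] with ω hω
  rw [hmean] at hω
  have h₁ : Tendsto (fun n : ℕ => u₀ / ((n : ℝ) + 1)) atTop (𝓝 0) :=
    tendsto_const_nhds.div_atTop
      (tendsto_atTop_add_const_right _ _ tendsto_natCast_atTop_atTop)
  have h₂ := h₁.add (hω.mul (tendsto_natCast_div_add_atTop (1 : ℝ)))
  rw [zero_add, mul_one] at h₂
  refine h₂.congr' ?_
  filter_upwards [eventually_gt_atTop 0] with n hn
  have : (0 : ℝ) < n := by exact_mod_cast hn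
  rw [Finset.sum_range (fun i => u (ω i))]
  field_simp

/-- The infinite product puts all sample sizes on one space, where the averages converge almost
surely. Boundedness of `G` then allows dominated convergence. -/
theorem tendsto_integral_average {u : Z → ℝ} (hu : Measurable u) (hi : Integrable u P)
    (u₀ : ℝ) {G : ℝ → ℝ} (hG : Measurable G) (hGb : ∀ t, |G t| ≤ 1)
    (hGc : ContinuousAt G (∫ z, u z ∂P)) :
    Tendsto (fun n : ℕ => ∫ S : Fin n → Z, |G ((u₀ + ∑ j, u (S j)) / ((n : ℝ) + 1))
      - G (∫ z, u z ∂P)| ∂(Measure.pi fun _ : Fin n => P)) atTop (𝓝 0) := by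
  have hm : ∀ n : ℕ, Measurable fun S : Fin n → Z => |G ((u₀ + ∑ j, u (S j)) / ((n : ℝ) + 1))
      - G (∫ z, u z ∂P)| := fun n =>
    ((hG.comp ((measurable_const.add (Finset.measurable_fun_sum _ fun j _ =>
      hu.comp (measurable_pi_apply j))).div_const _)).sub measurable_const).abs
  have e : ∀ n : ℕ, ∫ S : Fin n → Z, |G ((u₀ + ∑ j, u (S j)) / ((n : ℝ) + 1))
      - G (∫ z, u z ∂P)| ∂(Measure.pi fun _ : Fin n => P) =
      ∫ ω : ℕ → Z, |G ((u₀ + ∑ j : Fin n, u (ω j)) / ((n : ℝ) + 1))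
      - G (∫ z, u z ∂P)| ∂(Measure.infinitePi fun _ : ℕ => P) := fun n => by
    rw [← (measurePreserving_infinitePi_fin P n).map_eq, integral_map
      (measurePreserving_infinitePi_fin P n).measurable.aemeasurable (hm n).aestronglyMeasurable]
  simp_rw [e]
  have := tendsto_integral_of_dominated_convergence (μ := Measure.infinitePi fun _ : ℕ => P)
    (F := fun n ω => |G ((u₀ + ∑ j : Fin n, u (ω j)) / ((n : ℝ) + 1)) - G (∫ z, u z ∂P)|)
    (f := fun _ => 0) (fun _ => 2)
    (fun n => ((hm n).comp (measurePreserving_infinitePi_fin P n).measurable).aestronglyMeasurable)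
    (integrable_const _) (fun n => ae_of_all _ fun ω => ?_) ?_
  · simpa using this
  · rw [Real.norm_eq_abs, abs_abs]
    exact (abs_sub _ _).trans ((add_le_add (hGb _) (hGb _)).trans (by norm_num))
  · filter_upwards [ae_tendsto_average_infinitePi P hu hi u₀] with ω hω
    have := ((hGc.tendsto.comp hω).sub_const (G (∫ z, u z ∂P))).abs
    simpa using this

theorem signAvg_sum_mul {n : ℕ} (a : ℝ) (x : Fin n → ℝ) :
    signAvg n (fun ε => a + ∑ j, ε j * x j) = a := by
  induction n generalizing a with
  | zero => simp [signAvg]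
  | succ n ih =>
    simp only [signAvg, Fin.sum_univ_succ, Fin.cons_zero, Fin.cons_succ, ← add_assoc]
    rw [ih, ih]; ring

/-- A lower tail bound for averages of bounded functions. -/
theorem measure_sum_lt_le {f : Z → ℝ} (hf : Measurable f) (hb : ∀ z, |f z| ≤ 1) (n : ℕ) {s : ℝ}
    (hs : 0 ≤ s) :
    (Measure.pi fun _ : Fin n => P) {S | ∑ j, f (S j) < n * ∫ z, f z ∂P - s} ≤
      ENNReal.ofReal (Real.exp (-s ^ 2 / (2 * (n * (2 * 1) ^ 2)))) := by
  -- A class with a single member has Rademacher average exactly `0`, so `r = 0`.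
  have := measure_exists_lt_sum_le_of_fintype (T := Unit) (fun _ : Fin n => P)
    (f := fun _ _ z => -f z) (fun _ _ => hf.neg) (b := 1)
    (fun _ _ z => by rw [abs_neg]; exact hb z) (r := 0)
    (ae_of_all _ fun S s => by
      have := signAvg_sum_mul 0 fun j => -f (S j)
      simp only [zero_add] at this
      exact this.le) hs
  refine (measure_mono ?_).trans this
  intro S hS
  refine ⟨(), ?_⟩
  rw [Set.mem_ofPred_eq] at hS
  simp only [integral_neg, Finset.sum_sub_distrib, Finset.sum_neg_distrib, Finset.sum_const,
    Finset.card_univ, Fintype.card_fin, nsmul_eq_mul]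
  linarith

end Averages

/-! ### The marginal density and the limit of the popularities -/

section Marginal

variable {a b : ℕ} {X : Set (Vec a)} {Y : Set (Vec b)} {P : Measure (Vec a × Vec b)}
  {p : Vec a → Vec b → ℝ}

/-- The law of `y` has this function as its density: it gives no mass to the zero set, and the
density is finite almost everywhere because its integral is `1`. -/
theorem IsDataModel.ae_lintegral_density (h : IsDataModel X Y P p)
    [IsFiniteMeasure (refMeasure Y)] :
    ∀ᵐ z ∂P, ∫⁻ x, ENNReal.ofReal (p x z.2) ∂P.fst ≠ 0 ∧
      ∫⁻ x, ENNReal.ofReal (p x z.2) ∂P.fst ≠ ⊤ := by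
  have := h.isProbabilityMeasure
  have hm : Measurable fun y => ∫⁻ x, ENNReal.ofReal (p x y) ∂P.fst :=
    h.measurable_ofReal_uncurry.lintegral_prod_left'
  have hP : ∀ N : Set (Vec b), MeasurableSet N → P (Prod.snd ⁻¹' N) =
      ∫⁻ y in N, ∫⁻ x, ENNReal.ofReal (p x y) ∂P.fst ∂(refMeasure Y) := by
    intro N hN
    conv_lhs => rw [h.eq_withDensity]
    rw [withDensity_apply _ (measurable_snd hN), ← Set.univ_prod, ← Measure.prod_restrict,
      Measure.restrict_univ, lintegral_prod_symm _ h.measurable_ofReal_uncurry.aemeasurable]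
  refine Filter.Eventually.and ?_ ?_
  · have hN : MeasurableSet {y | ∫⁻ x, ENNReal.ofReal (p x y) ∂P.fst = 0} :=
      hm (measurableSet_singleton 0)
    have : P (Prod.snd ⁻¹' {y | ∫⁻ x, ENNReal.ofReal (p x y) ∂P.fst = 0}) = 0 := by
      rw [hP _ hN, setLIntegral_congr_fun hN (g := fun _ => 0) fun y hy => hy]
      simp
    rw [ae_iff]
    simpa using this
  · refine h.ae_of_ae_prod (Measure.quasiMeasurePreserving_snd.ae (p := fun y =>
      ∫⁻ x, ENNReal.ofReal (p x y) ∂P.fst ≠ ⊤) ?_)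
    refine (ae_lt_top hm ?_).mono fun y hy => hy.ne
    have := hP Set.univ MeasurableSet.univ
    rw [Measure.restrict_univ] at this
    rw [← this]
    exact measure_ne_top _ _

theorem IsDataModel.integral_density_eq (h : IsDataModel X Y P p) (y : Vec b) :
    ∫ x, p x y ∂P.fst = (∫⁻ x, ENNReal.ofReal (p x y) ∂P.fst).toReal :=
  integral_eq_lintegral_of_nonneg_ae (ae_of_all _ fun x => h.density_nonneg x y)
    (h.measurable_density.comp measurable_prodMk_right).aestronglyMeasurable

theorem IsDataModel.measurable_marginal (h : IsDataModel X Y P p) :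
    Measurable fun y => ∫ x, p x y ∂P.fst := by
  have := h.isProbabilityMeasure
  simp only [h.integral_density_eq]
  exact (Measurable.lintegral_prod_left' h.measurable_ofReal_uncurry).ennreal_toReal

theorem IsDataModel.ae_marginal (h : IsDataModel X Y P p) [IsFiniteMeasure (refMeasure Y)] :
    ∀ᵐ z ∂P, 0 < ∫ x, p x z.2 ∂P.fst ∧ Integrable (fun x => p x z.2) P.fst := by
  filter_upwards [h.ae_lintegral_density] with z hz
  rw [h.integral_density_eq]
  refine ⟨ENNReal.toReal_pos hz.1 hz.2,
    (h.measurable_density.comp measurable_prodMk_right).aestronglyMeasurable, ?_⟩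
  rw [hasFiniteIntegral_iff_ofReal (ae_of_all _ fun x => h.density_nonneg x z.2)]
  exact lt_top_iff_ne_top.2 hz.2

/-- The mean deviation, at one point of a sample of size `n + 1`, of a function of the average
popularity from its limit tends to zero. -/
theorem IsDataModel.tendsto_popularity_deviation (h : IsDataModel X Y P p)
    [IsFiniteMeasure (refMeasure Y)] {G : ℝ → ℝ} (hG : Measurable G) (hGb : ∀ t, |G t| ≤ 1)
    (hGc : ∀ t, 0 < t → ContinuousAt G t) :
    Tendsto (fun n : ℕ => ∫ z, ∫ S : Fin n → Vec a × Vec b,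
      |G ((p z.1 z.2 + ∑ j, p (S j).1 z.2) / ((n : ℝ) + 1)) - G (∫ x, p x z.2 ∂P.fst)|
        ∂(Measure.pi fun _ : Fin n => P) ∂P) atTop (𝓝 0) := by
  have := h.isProbabilityMeasure
  have hb : ∀ s t, |(|G s - G t|)| ≤ 2 := fun s t => by
    rw [abs_abs]; exact (abs_sub _ _).trans (by linarith [hGb s, hGb t])
  have hfst : MeasurePreserving Prod.fst P P.fst := ⟨measurable_fst, rfl⟩
  have hlim := tendsto_integral_of_dominated_convergence (μ := P)
    (F := fun (n : ℕ) z => ∫ S : Fin n → Vec a × Vec b,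
      |G ((p z.1 z.2 + ∑ j, p (S j).1 z.2) / ((n : ℝ) + 1)) - G (∫ x, p x z.2 ∂P.fst)|
        ∂(Measure.pi fun _ : Fin n => P))
    (f := fun _ => 0) (fun _ => 2) (fun n => ?_) (integrable_const _)
    (fun n => ae_of_all _ fun z => ?_) ?_
  · simpa using hlim
  · refine (StronglyMeasurable.integral_prod_right (f := fun (z : Vec a × Vec b)
      (S : Fin n → Vec a × Vec b) => |G ((p z.1 z.2 + ∑ j, p (S j).1 z.2) / ((n : ℝ) + 1))
        - G (∫ x, p x z.2 ∂P.fst)|) (Measurable.stronglyMeasurable ?_)).aestronglyMeasurable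
    have m₁ : Measurable fun q : (Vec a × Vec b) × (Fin n → Vec a × Vec b) =>
        ∑ j, p (q.2 j).1 q.1.2 := Finset.measurable_fun_sum _ fun j _ =>
      h.measurable_density.comp ((measurable_fst.comp ((measurable_pi_apply j).comp
        measurable_snd)).prodMk (measurable_snd.comp measurable_fst))
    exact ((hG.comp (((h.measurable_density.comp measurable_fst).add m₁).div_const _)).sub
      (hG.comp (h.measurable_marginal.comp (measurable_snd.comp measurable_fst)))).abs
  · have := norm_integral_le_of_norm_le_const (μ := Measure.pi fun _ : Fin n => P)
      (f := fun S : Fin n → Vec a × Vec b =>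
        |G ((p z.1 z.2 + ∑ j, p (S j).1 z.2) / ((n : ℝ) + 1)) - G (∫ x, p x z.2 ∂P.fst)|)
      (ae_of_all _ fun S => hb _ _)
    simpa using this
  · filter_upwards [h.ae_marginal] with z hz
    have hm : Measurable fun x => p x z.2 := h.measurable_density.comp measurable_prodMk_right
    have hmean : ∫ w : Vec a × Vec b, p w.1 z.2 ∂P = ∫ x, p x z.2 ∂P.fst := by
      rw [Measure.fst, integral_map measurable_fst.aemeasurable hm.aestronglyMeasurable]
    have := tendsto_integral_average P (u := fun w => p w.1 z.2) (hm.comp measurable_fst)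
      (hfst.integrable_comp_of_integrable hz.2) (p z.1 z.2) hG hGb
      (by rw [hmean]; exact hGc _ hz.1)
    rwa [hmean] at this

/-- Separating the `j`-th point `z` leaves `n` independent points, and the popularity becomes `p z.1
z.2` plus a sum over them. The right-hand side does not depend on `j`. -/
theorem IsDataModel.integral_popularity_deviation (h : IsDataModel X Y P p) {G : ℝ → ℝ}
    (hG : Measurable G) (hGb : ∀ t, |G t| ≤ 1) (n : ℕ) (j : Fin (n + 1)) :
    ∫ S : Fin (n + 1) → Vec a × Vec b, |G (popularity p S j / ((n : ℝ) + 1))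
        - G (∫ x, p x (S j).2 ∂P.fst)| ∂(Measure.pi fun _ => P) =
      ∫ z, ∫ S : Fin n → Vec a × Vec b,
      |G ((p z.1 z.2 + ∑ j, p (S j).1 z.2) / ((n : ℝ) + 1)) - G (∫ x, p x z.2 ∂P.fst)|
        ∂(Measure.pi fun _ : Fin n => P) ∂P := by
  have := h.isProbabilityMeasure
  have hp := (measurePreserving_piFinSuccAbove (fun _ : Fin (n + 1) => P) j).symm
  have hm : Measurable fun S : Fin (n + 1) → Vec a × Vec b =>
      |G (popularity p S j / ((n : ℝ) + 1)) - G (∫ x, p x (S j).2 ∂P.fst)| :=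
    ((hG.comp ((h.measurable_popularity j).div_const _)).sub (hG.comp
      (h.measurable_marginal.comp (measurable_snd.comp (measurable_pi_apply j))))).abs
  rw [← hp.integral_comp', integral_prod]
  · refine integral_congr_ae (ae_of_all _ fun z => integral_congr_ae (ae_of_all _ fun S => ?_))
    simp only [MeasurableEquiv.piFinSuccAbove_symm_apply, Fin.insertNthEquiv, Equiv.coe_fn_mk,
      popularity, densitySum, Fin.sum_univ_succAbove _ j, Fin.insertNth_apply_same,
      Fin.insertNth_apply_succAbove]
  · refine integrable_of_abs_le (hm.comp (MeasurableEquiv.measurable _)) (M := 2) fun q => ?_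
    rw [abs_abs]
    exact (abs_sub _ _).trans ((add_le_add (hGb _) (hGb _)).trans (by norm_num))

end Marginal

/-! ### Lower bounds by the reciprocal weight error -/

section ErrTermLower

variable {a b n : ℕ} {τ : ℝ} {E : Vec a → Vec b → ℝ} {S : Fin n → Vec a × Vec b}

theorem exp_mul_sum_le_errTerm (hτ : 0 < τ) (hn : 0 < n)
    (hE : ∀ i j, -1 ≤ E (S i).1 (S j).2) (qt q : Fin n → ℝ) :
    Real.exp (-2 / τ) * ∑ j, |1 / qt j - 1 / q j| ≤ errTerm τ E qt q S ∧
      Real.exp (-2 / τ) * ∑ j, |1 / qt j - 1 / q j| ≤ errTermCross τ E qt q S := by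
  have hn' : (0 : ℝ) < n := by exact_mod_cast hn
  have key : ∀ F : Fin n → Fin n → ℝ, (∀ i j, -1 ≤ F i j) →
      Real.exp (-2 / τ) * ∑ j, |1 / qt j - 1 / q j| ≤
        (1 / (n : ℝ)) * ∑ i, ∑ j, |1 / qt j - 1 / q j| * Real.exp ((F i j - 1) / τ) := by
    intro F hF
    have : ∑ _i : Fin n, Real.exp (-2 / τ) * ∑ j, |1 / qt j - 1 / q j| ≤
        ∑ i, ∑ j, |1 / qt j - 1 / q j| * Real.exp ((F i j - 1) / τ) := by
      refine Finset.sum_le_sum fun i _ => ?_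
      rw [Finset.mul_sum]
      refine Finset.sum_le_sum fun j _ => ?_
      rw [mul_comm]
      refine mul_le_mul_of_nonneg_left (Real.exp_le_exp.2 ?_) (abs_nonneg _)
      exact div_le_div_of_nonneg_right (by linarith [hF i j]) hτ.le
    rw [Finset.sum_const, Finset.card_univ, Fintype.card_fin, nsmul_eq_mul] at this
    rw [one_div, ← div_eq_inv_mul, le_div_iff₀ hn', mul_comm]
    exact this
  exact ⟨key (fun i _ => E (S i).1 (S i).2) fun i _ => hE i i, key (fun i j => E (S i).1 (S j).2) hE⟩

end ErrTermLower

/-- The truncated distance between the reciprocals of `κ` and `t`. -/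
noncomputable def recipGap (κ t : ℝ) : ℝ := min 1 |1 / κ - 1 / t|

section RecipGap

variable {κ : ℝ}

theorem recipGap_nonneg (κ t : ℝ) : 0 ≤ recipGap κ t := le_min zero_le_one (abs_nonneg _)

theorem abs_recipGap_le (κ t : ℝ) : |recipGap κ t| ≤ 1 := by
  rw [abs_of_nonneg (recipGap_nonneg κ t)]
  exact min_le_left _ _

theorem measurable_recipGap (κ : ℝ) : Measurable (recipGap κ) := by
  unfold recipGap
  fun_prop

theorem continuousAt_recipGap (κ : ℝ) {t : ℝ} (ht : 0 < t) : ContinuousAt (recipGap κ) t := by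
  unfold recipGap
  exact continuousAt_const.min ((continuousAt_const.sub
    (continuousAt_const.div continuousAt_id ht.ne')).abs)

theorem eq_of_recipGap_eq_zero {t : ℝ} (h : recipGap κ t = 0) : t = κ := by
  unfold recipGap at h
  rcases min_choice 1 |1 / κ - 1 / t| with h' | h'
  · rw [h'] at h
    exact absurd h one_ne_zero
  · rw [h', abs_eq_zero, sub_eq_zero, one_div, one_div, inv_inj] at h
    exact h.symm

/-- Rescaling by `n` turns one summand of the weight error into the distance of reciprocals at the
normalized popularity, which has a limit. Truncation at `1` makes the gap bounded without a lower
bound on the popularity, as the limit theorems require. -/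
theorem recipGap_div_le {n : ℕ} (hn : 0 < n) (κ q : ℝ) :
    recipGap κ (q / n) ≤ n * |1 / (n * κ) - 1 / q| := by
  have hn' : (0 : ℝ) < n := by exact_mod_cast hn
  refine (min_le_right _ _).trans (le_of_eq ?_)
  rw [← abs_of_pos hn', ← abs_mul, abs_of_pos hn']
  congr 1
  rw [mul_sub, one_div_div, mul_one_div, mul_one_div, ← div_div, div_self hn'.ne']

end RecipGap

section Uniform

variable {σ : ℝ → ℝ} {L : ℕ} {d₁ d₂ : ℕ → ℕ} {B : ℕ → ℝ} {X : Set (Vec (d₁ 0))}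
  {Y : Set (Vec (d₂ 0))} {P : Measure (Vec (d₁ 0) × Vec (d₂ 0))}
  {p : Vec (d₁ 0) → Vec (d₂ 0) → ℝ} {τ κ c₂ : ℝ}

theorem IsDataModel.integral_recipGap_pos (h : IsDataModel X Y P p)
    (hne : ¬ ∀ᵐ z ∂P, ∫ x, p x z.2 ∂P.fst = κ) :
    0 < ∫ z, recipGap κ (∫ x, p x z.2 ∂P.fst) ∂P := by
  have := h.isProbabilityMeasure
  have h0 : ∀ z : Vec (d₁ 0) × Vec (d₂ 0), 0 ≤ recipGap κ (∫ x, p x z.2 ∂P.fst) :=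
    fun z => recipGap_nonneg _ _
  refine (integral_nonneg h0).lt_of_ne fun h' => hne ?_
  have hi : Integrable (fun z : Vec (d₁ 0) × Vec (d₂ 0) => recipGap κ (∫ x, p x z.2 ∂P.fst)) P :=
    integrable_of_abs_le ((measurable_recipGap κ).comp (h.measurable_marginal.comp measurable_snd))
      fun z => abs_recipGap_le _ _
  filter_upwards [(integral_eq_zero_iff_of_nonneg h0 hi).1 h'.symm] with z hz
  exact eq_of_recipGap_eq_zero hz

/-- If both averages are close to their limits, then the error terms of the uniform choice are
bounded below. -/
theorem le_errTerm_uniform (hτ : 0 < τ) {n : ℕ} (hn : 0 < n) (hd : d₁ L = d₂ L)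
    {S : Fin n → Vec (d₁ 0) × Vec (d₂ 0)} (hS : ∀ j, (S j).1 ∈ X ∧ (S j).2 ∈ Y)
    {W₁ : Weights d₁} (h₁ : W₁ ∈ encoders σ L B d₁ X) {W₂ : Weights d₂}
    (h₂ : W₂ ∈ encoders σ L B d₂ Y) {θ : ℝ}
    (hA : ∑ j, |recipGap κ (popularity p S j / n) - recipGap κ (∫ x, p x (S j).2 ∂P.fst)|
      ≤ n * θ / 4)
    (hB : n * θ / 2 ≤ ∑ j, recipGap κ (∫ x, p x (S j).2 ∂P.fst)) :
    Real.exp (-2 / τ) * (θ / 4) ≤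
        errTerm τ (energy σ L hd W₁ W₂) (fun _ => n * κ) (popularity p S) S ∧
      Real.exp (-2 / τ) * (θ / 4) ≤
        errTermCross τ (energy σ L hd W₁ W₂) (fun _ => n * κ) (popularity p S) S := by
  have hn' : (0 : ℝ) < n := by exact_mod_cast hn
  have hE : ∀ i j, -1 ≤ energy σ L hd W₁ W₂ (S i).1 (S j).2 := fun i j =>
    (abs_le.1 (abs_energy_le hd (h₁.2 _ (hS i).1) (h₂.2 _ (hS j).2))).1
  -- The average gap at the marginal density is at least `θ / 2`, and passing to the normalized
  -- popularities loses at most `θ / 4`.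
  have key : θ / 4 ≤ ∑ j, |1 / (n * κ) - 1 / popularity p S j| := by
    have e₁ : ∑ j, recipGap κ (∫ x, p x (S j).2 ∂P.fst) ≤
        ∑ j, |recipGap κ (popularity p S j / n) - recipGap κ (∫ x, p x (S j).2 ∂P.fst)|
          + n * ∑ j, |1 / (n * κ) - 1 / popularity p S j| := by
      rw [Finset.mul_sum, ← Finset.sum_add_distrib]
      refine Finset.sum_le_sum fun j _ => ?_
      have := neg_abs_le
        (recipGap κ (popularity p S j / n) - recipGap κ (∫ x, p x (S j).2 ∂P.fst))
      linarith [recipGap_div_le hn κ (popularity p S j)]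
    have e₂ : n * (θ / 4) ≤ n * ∑ j, |1 / (n * κ) - 1 / popularity p S j| := by linarith
    exact le_of_mul_le_mul_left e₂ hn'
  have := mul_le_mul_of_nonneg_left key (Real.exp_pos (-2 / τ)).le
  have := exp_mul_sum_le_errTerm hτ hn hE (fun _ => n * κ) (popularity p S)
  constructor <;> linarith [this.1, this.2]

/-- Markov's inequality for the sum over `j`, all of whose terms have the same mean. -/
theorem measure_popularity_deviation_le (h : IsDataModel X Y P p) {G : ℝ → ℝ}
    (hG : Measurable G) (hGb : ∀ t, |G t| ≤ 1) (n : ℕ) {θ : ℝ} (hθ : 0 < θ) :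
    (Measure.pi fun _ : Fin (n + 1) => P) {S | ((n + 1 : ℕ) : ℝ) * θ / 4 ≤
        ∑ j, |G (popularity p S j / ((n + 1 : ℕ) : ℝ)) - G (∫ x, p x (S j).2 ∂P.fst)|} ≤
      ENNReal.ofReal ((∫ z, ∫ S : Fin n → Vec (d₁ 0) × Vec (d₂ 0),
        |G ((p z.1 z.2 + ∑ j, p (S j).1 z.2) / ((n : ℝ) + 1)) - G (∫ x, p x z.2 ∂P.fst)|
          ∂(Measure.pi fun _ : Fin n => P) ∂P) * (4 / θ)) := by
  have := h.isProbabilityMeasure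
  push_cast
  have hn : (0 : ℝ) < (n : ℝ) + 1 := by positivity
  have hi : ∀ j : Fin (n + 1), Integrable (fun S : Fin (n + 1) → Vec (d₁ 0) × Vec (d₂ 0) =>
      |G (popularity p S j / ((n : ℝ) + 1)) - G (∫ x, p x (S j).2 ∂P.fst)|)
      (Measure.pi fun _ => P) := fun j => by
    refine integrable_of_abs_le (M := 2) ((hG.comp
      ((h.measurable_popularity j).div_const _)).sub (hG.comp (h.measurable_marginal.comp
        (measurable_snd.comp (measurable_pi_apply j))))).abs fun S => ?_
    rw [abs_abs]
    exact (abs_sub _ _).trans ((add_le_add (hGb _) (hGb _)).trans (by norm_num))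
  have hM := mul_meas_ge_le_integral_of_nonneg (μ := Measure.pi fun _ : Fin (n + 1) => P)
    (ae_of_all _ fun S => Finset.sum_nonneg fun j _ => abs_nonneg
      (G (popularity p S j / ((n : ℝ) + 1)) - G (∫ x, p x (S j).2 ∂P.fst)))
    (integrable_finsetSum Finset.univ fun j _ => hi j) (((n : ℝ) + 1) * θ / 4)
  rw [integral_finsetSum _ fun j _ => hi j] at hM
  simp only [h.integral_popularity_deviation hG hGb, Finset.sum_const, Finset.card_univ,
    Fintype.card_fin, nsmul_eq_mul] at hM
  push_cast at hM
  rw [← ofReal_measureReal]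
  refine ENNReal.ofReal_le_ofReal ?_
  rw [mul_div_assoc, mul_assoc] at hM
  have := le_of_mul_le_mul_left hM hn
  rw [← mul_div_assoc, le_div_iff₀ hθ]
  rw [mul_div_assoc]
  linarith

theorem exists_tendsto_measure_errTerm_lt (hτ : 0 < τ) (hd : d₁ L = d₂ L)
    (hY : ∀ y ∈ Y, ‖y‖ ≤ c₂) (h : IsDataModel X Y P p)
    (hne : ¬ ∀ᵐ z ∂P, ∫ x, p x z.2 ∂P.fst = κ) :
    ∃ η : ℝ, 0 < η ∧ Tendsto (fun n : ℕ => (Measure.pi fun _ : Fin n => P)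
      {S | ∃ W₁ ∈ encoders σ L B d₁ X, ∃ W₂ ∈ encoders σ L B d₂ Y,
        errTerm τ (energy σ L hd W₁ W₂) (fun _ => n * κ) (popularity p S) S < η ∨
        errTermCross τ (energy σ L hd W₁ W₂) (fun _ => n * κ) (popularity p S) S < η})
      atTop (𝓝 0) := by
  have := h.isProbabilityMeasure
  have := isFiniteMeasure_refMeasure hY
  have hθ := h.integral_recipGap_pos hne
  set θ := ∫ z, recipGap κ (∫ x, p x z.2 ∂P.fst) ∂P with hθ_def
  -- Sizes are shifted to `n + 1`, so that one sample point can be singled out and `n` independent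
  -- ones remain.
  refine ⟨Real.exp (-2 / τ) * (θ / 4), by positivity, (tendsto_add_atTop_iff_nat 1).1 ?_⟩
  have hGm : Measurable fun z : Vec (d₁ 0) × Vec (d₂ 0) => recipGap κ (∫ x, p x z.2 ∂P.fst) :=
    (measurable_recipGap κ).comp (h.measurable_marginal.comp measurable_snd)
  have t₁ := ENNReal.tendsto_ofReal ((h.tendsto_popularity_deviation (measurable_recipGap κ)
    (abs_recipGap_le κ) fun t ht => continuousAt_recipGap κ ht).mul_const (4 / θ))
  have t₂ : Tendsto (fun n : ℕ => ENNReal.ofReal (Real.exp (-(((n + 1 : ℕ) : ℝ) * θ / 2) ^ 2 /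
      (2 * (((n + 1 : ℕ) : ℝ) * (2 * 1) ^ 2))))) atTop (𝓝 (ENNReal.ofReal 0)) := by
    refine ENNReal.tendsto_ofReal ((tendsto_add_atTop_iff_nat (f := fun n : ℕ =>
      Real.exp (-((n : ℝ) * θ / 2) ^ 2 / (2 * ((n : ℝ) * (2 * 1) ^ 2)))) 1).2 ?_)
    refine Real.tendsto_exp_atBot.comp ?_
    -- With `s = n θ / 2` the exponent `-s² / (8 n)` equals `-n θ² / 32`.
    have hc : 0 < θ ^ 2 / 32 := by positivity
    refine (tendsto_neg_atTop_atBot.comp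
      (tendsto_natCast_atTop_atTop.const_mul_atTop hc)).congr' ?_
    filter_upwards [eventually_gt_atTop 0] with n hn
    have : (0 : ℝ) < n := by exact_mod_cast hn
    simp only [Function.comp]
    field_simp
    ring
  rw [zero_mul] at t₁
  have t := t₁.add t₂
  rw [ENNReal.ofReal_zero, add_zero] at t
  refine tendsto_of_tendsto_of_tendsto_of_le_of_le tendsto_const_nhds t (fun n => zero_le)
    fun n => ?_
  -- Up to a null set, a small error term forces one of two events: popularities far from the
  -- marginal density on average, or an empirical mean gap below half of `θ`. Neither event involves
  -- the weights, which gives uniformity over the encoders.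
  refine (measure_mono_ae ?_).trans ((measure_union_le _ _).trans (add_le_add
    (measure_popularity_deviation_le h (measurable_recipGap κ) (abs_recipGap_le κ) n hθ)
    (measure_sum_lt_le P hGm (fun z => abs_recipGap_le _ _) (n + 1)
      (s := ((n + 1 : ℕ) : ℝ) * θ / 2) (by positivity))))
  filter_upwards [h.ae_pi_mem (n + 1)] with S hS
  rintro ⟨W₁, h₁, W₂, h₂, hlt⟩
  by_contra hcon
  obtain ⟨hA, hB⟩ := not_or.1 hcon
  rw [Set.mem_ofPred_eq, not_le] at hA
  rw [Set.mem_ofPred_eq, not_lt] at hB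
  have := le_errTerm_uniform hτ n.succ_pos hd hS h₁ h₂ hA.le (by
    rw [← hθ_def] at hB
    linarith)
  rcases hlt with hlt | hlt
  · exact absurd this.1 (not_le.2 hlt)
  · exact absurd this.2 (not_le.2 hlt)

end Uniform

end DPM

theorem theorem1 (τ : ℝ) (hτ : 0 < τ) (L : ℕ) (hL : 1 ≤ L) (B : ℕ → ℝ) (c₁ c₂ : ℝ) :
    -- the generalization bound; `C` depends only on `τ, L, B, c₁, c₂`, on the constant `c` with
    -- `q^(j) ≥ c n`, on the bound `K` for `q̃^(j) / n`, and on a lower bound `m` for `μ(Y)`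
    (∀ c K m : ℝ, 0 < c → 0 < K → 0 < m → ∃ C : ℝ, 0 < C ∧
      ∀ (d₁ d₂ : ℕ → ℕ) (hd : d₁ L = d₂ L) (σ : ℝ → ℝ)
        (X : Set (DPM.Vec (d₁ 0))) (Y : Set (DPM.Vec (d₂ 0)))
        (P : Measure (DPM.Vec (d₁ 0) × DPM.Vec (d₂ 0)))
        (p : DPM.Vec (d₁ 0) → DPM.Vec (d₂ 0) → ℝ) (n : ℕ) (δ : ℝ),
        1 ≤ d₁ L →
        (∀ a t : ℝ, 0 ≤ a → σ (a * t) = a * σ t) → LipschitzWith 1 σ →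
        (∀ x ∈ X, ‖x‖ ≤ c₁) → (∀ y ∈ Y, ‖y‖ ≤ c₂) →
        ENNReal.ofReal m ≤ DPM.refMeasure Y Set.univ →
        DPM.IsDataModel X Y P p →
        1 ≤ n →
        (∀ᵐ S ∂(Measure.pi fun _ : Fin n => P), ∀ j, c * n ≤ DPM.popularity p S j) →
        (∀ᵐ S ∂(Measure.pi fun _ : Fin n => P), ∀ᵐ y ∂(DPM.refMeasure Y),
          0 < DPM.densitySum p S y) →
        0 < δ → δ < 1 →
        (Measure.pi fun _ : Fin n => P)
          {S | ¬ ∀ W₁ ∈ DPM.encoders σ L B d₁ X, ∀ W₂ ∈ DPM.encoders σ L B d₂ Y,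
            ∀ qt : Fin n → ℝ, (∀ j, 0 < qt j ∧ qt j ≤ K * n) →
              |DPM.empRisk τ (DPM.energy σ L hd W₁ W₂) qt S
                  - DPM.trueRisk τ Y P (DPM.energy σ L hd W₁ W₂)|
                ≤ C * (1 / n + √(d₁ L / n) + √(Real.log (1 / δ) / n)
                  + DPM.errTerm τ (DPM.energy σ L hd W₁ W₂) qt (DPM.popularity p S) S) ∧
              |DPM.empRisk τ (DPM.energy σ L hd W₁ W₂) qt S
                  - DPM.trueRisk τ Y P (DPM.energy σ L hd W₁ W₂)|
                ≤ C * (1 / n + √(d₁ L / n) + √(Real.log (1 / δ) / n)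
                  + DPM.errTermCross τ (DPM.energy σ L hd W₁ W₂) qt (DPM.popularity p S) S)}
          ≤ ENNReal.ofReal δ) ∧
    -- the error term of the uniform choice `q̃^(j) = n κ` does not vanish as `n → ∞`, unless the
    -- marginal density of `y` is almost surely equal to `κ`
    (∀ (d₁ d₂ : ℕ → ℕ) (hd : d₁ L = d₂ L) (σ : ℝ → ℝ)
        (X : Set (DPM.Vec (d₁ 0))) (Y : Set (DPM.Vec (d₂ 0)))
        (P : Measure (DPM.Vec (d₁ 0) × DPM.Vec (d₂ 0)))
        (p : DPM.Vec (d₁ 0) → DPM.Vec (d₂ 0) → ℝ) (κ : ℝ),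
        1 ≤ d₁ L →
        (∀ a t : ℝ, 0 ≤ a → σ (a * t) = a * σ t) → LipschitzWith 1 σ →
        (∀ x ∈ X, ‖x‖ ≤ c₁) → (∀ y ∈ Y, ‖y‖ ≤ c₂) →
        DPM.IsDataModel X Y P p →
        0 < κ →
        (¬ ∀ᵐ z ∂P, ∫ x, p x z.2 ∂P.fst = κ) →
        ∃ η : ℝ, 0 < η ∧
          Tendsto (fun n : ℕ => (Measure.pi fun _ : Fin n => P)
            {S | ∃ W₁ ∈ DPM.encoders σ L B d₁ X, ∃ W₂ ∈ DPM.encoders σ L B d₂ Y,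
              DPM.errTerm τ (DPM.energy σ L hd W₁ W₂)
                  (fun _ => n * κ) (DPM.popularity p S) S < η ∨
              DPM.errTermCross τ (DPM.energy σ L hd W₁ W₂)
                  (fun _ => n * κ) (DPM.popularity p S) S < η})
            atTop (𝓝 0)) := by
  refine ⟨fun c K m hc hK hm => ⟨DPM.boundConst τ L B c₁ c₂ c K m,
    DPM.boundConst_pos hτ hc hK hm L B c₁ c₂, ?_⟩, ?_⟩
  · intro d₁ d₂ hd σ X Y P p n δ hdL hσ hL₁ hX hY hmY h hn hpop hpos hδ hδ'
    exact DPM.measure_generalization_gap_le hτ hL hc hm hd hdL hσ hL₁ hX hY hmY h hn hpop hpos hδ hδ'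
  · intro d₁ d₂ hd σ X Y P p κ _ _ _ _ hY h _ hne
    exact DPM.exists_tendsto_measure_errTerm_lt hτ hd hY h hne
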